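/- Let $k$ be a field of characteristic $0$ and let $\widetilde V$ be a finite-dimensional $k$-vector space with a grading, i.e. a linear action of $k^\times$ such that $\widetilde V$ is the sum of its weight spaces of weights $n\ge 1$ (for instance, scalar multiplication). A reflection of a finite-dimensional vector space is an automorphism $g$ of finite order such that $\ker(g-1)$ is a hyperplane; a finite group acting faithfully on a vector space is a reflection group if it is generated by its elements acting as reflections. A morphism of reflection groups is a group morphism that maps each reflection to $1$ or to a reflection; an isomorphism of reflection groups is a group isomorphism between reflection groups that is, together with its inverse, a morphism of reflection groups. For a finite group $\widetilde W\subset GL(\widetilde V)$ that commutes with the action of $k^\times$, and a normal subgroup $G$ of $\widetilde W$, put $W=\widetilde W/G$ and $\widetilde V/G=\operatorname{Spec} k[\widetilde V]^G$. Let $\mathfrak m\subset k[\widetilde V]^G$ be the maximal ideal of the image of $0$, and let $V=(\mathfrak m/\mathfrak m^2)^*$ be the tangent space of $\widetilde V/G$ at that point, with the induced action of $W$. A graded $\widetilde W$-equivariant linear splitting $\sigma:V^*=\mathfrak m/\mathfrak m^2\to\mathfrak m$ of the projection $\mathfrak m\to\mathfrak m/\mathfrak m^2$ induces a surjection $A=k[V]=S(V^*)\to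 k[\widetilde V]^G$, i.e. a closed embedding $\widetilde V/G\hookrightarrow V$; let $I$ be its kernel, let $A_+\subset A$ be the ideal of the functions vanishing at $0$, and let $p:\widetilde V\to\widetilde V/G\hookrightarrow V$ be the resulting map. When $\widetilde W$ is a reflection group on $\widetilde V$, one says that $G$ is good in $\widetilde W$ if the minimal number of generators of $I$ is $\dim V-\dim\operatorname{Spec}(A/I)$ and $W$ acts trivially on $I/A_+I$. For a subset $S$ of a space with a group action, a subscript $S$ denotes the pointwise stabilizer of $S$. **Theorem.** Let $\widetilde W$ be a finite reflection group on $\widetilde V$ commuting with $k^\times$, let $G$ be a normal subgroup of $\widetilde W$, fix a graded $\widetilde W$-equivariant splitting $\sigma$ as above, with the corresponding map $p$, and suppose that $G$ is good in $\widetilde W$ (with respect to $\sigma$). 1. Let $x\in\widetilde V$. Then $\widetilde W_x$ is a reflection group on $\widetilde V$ and $G_x$ is good in $\widetilde W_x$ (graded $\widetilde W_x$-equivariant splittings for $G_x$ exist, and the conditions hold for each of them). The canonical linear map from the tangent space $T$ of $\widetilde V/G_x$ at the image of $x$ to $V$ (the differential of the map $\widetilde V/G_x\to V$ induced by $p$)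 is injective. The canonical map $\widetilde W_x/G_x\to W$ induces a group isomorphism $\widetilde W_x/G_x\to W_{p(x)}$, the map $T\to V$ is equivariant with respect to it, and it is an isomorphism of reflection groups for the action of $\widetilde W_x/G_x$ on $T$ and of $W_{p(x)}$ on $V$. 2. Let $L$ be a linear subspace of $\widetilde V$. Then $\widetilde W_L$ is a reflection group on $\widetilde V$ and $G_L$ is good in $\widetilde W_L$ (in the same sense). The canonical map $\widetilde W_L/G_L\to W$ induces an isomorphism of reflection groups $\widetilde W_L/G_L\to W_{p(L)}$, for the action of $\widetilde W_L/G_L$ on the tangent space of $\widetilde V/G_L$ at the image of $0$ and of $W_{p(L)}$ on $V$. -/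

import Mathlib

/-!
Conventions. `V` is a finite dimensional vector space over `k`, the algebra `k[V]` of polynomial
functions is the symmetric algebra of the dual of `V`, and groups of automorphisms of `V` are
subgroups of `V ≃ₗ[k] V`.
-/

noncomputable section

namespace GoodQuotient

/-! ### Reflections and reflection groups -/

section Reflections

variable {k : Type*} [Field k]

/-- A reflection: an automorphism of finite order whose fixed space is a hyperplane. -/
def IsReflection {M : Type*} [AddCommGroup M] [Module k M] (f : Module.End k M) : Prop :=
  IsOfFinOrder f ∧
    Module.finrank k (LinearMap.ker (f - 1)) + 1 = Module.finrank k M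

/-- A group `Γ` acting linearly on `M` is a reflection group on `M` if it acts faithfully and is
generated by the elements that act as reflections. -/
def IsReflectionGroup {Γ M : Type*} [Group Γ] [AddCommGroup M] [Module k M]
    (r : Representation k Γ M) : Prop :=
  Function.Injective r ∧ Subgroup.closure {γ : Γ | IsReflection (r γ)} = ⊤

/-- A morphism of groups that maps each reflection to `1` or to a reflection. -/
def IsReflectionHom {Γ M Γ' M' : Type*} [Group Γ] [AddCommGroup M] [Module k M]
    [Group Γ'] [AddCommGroup M'] [Module k M']
    (r : Representation k Γ M) (r' : Representation k Γ' M') (f : Γ →* Γ') : Prop :=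
  ∀ γ : Γ, IsReflection (r γ) → f γ = 1 ∨ IsReflection (r' (f γ))

/-- An isomorphism of reflection groups: source and target are reflection groups, and the
isomorphism and its inverse are morphisms of reflection groups. -/
def IsReflectionIso {Γ M Γ' M' : Type*} [Group Γ] [AddCommGroup M] [Module k M]
    [Group Γ'] [AddCommGroup M'] [Module k M']
    (r : Representation k Γ M) (r' : Representation k Γ' M') (e : Γ ≃* Γ') : Prop :=
  IsReflectionGroup r ∧ IsReflectionGroup r' ∧
    IsReflectionHom r r' e.toMonoidHom ∧ IsReflectionHom r' r e.symm.toMonoidHom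

end Reflections

/-! ### Polynomial functions and invariants -/

section Polynomials

/-- The action of `Γ` on the symmetric algebra of `M` induced by a linear action on `M`. -/
def symAct {k : Type*} [Field k] {Γ M : Type*} [Group Γ] [AddCommGroup M] [Module k M]
    (r : Representation k Γ M) :
    Γ →* (SymmetricAlgebra k M →ₐ[k] SymmetricAlgebra k M) where
  toFun γ := SymmetricAlgebra.lift (SymmetricAlgebra.ι k M ∘ₗ r γ)
  map_one' := by
    apply SymmetricAlgebra.algHom_ext
    ext m
    simp
  map_mul' a b := by
    apply SymmetricAlgebra.algHom_ext
    ext m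
    simp

variable {k V : Type*} [Field k] [AddCommGroup V] [Module k V]

variable (k V) in
/-- The algebra `k[V] = S(V^*)`. -/
abbrev Poly : Type _ := SymmetricAlgebra k (Module.Dual k V)

variable (k V) in
/-- The tautological action of `GL(V)` on `V`. -/
def natRep : Representation k (V ≃ₗ[k] V) V :=
  LinearEquiv.automorphismGroup.toLinearMapMonoidHom

/-- The action of `GL(V)` on `k[V]`, `(g f)(v) = f (g⁻¹ v)`. -/
def polyAct : (V ≃ₗ[k] V) →* (Poly k V →ₐ[k] Poly k V) :=
  symAct (natRep k V).dual

/-- Evaluation of polynomial functions at the point `x`. -/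
def evalAt (x : V) : Poly k V →ₐ[k] k :=
  SymmetricAlgebra.lift (Module.Dual.eval k V x)

theorem evalAt_polyAct (g : V ≃ₗ[k] V) (x : V) (f : Poly k V) :
    evalAt x (polyAct g f) = evalAt (g⁻¹ x) f := by
  have h : (evalAt x).comp (polyAct g) = evalAt (k := k) (g⁻¹ x) := by
    apply SymmetricAlgebra.algHom_ext
    ext l
    change evalAt x (symAct (natRep k V).dual g (SymmetricAlgebra.ι k _ l))
      = evalAt (g⁻¹ x) (SymmetricAlgebra.ι k _ l)
    have h1 : symAct (natRep k V).dual g (SymmetricAlgebra.ι k _ l)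
        = SymmetricAlgebra.ι k _ ((natRep k V).dual g l) := SymmetricAlgebra.lift_ι_apply _ _
    rw [h1, evalAt, evalAt, SymmetricAlgebra.lift_ι_apply, SymmetricAlgebra.lift_ι_apply]
    rfl
  exact DFunLike.congr_fun h f

/-- The algebra `k[V]^G`, that is, the algebra of the quotient `V/G = Spec k[V]^G`. -/
def invariants (G : Subgroup (V ≃ₗ[k] V)) : Subalgebra k (Poly k V) where
  carrier := {f | ∀ g ∈ G, polyAct g f = f}
  mul_mem' ha hb g hg := by rw [map_mul, ha g hg, hb g hg]
  add_mem' ha hb g hg := by rw [map_add, ha g hg, hb g hg]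
  algebraMap_mem' r g _ := AlgHom.commutes _ r

theorem polyAct_mem_invariants {G : Subgroup (V ≃ₗ[k] V)} {n : V ≃ₗ[k] V}
    (hn : n ∈ Subgroup.normalizer (G : Set (V ≃ₗ[k] V))) {f : Poly k V}
    (hf : f ∈ invariants G) : polyAct n f ∈ invariants G := by
  intro g hg
  have h1 : n⁻¹ * g * n ∈ G := by
    have := (Subgroup.mem_normalizer_iff.1 (inv_mem hn) g).1 hg
    simpa using this
  have h2 : g * n = n * (n⁻¹ * g * n) := by group
  calc polyAct g (polyAct n f) = polyAct (g * n) f := by rw [map_mul]; rfl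
    _ = polyAct n (polyAct (n⁻¹ * g * n) f) := by rw [h2, map_mul]; rfl
    _ = polyAct n f := by rw [hf _ h1]

/-- The action of the normalizer of `G` on `k[V]^G`. -/
def invAct (G : Subgroup (V ≃ₗ[k] V)) :
    Subgroup.normalizer (G : Set (V ≃ₗ[k] V)) →* (invariants G →ₐ[k] invariants G) where
  toFun n := ((polyAct (n : V ≃ₗ[k] V)).comp (invariants G).val).codRestrict (invariants G)
    fun f => polyAct_mem_invariants n.2 f.2
  map_one' := by
    ext f
    simp
  map_mul' a b := by
    ext f
    change polyAct ((a : V ≃ₗ[k] V) * (b : V ≃ₗ[k] V)) (f : Poly k V) = _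
    rw [map_mul]
    rfl

/-- The maximal ideal of `k[V]^G` of the image of `x` in `V/G`. -/
def maxIdeal (G : Subgroup (V ≃ₗ[k] V)) (x : V) : Ideal (invariants G) :=
  RingHom.ker ((evalAt x).comp (invariants G).val)

/-- The cotangent space `𝔪/𝔪²` of `V/G` at the image of `x`. -/
abbrev Cot (G : Subgroup (V ≃ₗ[k] V)) (x : V) : Type _ := (maxIdeal G x).Cotangent

/-- The tangent space of `V/G` at the image of `x`. -/
abbrev Tangent (G : Subgroup (V ≃ₗ[k] V)) (x : V) : Type _ := Module.Dual k (Cot G x)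

/-- The elements of the normalizer of `G` that fix `x`. -/
def normFix (G : Subgroup (V ≃ₗ[k] V)) (x : V) :
    Subgroup (Subgroup.normalizer (G : Set (V ≃ₗ[k] V))) where
  carrier := {n | (n : V ≃ₗ[k] V) x = x}
  one_mem' := rfl
  mul_mem' {a b} ha hb := by
    change (a : V ≃ₗ[k] V) ((b : V ≃ₗ[k] V) x) = x
    rw [hb, ha]
  inv_mem' {a} ha := by
    change (a : V ≃ₗ[k] V).symm x = x
    rw [LinearEquiv.symm_apply_eq]
    exact Eq.symm ha

theorem maxIdeal_le_comap (G : Subgroup (V ≃ₗ[k] V)) (x : V) (n : normFix G x) :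
    maxIdeal G x ≤ (maxIdeal G x).comap (invAct G n) := by
  intro f hf
  have h : ((n⁻¹ : normFix G x) : V ≃ₗ[k] V) x = x := (n⁻¹).2
  change evalAt x (polyAct _ (f : Poly k V)) = 0
  rw [evalAt_polyAct]
  exact (congrArg (fun y => evalAt y (f : Poly k V)) h).trans hf

/-- The action on the cotangent space of `V/G` at the image of `x`. -/
def cotRep (G : Subgroup (V ≃ₗ[k] V)) (x : V) : Representation k (normFix G x) (Cot G x) where
  toFun n := Ideal.mapCotangent _ _ (invAct G n) (maxIdeal_le_comap G x n)
  map_one' := by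
    ext f
    obtain ⟨f, rfl⟩ := Ideal.toCotangent_surjective _ f
    simp [Ideal.mapCotangent_toCotangent]
  map_mul' a b := by
    ext f
    obtain ⟨f, rfl⟩ := Ideal.toCotangent_surjective _ f
    simp [Ideal.mapCotangent_toCotangent]

end Polynomials

/-! ### Gradings -/

/-- A grading of `V`: a linear action of `k^×` on `V` such that `V` is the sum of the weight
spaces of strictly positive weights. -/
def IsGrading {k V : Type*} [Field k] [AddCommGroup V] [Module k V]
    (ρ : kˣ →* (V ≃ₗ[k] V)) : Prop :=
  Submodule.span k {v : V | ∃ n : ℕ, 0 < n ∧ ∀ t : kˣ, ρ t v = (t : k) ^ n • v} = ⊤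

/-! ### Pairs consisting of a group and a normal subgroup -/

/-- A subgroup `W` of `GL(V)` with a normal subgroup `G` of `W`. -/
structure NormalPair (k V : Type*) [Field k] [AddCommGroup V] [Module k V] where
  W : Subgroup (V ≃ₗ[k] V)
  G : Subgroup (V ≃ₗ[k] V)
  le : G ≤ W
  normal : (G.subgroupOf W).Normal

namespace NormalPair

variable {k V : Type*} [Field k] [AddCommGroup V] [Module k V] (P : NormalPair k V)

instance : (P.G.subgroupOf P.W).Normal := P.normal

/-- The quotient group `W/G`. -/
abbrev Quot : Type _ := P.W ⧸ P.G.subgroupOf P.W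

theorem W_le_normalizer : P.W ≤ Subgroup.normalizer (P.G : Set (V ≃ₗ[k] V)) := by
  intro w hw
  rw [Subgroup.mem_normalizer_iff]
  intro g
  constructor
  · intro hg
    exact P.normal.conj_mem ⟨g, P.le hg⟩ hg ⟨w, hw⟩
  · intro hg
    have := P.normal.conj_mem ⟨_, P.le hg⟩ hg ⟨w⁻¹, inv_mem hw⟩
    simpa [Subgroup.mem_subgroupOf, mul_assoc] using this

/-- The inclusion of `W` into the normalizer of `G`. -/
def toNorm : P.W →* Subgroup.normalizer (P.G : Set (V ≃ₗ[k] V)) :=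
  Subgroup.inclusion P.W_le_normalizer

/-- The inclusion of `W` into the group of elements of the normalizer of `G` that fix `x`. -/
def toNormFix (x : V) (hx : ∀ w ∈ P.W, w x = x) : P.W →* normFix P.G x :=
  P.toNorm.codRestrict (normFix P.G x) fun w => hx w w.2

/-- If `W` fixes `x`, then `W/G` acts on the cotangent space of `V/G` at the image of `x`. -/
def quotCotRep (x : V) (hx : ∀ w ∈ P.W, w x = x) : Representation k P.Quot (Cot P.G x) :=
  QuotientGroup.lift (P.G.subgroupOf P.W) ((cotRep P.G x).comp (P.toNormFix x hx)) (by
    intro w hw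
    refine LinearMap.ext fun f => ?_
    obtain ⟨f, rfl⟩ := Ideal.toCotangent_surjective _ f
    refine congrArg _ (Subtype.ext (Subtype.ext ?_))
    exact f.1.2 w hw)

/-- If `W` fixes `x`, then `W/G` acts on the tangent space of `V/G` at the image of `x`. -/
def tangentRep (x : V) (hx : ∀ w ∈ P.W, w x = x) : Representation k P.Quot (Tangent P.G x) :=
  (P.quotCotRep x hx).dual

/-- The action of `W/G` on the cotangent space of `V/G` at the image of `0`. -/
abbrev cotRepZero : Representation k P.Quot (Cot P.G 0) :=
  P.quotCotRep 0 fun w _ => map_zero w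

/-- The action of `W/G` on the tangent space of `V/G` at the image of `0`. -/
abbrev tangentRepZero : Representation k P.Quot (Tangent P.G 0) :=
  P.tangentRep 0 fun w _ => map_zero w

/-! ### Equivariant embeddings of `V/G` in its tangent space at the image of `0` -/

/-- A graded `W`-equivariant splitting `𝔪/𝔪² → 𝔪` of the projection `𝔪 → 𝔪/𝔪²`, for the
maximal ideal `𝔪` of `k[V]^G` at the image of `0`. -/
structure Splitting (ρ : kˣ →* (V ≃ₗ[k] V)) where
  toLin : Cot P.G 0 →ₗ[k] maxIdeal P.G 0
  section_eq : ∀ φ, (maxIdeal P.G 0).toCotangent (toLin φ) = φ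
  equivariant : ∀ n : normFix P.G 0, (n.1 : V ≃ₗ[k] V) ∈ P.W →
    ∀ φ, ((toLin (cotRep P.G 0 n φ) : maxIdeal P.G 0) : invariants P.G)
      = invAct P.G n (toLin φ : invariants P.G)
  graded : ∀ n : normFix P.G 0, (∃ t : kˣ, ρ t = (n.1 : V ≃ₗ[k] V)) →
    ∀ φ, ((toLin (cotRep P.G 0 n φ) : maxIdeal P.G 0) : invariants P.G)
      = invAct P.G n (toLin φ : invariants P.G)

namespace Splitting

variable {P} {ρ : kˣ →* (V ≃ₗ[k] V)} (σ : P.Splitting ρ)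

/-- The splitting with values in `k[V]^G`. -/
def toInv : Cot P.G 0 →ₗ[k] invariants P.G where
  toFun φ := (σ.toLin φ : invariants P.G)
  map_add' a b := by rw [map_add]; rfl
  map_smul' c a := by rw [map_smul]; rfl

/-- The morphism `A → k[V]^G` induced by the splitting, where `A` is the symmetric algebra of the
cotangent space of `V/G` at the image of `0`, that is, the algebra of polynomial functions on the
tangent space. -/
def algMap : SymmetricAlgebra k (Cot P.G 0) →ₐ[k] invariants P.G :=
  SymmetricAlgebra.lift σ.toInv

/-- The ideal of `A` that defines `V/G` in its tangent space at the image of `0`. -/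
def I : Ideal (SymmetricAlgebra k (Cot P.G 0)) := RingHom.ker σ.algMap

/-- The morphism `p` from `V` to the tangent space of `V/G` at the image of `0`. -/
def p (x : V) : Tangent P.G 0 :=
  ((evalAt x).comp (invariants P.G).val).toLinearMap ∘ₗ σ.toInv

end Splitting

/-- The ideal `A_+` of `A`. -/
def augIdeal : Ideal (SymmetricAlgebra k (Cot P.G 0)) :=
  RingHom.ker (SymmetricAlgebra.algebraMapInv (R := k) (M := Cot P.G 0))

/-- `G` is good in `W`, with respect to a given splitting: the ideal `I` is a complete
intersection (its minimal number of generators is `dim Spec A - dim Spec A/I`, where `Spec A`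
is the tangent space), and `W` acts trivially on `I / A_+ I`. -/
def Splitting.IsGood {P : NormalPair k V} {ρ : kˣ →* (V ≃ₗ[k] V)} (σ : P.Splitting ρ) : Prop :=
  ((Submodule.spanFinrank σ.I : ℕ) : WithBot ℕ∞) +
      ringKrullDim (SymmetricAlgebra k (Cot P.G 0) ⧸ σ.I)
    = ((Module.finrank k (Tangent P.G 0) : ℕ) : WithBot ℕ∞) ∧
  ∀ w : P.Quot, ∀ f ∈ σ.I, symAct P.cotRepZero w f - f ∈ P.augIdeal * σ.I

/-- `W` is a reflection group on `V` and `G` is good in `W`, with respect to every splitting;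
moreover there is a splitting. -/
def IsGoodPair (ρ : kˣ →* (V ≃ₗ[k] V)) : Prop :=
  IsReflectionGroup ((natRep k V).comp P.W.subtype) ∧
    Nonempty (P.Splitting ρ) ∧ ∀ τ : P.Splitting ρ, τ.IsGood

/-! ### Parabolic subgroups -/

/-- The pair `(W_S, G_S)` of the pointwise stabilizers of a subset `S` of `V`. -/
def fix (S : Set V) : NormalPair k V where
  W := P.W ⊓ fixingSubgroup (V ≃ₗ[k] V) S
  G := P.G ⊓ fixingSubgroup (V ≃ₗ[k] V) S
  le := inf_le_inf_right _ P.le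
  normal := ⟨fun g hg w =>
    ⟨P.normal.conj_mem ⟨g, g.2.1⟩ hg.1 ⟨w, w.2.1⟩,
      (fixingSubgroup (V ≃ₗ[k] V) S).mul_mem
        ((fixingSubgroup (V ≃ₗ[k] V) S).mul_mem w.2.2 g.2.2)
        ((fixingSubgroup (V ≃ₗ[k] V) S).inv_mem w.2.2)⟩⟩

theorem fix_apply {S : Set V} {x : V} (hx : x ∈ S) : ∀ w ∈ (P.fix S).W, w x = x :=
  fun _ hw => (mem_fixingSubgroup_iff _).1 hw.2 x hx

/-- The canonical map `W_S/G_S → W/G`. -/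
def fixMap (S : Set V) : (P.fix S).Quot →* P.Quot :=
  QuotientGroup.map _ _ (Subgroup.inclusion (inf_le_left : (P.fix S).W ≤ P.W)) fun _ hg => hg.1

/-- The pointwise stabilizer in `W/G` of a subset of the tangent space at the image of `0`. -/
def quotStab (S : Set (Tangent P.G 0)) : Subgroup P.Quot where
  carrier := {γ | ∀ v ∈ S, P.tangentRepZero γ v = v}
  one_mem' v _ := by rw [map_one]; rfl
  mul_mem' {a b} ha hb v hv := by
    rw [map_mul]
    change P.tangentRepZero a (P.tangentRepZero b v) = v
    rw [hb v hv, ha v hv]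
  inv_mem' {a} ha v hv := by
    have h : P.tangentRepZero a⁻¹ (P.tangentRepZero a v) = v := by
      rw [← Module.End.mul_apply, ← map_mul, inv_mul_cancel, map_one]; rfl
    rwa [ha v hv] at h

/-- The action of the pointwise stabilizer of `S` on the tangent space at the image of `0`. -/
abbrev quotStabRep (S : Set (Tangent P.G 0)) : Representation k (P.quotStab S) (Tangent P.G 0) :=
  P.tangentRepZero.comp (P.quotStab S).subtype

/-- The inclusion `k[V]^G ⊆ k[V]^{G_S}`. -/
def invIncl (S : Set V) : invariants P.G →ₐ[k] invariants (P.fix S).G :=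
  Subalgebra.inclusion fun _ hf g hg => hf g hg.1

namespace Splitting

variable {P} {ρ : kˣ →* (V ≃ₗ[k] V)} (σ : P.Splitting ρ)

/-- The transpose of `tangentMap`: it maps the linear form `φ` to the class
of `σ(φ) - σ(φ)(x)` in the cotangent space of `V/G_x` at the image of `x`. -/
def cotangentMap (x : V) : Cot P.G 0 →ₗ[k] Cot (P.fix {x}).G x :=
  ((maxIdeal (P.fix {x}).G x).toCotangent.restrictScalars k) ∘ₗ
    { toFun := fun φ => ⟨P.invIncl {x} (σ.toInv φ) - algebraMap k _ (σ.p x φ), by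
          change evalAt x ((σ.toInv φ : Poly k V) - algebraMap k _ (σ.p x φ)) = 0
          rw [map_sub, AlgHom.commutes]
          exact sub_self _⟩
      map_add' := fun a b => by
        apply Subtype.ext
        simp only [map_add, Submodule.coe_add]
        abel
      map_smul' := fun c a => by
        apply Subtype.ext
        simp [Algebra.smul_def, mul_sub] }

/-- The canonical map from the tangent space of `V/G_x` at the image of `x` to the tangent space
of `V/G` at the image of `0`: the differential at the image of `x` of the morphism induced
by `p` on `V/G_x`. -/
def tangentMap (x : V) : Tangent (P.fix {x}).G x →ₗ[k] Tangent P.G 0 :=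
  (σ.cotangentMap x).dualMap

end Splitting

end NormalPair

end GoodQuotient

end

/-! The proof rests on a numerical form of the theorem of Chevalley, Shephard–Todd and Serre. Let a
finite group `Γ` act faithfully on `M`, and put `S = S(M)`, `R = S^Γ`. Then `Γ` is generated by
reflections if and only if the zero fibre `S / R_+ S` has length at most `|Γ|`. One direction is
`finrank_fibre_le_of_isReflectionGroup`: divided differences show that lifts of a basis of the zero
fibre are independent over `R`, and an `R`-independent family has at most `|Γ|` members. The other
is `isReflectionGroup_of_finrank_le`, a purity argument. If `H` is the subgroup generated by the
reflections, the conjugates of local generators of `S^H` form a square matrix indexed by `Γ/H`. Its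
determinant vanishes at `0` unless `H = Γ`, and yet no prime factor that vanishes at `0` can occur,
because two elements that agree on `S^H` modulo a principal prime differ by an element of `H`. Fibre
lengths are semicontinuous and behave well under passage to stabilizers of points, so the criterion
also gives Steinberg's theorem, `isReflectionGroup_stabilizer`.

It applies to `W = W̃/G` as follows. Goodness and averaging give `I ⊆ B_+ A` with `B = A^W`. Hence
`A / B_+ A` embeds in the zero fibre of `W̃`, with image in the classes of `k[Ṽ]^G`; by
`finrank_map_le_index` these span at most `[W̃ : G] = |W|` dimensions. This is
`Splitting.isReflectionGroup_cotRepZero`.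

To pass from `0` to `x`, note that `Ṽ/G_x` and `Ṽ/G` have the same infinitesimal neighbourhoods of
the image of `x`, by the Chinese remainder theorem along the orbit. By the graded Nakayama lemma `I`
is generated by `W`-invariants, so the stabilizer of `x` acts trivially on `I` modulo the ideal of
`p(x)` times `I`. The lemma `transfer` compares the presentation of the neighbourhood of `x` by `A`
with the minimal one, the embedding of `Ṽ/G_x` translated to `x`. All equations of the latter come
from `I`, so triviality of the action is inherited, and the number of equations minus the embedding
dimension does not grow. The height theorem gives the opposite inequality, whence
`Splitting.isGood_fix`.

For reflections, the cotangent map at `x` is surjective, and its kernel consists of differentials at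
`p(x)` of elements of `I`, which the stabilizer fixes. A surjective equivariant map with fixed
kernel preserves the rank of `γ - 1`, so reflections correspond in both directions; translation
compares the tangent spaces of `Ṽ/G_x` at `x` and at `0`. The stabilizer of `p(x)` comes from that
of `x` because the fibres of `p` are `G`-orbits. Finally, a subspace is not a finite union of proper
subspaces, so some point of `L` has the same stabilizer as `L`, which reduces subspaces to points.
-/

noncomputable section

namespace GoodQuotient

/-! ### Averaging over a finite group -/

section Average

variable {k Γ X Y : Type*} [Field k] [Group Γ] [AddCommGroup X] [Module k X]
  [AddCommGroup Y] [Module k Y]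

/-- The projection onto the invariants, for a linear action of a finite group. -/
def avg [Finite Γ] (r : Representation k Γ X) : X →ₗ[k] X :=
  letI := Fintype.ofFinite Γ
  (Nat.card Γ : k)⁻¹ • ∑ γ, r γ

theorem avg_apply [Fintype Γ] (r : Representation k Γ X) (x : X) :
    avg r x = (Nat.card Γ : k)⁻¹ • ∑ γ, r γ x := by
  simp only [avg, LinearMap.smul_apply, LinearMap.sum_apply]
  congr 1
  exact Finset.sum_congr (by ext; simp) fun _ _ => rfl

variable [Finite Γ] (r : Representation k Γ X)

theorem avg_invariant (γ : Γ) (x : X) : r γ (avg r x) = avg r x := by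
  have := Fintype.ofFinite Γ
  rw [avg_apply, map_smul, map_sum]
  congr 1
  simp only [← Module.End.mul_apply, ← map_mul]
  exact Fintype.sum_equiv (Equiv.mulLeft γ) _ _ fun _ => rfl

theorem avg_mem (N : Submodule k X) {x : X} (h : ∀ γ, r γ x ∈ N) : avg r x ∈ N := by
  have := Fintype.ofFinite Γ
  rw [avg_apply]
  exact N.smul_mem _ (N.sum_mem fun γ _ => h γ)

variable [CharZero k]

theorem avg_of_invariant {x : X} (h : ∀ γ, r γ x = x) : avg r x = x := by
  have := Fintype.ofFinite Γ
  rw [avg_apply]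
  simp only [h, Finset.sum_const, Finset.card_univ, ← Nat.card_eq_fintype_card]
  rw [← Nat.cast_smul_eq_nsmul k, smul_smul, inv_mul_cancel₀, one_smul]
  exact Nat.cast_ne_zero.2 Nat.card_pos.ne'

/-- Averaging congruences keeps them. With `y = x`, an element on which the group acts trivially
modulo `N` is congruent to an invariant one; most uses below are of this kind. -/
theorem avg_sub_mem (N : Submodule k X) {x y : X} (h : ∀ γ, r γ x - y ∈ N) :
    avg r x - y ∈ N := by
  have := Fintype.ofFinite Γ
  have h1 : avg r x - y = (Nat.card Γ : k)⁻¹ • ∑ γ, (r γ x - y) := by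
    rw [avg_apply, Finset.sum_sub_distrib, smul_sub]
    simp only [Finset.sum_const, Finset.card_univ, ← Nat.card_eq_fintype_card]
    rw [← Nat.cast_smul_eq_nsmul k (Nat.card Γ) y, smul_smul, inv_mul_cancel₀, one_smul]
    exact Nat.cast_ne_zero.2 Nat.card_pos.ne'
  rw [h1]
  exact N.smul_mem _ (N.sum_mem fun γ _ => h γ)

end Average

/-! ### Finite groups acting on algebras -/

section Action

variable {k S Γ : Type*} [Field k] [CommRing S] [Algebra k S] [Group Γ]

/-- The linear representation that underlies an action by algebra automorphisms. -/
def actRep (a : Γ →* (S →ₐ[k] S)) : Representation k Γ S := AlgHom.toEnd.comp a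

@[simp] theorem actRep_apply (a : Γ →* (S →ₐ[k] S)) (γ : Γ) (f : S) : actRep a γ f = a γ f := rfl

theorem act_mul (a : Γ →* (S →ₐ[k] S)) (γ δ : Γ) (f : S) : a (γ * δ) f = a γ (a δ f) := by
  rw [map_mul]; rfl

@[simp] theorem act_inv_act (a : Γ →* (S →ₐ[k] S)) (γ : Γ) (f : S) : a γ⁻¹ (a γ f) = f := by
  rw [← act_mul]; simp

@[simp] theorem act_act_inv (a : Γ →* (S →ₐ[k] S)) (γ : Γ) (f : S) : a γ (a γ⁻¹ f) = f := by
  rw [← act_mul]; simp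

/-- `R` is the algebra of invariants of the action `a`. -/
def IsInv (a : Γ →* (S →ₐ[k] S)) (R : Subalgebra k S) : Prop :=
  ∀ f, f ∈ R ↔ ∀ γ, a γ f = f

/-- The algebra of invariants. -/
def inv (a : Γ →* (S →ₐ[k] S)) : Subalgebra k S where
  carrier := {f | ∀ γ, a γ f = f}
  mul_mem' ha hb γ := by rw [map_mul, ha γ, hb γ]
  add_mem' ha hb γ := by rw [map_add, ha γ, hb γ]
  algebraMap_mem' c γ := AlgHom.commutes _ c

theorem isInv_inv (a : Γ →* (S →ₐ[k] S)) : IsInv a (inv a) := fun _ => Iff.rfl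

variable {a : Γ →* (S →ₐ[k] S)} {R : Subalgebra k S}

/-- The maximal ideal of a point of the quotient. -/
def ptIdeal (R : Subalgebra k S) (e : S →ₐ[k] k) : Ideal R := RingHom.ker (e.comp R.val)

theorem mem_ptIdeal {e : S →ₐ[k] k} {f : R} : f ∈ ptIdeal R e ↔ e f = 0 := Iff.rfl

section Finite

variable [Finite Γ] (hR : IsInv a R)

include hR in
theorem avg_mem_of_isInv (f : S) : avg (actRep a) f ∈ R :=
  (hR _).2 fun γ => avg_invariant (actRep a) γ f

/-- The Reynolds operator, as a linear map over the algebra of invariants. -/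
def reynolds : S →ₗ[R] R where
  toFun f := ⟨avg (actRep a) f, avg_mem_of_isInv hR f⟩
  map_add' f g := Subtype.ext (map_add _ f g)
  map_smul' c f := by
    have := Fintype.ofFinite Γ
    apply Subtype.ext
    change avg (actRep a) ((c : S) * f) = (c : S) * avg (actRep a) f
    rw [avg_apply, avg_apply, mul_smul_comm, Finset.mul_sum]
    congr 1
    refine Finset.sum_congr rfl fun γ _ => ?_
    rw [actRep_apply, map_mul, (hR c).1 c.2 γ, actRep_apply]

theorem reynolds_coe [CharZero k] (f : R) : reynolds hR (f : S) = f :=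
  Subtype.ext (avg_of_invariant (actRep a) fun γ => (hR f).1 f.2 γ)

theorem reynolds_mem {J : Ideal R} {f : S} (hf : f ∈ J.map (algebraMap R S)) :
    reynolds hR f ∈ J := by
  have h1 : f ∈ J • (⊤ : Submodule R S) := by
    rw [Ideal.smul_top_eq_map]; exact hf
  refine Submodule.smul_induction_on h1 (fun c hc g _ => ?_) fun g g' hg hg' => ?_
  · rw [map_smul]
    exact Ideal.mul_mem_right _ _ hc
  · rw [map_add]
    exact add_mem hg hg'

-- The Reynolds operator maps `J S` to `J` and is the identity on `R`, so extended ideals contract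
-- back: `J S ∩ R = J`.
include hR in
theorem mem_of_coe_mem_map [CharZero k] {J : Ideal R} {f : R}
    (hf : (f : S) ∈ J.map (algebraMap R S)) : f ∈ J := by
  have := reynolds_mem hR hf
  rwa [reynolds_coe] at this

-- Since extension of ideals is undone by contraction, it embeds the ideals of `R` in those of `S`
-- as ordered sets, and ascending chains stop.
include hR in
theorem isNoetherianRing_of_isInv [CharZero k] [IsNoetherianRing S] : IsNoetherianRing R := by
  have h : StrictMono fun J : Ideal R => J.map (algebraMap R S) := by
    refine Monotone.strictMono_of_injective (fun _ _ h => Ideal.map_mono h) fun J J' h => ?_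
    have hc : ∀ J : Ideal R, (J.map (algebraMap R S)).comap (algebraMap R S) = J := fun J =>
      le_antisymm (fun f hf => mem_of_coe_mem_map hR hf) Ideal.le_comap_map
    rw [← hc J, ← hc J']
    exact congrArg _ h
  rw [isNoetherianRing_iff, isNoetherian_iff']
  exact h.wellFoundedGT

open Polynomial in
/-- The polynomial whose roots are the conjugates of `b`. -/
def orbitPoly (a : Γ →* (S →ₐ[k] S)) (b : S) : S[X] :=
  letI := Fintype.ofFinite Γ
  ∏ γ, (X - C (a γ b))

open Polynomial in
theorem orbitPoly_monic (b : S) : (orbitPoly a b).Monic := by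
  let := Fintype.ofFinite Γ
  exact monic_prod_of_monic _ _ fun γ _ => monic_X_sub_C _

open Polynomial in
theorem orbitPoly_eval (b : S) : (orbitPoly a b).eval b = 0 := by
  let := Fintype.ofFinite Γ
  rw [orbitPoly, eval_prod]
  refine Finset.prod_eq_zero (Finset.mem_univ (1 : Γ)) ?_
  simp

open Polynomial in
theorem orbitPoly_map (b : S) (γ : Γ) : (orbitPoly a b).map (a γ : S →+* S) = orbitPoly a b := by
  let := Fintype.ofFinite Γ
  rw [orbitPoly, Polynomial.map_prod]
  refine Fintype.prod_equiv (Equiv.mulLeft γ) _ _ fun δ => ?_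
  simp

include hR in
theorem orbitPoly_coeff_mem (b : S) (i : ℕ) : (orbitPoly a b).coeff i ∈ R := by
  rw [hR]
  intro γ
  conv_rhs => rw [← orbitPoly_map b γ]
  rw [Polynomial.coeff_map]; rfl

open Polynomial in
include hR in
theorem isIntegral_of_isInv : Algebra.IsIntegral R S := by
  refine ⟨fun b => ?_⟩
  have h : orbitPoly a b ∈ lifts (algebraMap R S) := by
    rw [lifts_iff_coeff_lifts]
    exact fun i => ⟨⟨_, orbitPoly_coeff_mem hR b i⟩, rfl⟩
  obtain ⟨q, hq, -, hm⟩ := lifts_and_natDegree_eq_and_monic h (orbitPoly_monic b)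
  refine ⟨q, hm, ?_⟩
  rw [← eval_map, hq, orbitPoly_eval]

-- All conjugates of `b` vanish at `e`, so the orbit polynomial of `b` becomes a power of `X` at `e`
-- and its lower coefficients lie in the ideal of the point. Evaluating the polynomial at its root
-- `b` gives the claim.
open Polynomial in
include hR in
theorem pow_mem_map_ptIdeal (e : S →ₐ[k] k) {b : S} (hb : ∀ γ, e (a γ b) = 0) :
    ∃ n, b ^ n ∈ (ptIdeal R e).map (algebraMap R S) := by
  let := Fintype.ofFinite Γ
  refine ⟨(orbitPoly a b).natDegree, ?_⟩
  have h1 := orbitPoly_eval (a := a) b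
  rw [eval_eq_sum_range, Finset.sum_range_succ, (orbitPoly_monic b).coeff_natDegree, one_mul] at h1
  rw [← neg_eq_of_add_eq_zero_right h1]
  refine neg_mem (sum_mem fun i hi => Ideal.mul_mem_right _ _ ?_)
  refine Ideal.mem_map_of_mem (algebraMap R S) (x := ⟨_, orbitPoly_coeff_mem hR b i⟩) ?_
  rw [mem_ptIdeal]
  have h2 : (orbitPoly a b).map (e : S →+* k) = X ^ (orbitPoly a b).natDegree := by
    have : (orbitPoly a b).map (e : S →+* k) = X ^ (Fintype.card Γ) := by
      rw [orbitPoly, Polynomial.map_prod]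
      simp [hb]
    rw [this]
    congr 1
    rw [← (orbitPoly_monic (a := a) b).natDegree_map (e : S →+* k), this]
    simp
  have h3 := congrArg (fun p => p.coeff i) h2
  simp only [coeff_map, coeff_X_pow, (Finset.mem_range.1 hi).ne, if_false] at h3
  exact h3

include hR in
theorem exists_pow_le_map_ptIdeal [IsNoetherianRing S] (e : S →ₐ[k] k) {q : Ideal S}
    (hq : ∀ b ∈ q, ∀ γ, e (a γ b) = 0) : ∃ n, q ^ n ≤ (ptIdeal R e).map (algebraMap R S) :=
  Ideal.exists_pow_le_of_le_radical_of_fg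
    (fun b hb => pow_mem_map_ptIdeal hR e (hq b hb)) (IsNoetherian.noetherian q)

end Finite

end Action

end GoodQuotient

namespace GoodQuotient

/-! ### Infinitesimal neighbourhoods of orbits -/

section Orbits

variable {k S Γ : Type*} [Field k] [CommRing S] [Algebra k S] [Group Γ]

theorem isCoprime_ker {e e' : S →ₐ[k] k} (h : e ≠ e') :
    IsCoprime (RingHom.ker e) (RingHom.ker e') := by
  obtain ⟨f, hf⟩ : ∃ f, e f ≠ e' f := by
    by_contra! hc
    exact h (AlgHom.ext hc)
  rw [Ideal.isCoprime_iff_exists]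
  have hf' : e' f - e f ≠ 0 := sub_ne_zero.2 (Ne.symm hf)
  refine ⟨algebraMap k S (e' f - e f)⁻¹ * (f - algebraMap k S (e f)), ?_,
    algebraMap k S (e' f - e f)⁻¹ * (algebraMap k S (e' f) - f), ?_, ?_⟩
  · rw [RingHom.mem_ker, map_mul, map_sub, AlgHom.commutes]; simp
  · rw [RingHom.mem_ker, map_mul, map_sub, AlgHom.commutes]; simp
  · rw [← mul_add]
    have : f - algebraMap k S (e f) + (algebraMap k S (e' f) - f)
        = algebraMap k S (e' f - e f) := by rw [map_sub]; ring
    rw [this, ← map_mul, inv_mul_cancel₀ hf', map_one]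

variable {a : Γ →* (S →ₐ[k] S)} {R : Subalgebra k S}

/-- `H` is the stabilizer of the point `e`. -/
def IsStab (a : Γ →* (S →ₐ[k] S)) (e : S →ₐ[k] k) (H : Subgroup Γ) : Prop :=
  ∀ γ, γ ∈ H ↔ e.comp (a γ) = e

theorem act_mem_ker_pow (e : S →ₐ[k] k) (γ : Γ) {n : ℕ} {f : S}
    (hf : f ∈ RingHom.ker (e.comp (a γ)) ^ n) : a γ f ∈ RingHom.ker e ^ n := by
  have h1 : a γ f ∈ (RingHom.ker (e.comp (a γ)) ^ n).map (a γ) := Ideal.mem_map_of_mem _ hf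
  rw [Ideal.map_pow] at h1
  refine Ideal.pow_right_mono (Ideal.map_le_iff_le_comap.2 fun g hg => ?_) n h1
  exact hg

theorem mem_ker_comp_pow (e : S →ₐ[k] k) (γ : Γ) {n : ℕ} {f : S}
    (hf : a γ f ∈ RingHom.ker e ^ n) : f ∈ RingHom.ker (e.comp (a γ)) ^ n := by
  have h1 := act_mem_ker_pow (a := a) (e.comp (a γ)) γ⁻¹ (n := n) (f := a γ f) (by
    have : (e.comp (a γ)).comp (a γ⁻¹) = e := AlgHom.ext fun f => by simp
    rwa [this])
  simpa using h1

variable {e : S →ₐ[k] k} {H : Subgroup Γ}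

/-- Chinese remainder theorem along an orbit. -/
theorem exists_localized_at [Finite Γ] (hH : IsStab a e H) (g : S) (n : ℕ) :
    ∃ b : S, b - g ∈ RingHom.ker e ^ n ∧ ∀ γ ∉ H, b ∈ RingHom.ker (e.comp (a γ)) ^ n := by
  classical
  have := Fintype.ofFinite Γ
  have h1 : IsCoprime (RingHom.ker e ^ n)
      (∏ γ ∈ Finset.univ.filter (fun γ : Γ => γ ∉ H), RingHom.ker (e.comp (a γ)) ^ n) := by
    refine IsCoprime.prod_right fun γ hγ => IsCoprime.pow (isCoprime_ker fun h => ?_)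
    exact (Finset.mem_filter.1 hγ).2 ((hH γ).2 h.symm)
  obtain ⟨u, hu, v, hv, huv⟩ := Ideal.isCoprime_iff_exists.1 h1
  refine ⟨v * g, ?_, fun γ hγ => ?_⟩
  · have : v * g - g = -(u * g) := by rw [← eq_sub_iff_add_eq'] at huv; rw [huv]; ring
    rw [this]
    exact neg_mem (Ideal.mul_mem_right _ _ hu)
  · refine Ideal.mul_mem_right _ _ (Ideal.le_of_dvd 
      (Finset.dvd_prod_of_mem (fun γ => RingHom.ker (e.comp (a γ)) ^ n) ?_) hv)
    exact Finset.mem_filter.2 ⟨Finset.mem_univ _, hγ⟩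

variable [Finite Γ] [CharZero k] (hR : IsInv a R)

include hR in
/-- Every function that is invariant under the stabilizer of a point is congruent to an invariant
function modulo a given power of the ideal of the point. -/
theorem exists_invariant_sub_mem (hH : IsStab a e H) {g : S} (hg : ∀ γ ∈ H, a γ g = g) (n : ℕ) :
    ∃ r ∈ R, r - g ∈ RingHom.ker e ^ n := by
  classical
  have := Fintype.ofFinite Γ
  obtain ⟨b, hb, hb'⟩ := exists_localized_at (a := a) hH g n
  have hc : (Nat.card H : k) ≠ 0 := Nat.cast_ne_zero.2 Nat.card_pos.ne'
  refine ⟨(Nat.card H : k)⁻¹ • ∑ γ, a γ b, R.smul_mem ((hR _).2 fun γ => ?_) _, ?_⟩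
  · rw [map_sum]
    simp only [← act_mul]
    exact Fintype.sum_equiv (Equiv.mulLeft γ) _ _ fun _ => rfl
  · have h1 : (Nat.card H : k)⁻¹ • ∑ γ, a γ b - g
        = (Nat.card H : k)⁻¹ • ∑ γ, (a γ b - if γ ∈ H then g else 0) := by
      rw [Finset.sum_sub_distrib, smul_sub, Finset.sum_ite]
      simp only [Finset.sum_const, smul_zero, add_zero]
      rw [← Nat.cast_smul_eq_nsmul k, smul_smul]
      have : (Finset.univ.filter fun γ => γ ∈ H).card = Nat.card H := by
        rw [Nat.card_eq_fintype_card, Fintype.card_subtype]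
      rw [this, inv_mul_cancel₀ hc, one_smul]
    rw [h1]
    refine Submodule.smul_of_tower_mem _ _ (sum_mem fun γ _ => ?_)
    split_ifs with hγ
    · have h2 : a γ b - g = a γ (b - g) := by rw [map_sub, hg γ hγ]
      rw [h2]
      refine act_mem_ker_pow e γ ?_
      rwa [(hH γ).1 hγ]
    · rw [sub_zero]
      exact act_mem_ker_pow e γ (hb' γ hγ)

variable [IsNoetherianRing S] {R' : Subalgebra k S}

-- The orbit of `e` under its own stabilizer is a single point, so the fibre of the quotient by `H`
-- through `e` is supported at `e`, and the ideal it generates defines the same topology on `S` as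
-- the powers of `ker e`.
omit [CharZero k] in
theorem ker_pow_le_of_isStab (hH : IsStab a e H) (hR' : IsInv (a.comp H.subtype) R') :
    ∃ m, RingHom.ker e ^ m ≤ (ptIdeal R' e).map (algebraMap R' S) := by
  refine exists_pow_le_map_ptIdeal hR' e fun b hb γ => ?_
  exact (DFunLike.congr_fun ((hH γ).1 γ.2) b).trans hb

include hR in
/-- The quotients by a finite group and by the stabilizer of a point have the same infinitesimal
neighbourhoods of the image of the point. -/
theorem exists_sub_mem_ptIdeal_pow (hH : IsStab a e H) (hR' : IsInv (a.comp H.subtype) R')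
    (g : R') (n : ℕ) : ∃ r ∈ R, ∃ h : r ∈ R', (⟨r, h⟩ : R') - g ∈ ptIdeal R' e ^ n := by
  obtain ⟨m, hm⟩ := ker_pow_le_of_isStab hH hR'
  obtain ⟨r, hr, hrg⟩ := exists_invariant_sub_mem hR hH (g := g)
    (fun γ hγ => (hR' g).1 g.2 ⟨γ, hγ⟩) (m * n)
  have h : r ∈ R' := (hR' r).2 fun γ => (hR r).1 hr γ
  refine ⟨r, hr, h, mem_of_coe_mem_map hR' ?_⟩
  rw [pow_mul] at hrg
  rw [Ideal.map_pow]
  exact Ideal.pow_right_mono hm n hrg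

-- An invariant that vanishes to order `m` at `e` does so along the whole orbit. The ideals of
-- distinct points are coprime, so it lies in a product of powers, hence in a power of the ideal of
-- the fibre, and contraction to `R` finishes.
include hR in
theorem mem_ptIdeal_pow_of_mem (e : S →ₐ[k] k) (n : ℕ) : ∃ m, ∀ r : R,
    (r : S) ∈ RingHom.ker e ^ m → r ∈ ptIdeal R e ^ n := by
  classical
  have := Fintype.ofFinite Γ
  let T : Finset (S →ₐ[k] k) := Finset.univ.image fun γ : Γ => e.comp (a γ)
  obtain ⟨M, hM⟩ := exists_pow_le_map_ptIdeal hR e (q := ⨅ e' ∈ T, RingHom.ker e') (by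
    intro b hb γ
    simp only [Ideal.mem_iInf] at hb
    exact hb (e.comp (a γ)) (Finset.mem_image_of_mem _ (Finset.mem_univ γ)))
  refine ⟨M * n, fun r hr => mem_of_coe_mem_map hR ?_⟩
  -- `T` is the orbit as a set without repetitions, which coprimality requires.
  have hco : ∀ N : ℕ, ∏ e' ∈ T, RingHom.ker e' ^ N = ⨅ e' ∈ T, RingHom.ker e' ^ N := fun N =>
    Ideal.prod_eq_iInf_of_pairwise_isCoprime fun e₁ _ e₂ _ h => (isCoprime_ker h).pow
  have h1 : (r : S) ∈ ∏ e' ∈ T, RingHom.ker e' ^ (M * n) := by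
    rw [hco]
    simp only [Ideal.mem_iInf]
    intro e' he'
    obtain ⟨γ, -, rfl⟩ := Finset.mem_image.1 he'
    refine mem_ker_comp_pow e γ ?_
    rwa [(hR r).1 r.2 γ]
  rw [Finset.prod_pow, pow_mul] at h1
  rw [Ideal.map_pow]
  refine Ideal.pow_right_mono (le_trans (Ideal.pow_right_mono ?_ M) hM) n h1
  have := hco 1
  simp only [pow_one] at this
  rw [this]

end Orbits

end GoodQuotient

namespace GoodQuotient

/-! ### The rank of an algebra over its invariants -/

section Rank

variable {k S Γ : Type*} [Field k] [CommRing S] [Algebra k S] [Group Γ]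
  {a : Γ →* (S →ₐ[k] S)} {R : Subalgebra k S}

/-- The ideal of the scheme theoretic fibre through the point `e` of the quotient map. -/
def fibreIdeal (R : Subalgebra k S) (e : S →ₐ[k] k) : Ideal S :=
  (ptIdeal R e).map (algebraMap R S)

theorem fibreIdeal_eq_smul (R : Subalgebra k S) (e : S →ₐ[k] k) :
    (fibreIdeal R e : Set S) = (ptIdeal R e • (⊤ : Submodule R S) : Submodule R S) := by
  rw [Ideal.smul_top_eq_map]; rfl

theorem mem_fibreIdeal_of_mem {e : S →ₐ[k] k} {f : S} (hf : f ∈ R) (h : e f = 0) :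
    f ∈ fibreIdeal R e :=
  Ideal.mem_map_of_mem (algebraMap R S) (x := ⟨f, hf⟩) h

theorem act_mem_fibreIdeal {e : S →ₐ[k] k} (hR : IsInv a R) {f : S} (h : f ∈ fibreIdeal R e)
    (γ : Γ) : a γ f ∈ fibreIdeal R e := by
  have : fibreIdeal R e ≤ (fibreIdeal R e).comap (a γ) :=
    Ideal.map_le_iff_le_comap.2 fun g hg => by
      change a γ (g : S) ∈ fibreIdeal R e
      rw [(hR g).1 g.2 γ]
      exact mem_fibreIdeal_of_mem g.2 hg
  exact this h

theorem finite_of_isInv [Finite Γ] (hR : IsInv a R) [Algebra.FiniteType k S] :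
    Module.Finite R S := by
  have := isIntegral_of_isInv hR
  have : Algebra.FiniteType R S := Algebra.FiniteType.of_restrictScalars_finiteType k R S
  exact Algebra.IsIntegral.finite

/-- Nakayama's lemma: lifts of a spanning set of the fibre of `N` at `e` generate `N` near `e`. No
localization is used; the denominator `u`, with value `1` at `e`, is kept explicit. -/
theorem exists_mul_mem_span (N : Submodule R S) [Module.Finite R N] {ι : Type*} (z : ι → S)
    (e : S →ₐ[k] k)
    (hz : ∀ f ∈ N, ∃ g ∈ Submodule.span k (Set.range z), f - g ∈ ptIdeal R e • N) :
    ∃ u : R, e u = 1 ∧ ∀ f ∈ N, (u : S) * f ∈ Submodule.span R (Set.range z) := by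
  have hN : N.FG := Module.Finite.iff_fg.1 inferInstance
  have h1 : N ≤ Submodule.span R (Set.range z) ⊔ ptIdeal R e • N := by
    intro f hf
    obtain ⟨g, hg, hfg⟩ := hz f hf
    rw [← sub_add_cancel f g, add_comm]
    refine Submodule.add_mem_sup ?_ hfg
    exact Submodule.span_subset_span k R _ hg
  obtain ⟨u, hu, hu'⟩ :=
    Submodule.exists_sub_one_mem_and_smul_le_of_fg_of_le_sup hN le_rfl h1
  refine ⟨u, ?_, fun f hf => hu' (Submodule.smul_mem_pointwise_smul f u N hf)⟩
  have h2 : e ((u : S) - 1) = 0 := hu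
  rwa [map_sub, map_one, sub_eq_zero] at h2

theorem finite_quotient_fibreIdeal [Module.Finite R S] (e : S →ₐ[k] k) :
    Module.Finite k (S ⧸ fibreIdeal R e) := by
  classical
  obtain ⟨t, ht⟩ := Module.Finite.fg_top (R := R) (M := S)
  refine ⟨⟨t.image (Ideal.Quotient.mk _), ?_⟩⟩
  rw [eq_top_iff]
  rintro x -
  obtain ⟨f, rfl⟩ := Ideal.Quotient.mk_surjective x
  have hf : f ∈ Submodule.span R (t : Set S) := by rw [ht]; trivial
  refine Submodule.span_induction (p := fun f _ => Ideal.Quotient.mk (fibreIdeal R e) f ∈ _)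
    (fun g hg => ?_) ?_ (fun g h _ _ hg hh => ?_) (fun c g _ hg => ?_) hf
  · exact Submodule.subset_span (Finset.mem_coe.2 (Finset.mem_image_of_mem _ hg))
  · rw [map_zero]; exact zero_mem _
  · rw [map_add]; exact add_mem hg hh
  · have h1 : Ideal.Quotient.mk (fibreIdeal R e) (c • g)
        = e c • Ideal.Quotient.mk (fibreIdeal R e) g := by
      rw [← Ideal.Quotient.mkₐ_eq_mk k, ← map_smul, Ideal.Quotient.mkₐ_eq_mk, Ideal.Quotient.eq,
        Algebra.smul_def (e c) g]
      change (c : S) * g - _ ∈ _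
      rw [← sub_mul]
      refine Ideal.mul_mem_right _ _ (mem_fibreIdeal_of_mem (sub_mem c.2 (R.algebraMap_mem _)) ?_)
      rw [map_sub, AlgHom.commutes]
      exact sub_self _
    rw [h1]
    exact Submodule.smul_mem _ _ hg

variable [IsDomain S] [Fintype Γ]

/-- Independence of the conjugates of a generating family. -/
theorem act_rows_independent (ha : Function.Injective a) (hR : IsInv a R) {ι : Type*} [Fintype ι]
    {z : ι → S} {u : S} (hu0 : u ≠ 0) (hu : ∀ f, u * f ∈ Submodule.span R (Set.range z)) {α : Γ → S}
    (hα : ∀ i, ∑ γ, α γ * a γ (z i) = 0) : α = 0 := by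
  have h1 : ∀ f ∈ Submodule.span R (Set.range z), ∑ γ, α γ * a γ f = 0 := by
    intro f hf
    refine Submodule.span_induction (p := fun f _ => ∑ γ, α γ * a γ f = 0) ?_ ?_ ?_ ?_ hf
    · rintro _ ⟨i, rfl⟩; exact hα i
    · simp
    · intro f g _ _ hf hg
      simp only [map_add, mul_add, Finset.sum_add_distrib, hf, hg, add_zero]
    · intro c f _ hf
      have : ∀ γ, α γ * a γ (c • f) = (c : S) * (α γ * a γ f) := fun γ => by
        change α γ * a γ ((c : S) * f) = _
        rw [map_mul, (hR c).1 c.2 γ]; ring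
      simp only [this, ← Finset.mul_sum, hf, mul_zero]
  have hinj : Function.Injective fun γ : Γ => ((a γ : S →* S)) := by
    intro γ δ h
    exact ha (AlgHom.ext fun f => DFunLike.congr_fun h f)
  have h2 := (linearIndependent_monoidHom S S).comp _ hinj
  rw [Fintype.linearIndependent_iff] at h2
  have h3 := h2 (fun γ => α γ * a γ u) (by
    funext f
    have := h1 _ (hu f)
    simp only [map_mul] at this
    simpa [Finset.sum_apply, mul_assoc] using this)
  funext γ
  have := h3 γ
  rcases mul_eq_zero.1 this with h | h
  · exact h
  · have : u = 0 := by simpa using congrArg (a γ⁻¹) h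
    exact absurd this hu0

/-- Independence of the `|Γ|` rows forces at least `|Γ|` columns. With the bound `hι` the matrix of
conjugates is square with nonzero determinant, so its columns are independent too. -/
theorem act_columns_independent (ha : Function.Injective a) (hR : IsInv a R) {ι : Type*}
    [Fintype ι] (hι : Fintype.card ι ≤ Fintype.card Γ)
    {z : ι → S} {u : S} (hu0 : u ≠ 0) (hu : ∀ f, u * f ∈ Submodule.span R (Set.range z)) {c : ι → S}
    (hc : ∀ γ, ∑ i, c i * a γ (z i) = 0) : c = 0 := by
  classical
  have hrow : LinearIndependent S (fun (γ : Γ) (i : ι) => a γ (z i)) := by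
    rw [Fintype.linearIndependent_iff]
    intro α hα
    refine congrFun (act_rows_independent ha hR hu0 hu fun i => ?_)
    have := congrFun hα i
    simpa [Finset.sum_apply] using this
  have h1 : Fintype.card Γ ≤ Fintype.card ι := by
    have := hrow.fintype_card_le_finrank
    rwa [Module.finrank_fintype_fun_eq_card] at this
  obtain ⟨q⟩ := Fintype.card_eq.1 (le_antisymm h1 hι)
  let M : Matrix Γ Γ S := Matrix.of fun γ δ => a γ (z (q δ))
  have hM : M.det ≠ 0 := by
    intro h0
    obtain ⟨v, hv0, hv⟩ := Matrix.exists_vecMul_eq_zero_iff.2 h0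
    refine hv0 (act_rows_independent ha hR hu0 hu fun i => ?_)
    have := congrFun hv (q.symm i)
    simpa [M, Matrix.vecMul, dotProduct] using this
  by_contra hc0
  refine hM (Matrix.exists_mulVec_eq_zero_iff.1 ⟨fun γ => c (q γ), fun h => hc0 ?_, ?_⟩)
  · funext i
    simpa using congrFun h (q.symm i)
  · funext γ
    have := hc γ
    rw [← q.sum_comp] at this
    simpa [M, Matrix.mulVec, dotProduct, mul_comm] using this

end Rank

section Coset

variable {k S Γ : Type*} [Field k] [CommRing S] [Algebra k S] [Group Γ]
  {a : Γ →* (S →ₐ[k] S)} {R : Subalgebra k S}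

theorem act_out_eq {H : Subgroup Γ} {R' : Subalgebra k S} (hR' : IsInv (a.comp H.subtype) R')
    {f : S} (hf : f ∈ R') (γ : Γ) : a (QuotientGroup.mk γ : Γ ⧸ H).out f = a γ f := by
  obtain ⟨h, hh⟩ := QuotientGroup.mk_out_eq_mul H γ
  rw [hh, act_mul]
  congr 1
  exact (hR' f).1 hf h

variable [IsDomain S] [Finite Γ] [Module.Finite R S]

/-- If the fibre of the quotient map through a point has length at most `|Γ|`, then the invariants
of `H` generate a subspace of dimension at most `[Γ : H]` of the algebra of functions on the
fibre. -/
theorem finrank_map_le_index (ha : Function.Injective a) (hR : IsInv a R) (e : S →ₐ[k] k)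
    (hd : Module.finrank k (S ⧸ fibreIdeal R e) ≤ Nat.card Γ) {H : Subgroup Γ}
    {R' : Subalgebra k S} (hR' : IsInv (a.comp H.subtype) R') :
    Module.finrank k (R'.toSubmodule.map (Ideal.Quotient.mkₐ k (fibreIdeal R e)).toLinearMap)
      ≤ H.index := by
  classical
  have := Fintype.ofFinite Γ
  have := finite_quotient_fibreIdeal (R := R) e
  set U := R'.toSubmodule.map (Ideal.Quotient.mkₐ k (fibreIdeal R e)).toLinearMap with hU
  let b := Module.finBasis k U
  have hlift : ∀ i, ∃ f ∈ R', Ideal.Quotient.mk (fibreIdeal R e) f = b i := fun i => (b i).2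
  choose w hw hwb using hlift
  obtain ⟨U', hU'⟩ := Submodule.exists_isCompl U
  -- The basis of `U` is completed to a basis of the whole fibre, so that the lifts generate `S`
  -- near `e`; those that lift `U` are kept inside `R'`.
  let b' := Module.finBasis k U'
  let B := (b.prod b').map (Submodule.prodEquivOfIsCompl U U' hU')
  have hsurj : ∀ x : S ⧸ fibreIdeal R e, ∃ f, Ideal.Quotient.mk (fibreIdeal R e) f = x :=
    Ideal.Quotient.mk_surjective
  choose s hs using hsurj
  let z : Fin (Module.finrank k U) ⊕ Fin (Module.finrank k U') → S :=
    Sum.elim w fun j => s (B (Sum.inr j))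
  have hz : ∀ i, Ideal.Quotient.mk (fibreIdeal R e) (z i) = B i := by
    rintro (i | j)
    · simp [z, B, hwb]
    · simp [z, B, hs]
  have : Module.Finite R (⊤ : Submodule R S) := Module.Finite.equiv Submodule.topEquiv.symm
  obtain ⟨u, hu1, hu⟩ := exists_mul_mem_span (R := R) ⊤ z e (by
    intro f _
    have h1 : Ideal.Quotient.mk (fibreIdeal R e) f ∈ Submodule.span k (Set.range B) := by
      rw [B.span_eq]; trivial
    have h2 : Set.range B = (Ideal.Quotient.mkₐ k (fibreIdeal R e)).toLinearMap '' Set.range z := by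
      rw [← Set.range_comp]
      exact congrArg Set.range (funext fun i => (hz i).symm)
    rw [h2, Submodule.span_image] at h1
    obtain ⟨g, hg, hgf⟩ := h1
    refine ⟨g, hg, ?_⟩
    have h3 : f - g ∈ fibreIdeal R e := Ideal.Quotient.eq.1 hgf.symm
    have h4 := fibreIdeal_eq_smul R e
    rw [← SetLike.mem_coe, ← h4]
    exact h3)
  have hu0 : (u : S) ≠ 0 := by
    intro h
    rw [h, map_zero] at hu1
    exact zero_ne_one hu1
  have hcard : Fintype.card (Fin (Module.finrank k U) ⊕ Fin (Module.finrank k U'))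
      ≤ Fintype.card Γ := by
    rw [← Module.finrank_eq_card_basis B, ← Nat.card_eq_fintype_card]
    exact hd
  -- The conjugates of an element of `R'` depend only on the coset, so these columns of the
  -- `Γ`-indexed matrix already live in a free module of rank `[Γ : H]`, which bounds their number.
  have hcol : LinearIndependent S (fun (i : Fin (Module.finrank k U)) (c : Γ ⧸ H) =>
      a c.out (w i)) := by
    rw [Fintype.linearIndependent_iff]
    intro α hα
    have h5 := act_columns_independent ha hR hcard (z := z) (c := Sum.elim α fun _ => 0) hu0
      (fun f => hu f trivial) (fun γ => by
        rw [Fintype.sum_sum_type]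
        simp only [z, Sum.elim_inl, Sum.elim_inr, zero_mul, Finset.sum_const_zero, add_zero]
        have := congrFun hα (QuotientGroup.mk γ)
        simp only [Finset.sum_apply, Pi.smul_apply, smul_eq_mul, Pi.zero_apply] at this
        rw [← this]
        exact Finset.sum_congr rfl fun i _ => by rw [act_out_eq hR' (hw i)])
    intro i
    exact congrFun h5 (Sum.inl i)
  have h6 := hcol.fintype_card_le_finrank
  rw [Module.finrank_fintype_fun_eq_card, Fintype.card_fin, ← Nat.card_eq_fintype_card] at h6
  exact h6

/-- A criterion for a subgroup to be everything. -/
theorem eq_top_of_finrank_le [UniqueFactorizationMonoid S] [CharZero k]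
    (ha : Function.Injective a) (hR : IsInv a R)
    (e : S →ₐ[k] k) (he : ∀ γ f, e (a γ f) = e f)
    (hd : Module.finrank k (S ⧸ fibreIdeal R e) ≤ Nat.card Γ) {H : Subgroup Γ}
    {R' : Subalgebra k S} (hR' : IsInv (a.comp H.subtype) R')
    (hH : ∀ (p : Ideal S) (γ δ : Γ), p.IsPrime → p.IsPrincipal → p ≤ RingHom.ker e →
      (∀ f ∈ R', a γ f - a δ f ∈ p) → γ⁻¹ * δ ∈ H) : H = ⊤ := by
  classical
  have := Fintype.ofFinite Γ
  have := finite_quotient_fibreIdeal (R := R) e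
  have hRR' : ∀ f ∈ R, f ∈ R' := fun f hf => (hR' f).2 fun γ => (hR f).1 hf γ
  have hle := finrank_map_le_index ha hR e hd hR'
  set U := R'.toSubmodule.map (Ideal.Quotient.mkₐ k (fibreIdeal R e)).toLinearMap with hU
  let b := Module.finBasis k U
  have hlift : ∀ i, ∃ f ∈ R', Ideal.Quotient.mk (fibreIdeal R e) f = b i := fun i => (b i).2
  choose w hw hwb using hlift
  let avgH : S →ₗ[R] S :=
    { toFun := fun f => avg (actRep (a.comp H.subtype)) f
      map_add' := map_add _
      map_smul' := fun c f =>
        congrArg Subtype.val ((reynolds hR').map_smul ⟨c, hRR' c c.2⟩ f) }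
  have havg : ∀ f ∈ R', avgH f = f := fun f hf =>
    avg_of_invariant _ fun γ => (hR' f).1 hf γ
  have hrange : ∀ f, f ∈ LinearMap.range avgH ↔ f ∈ R' := by
    intro f
    constructor
    · rintro ⟨g, rfl⟩
      exact avg_mem_of_isInv hR' g
    · intro hf
      exact ⟨f, havg f hf⟩
  -- `R'` is regarded as the range of the averaging over `H`, which is `R`-linear: this makes it a
  -- finite `R`-module, and it sends `ptIdeal R e • S` into `ptIdeal R e • R'`.
  obtain ⟨u, hu1, hu⟩ := exists_mul_mem_span (R := R) (LinearMap.range avgH) w e (by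
    intro f hf
    have hf' := (hrange f).1 hf
    have h0 : Ideal.Quotient.mk (fibreIdeal R e) f ∈ U := ⟨f, hf', rfl⟩
    have h1 : (⟨_, h0⟩ : U) ∈ Submodule.span k (Set.range b) := by
      rw [b.span_eq]; trivial
    have h1' : Ideal.Quotient.mk (fibreIdeal R e) f
        ∈ Submodule.map U.subtype (Submodule.span k (Set.range b)) := ⟨_, h1, rfl⟩
    have h2 : U.subtype '' Set.range b
        = (Ideal.Quotient.mkₐ k (fibreIdeal R e)).toLinearMap '' Set.range w := by
      rw [← Set.range_comp, ← Set.range_comp]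
      exact congrArg Set.range (funext fun i => (hwb i).symm)
    rw [Submodule.map_span, h2, ← Submodule.map_span] at h1'
    obtain ⟨g, hg, hgf⟩ := h1'
    refine ⟨g, hg, ?_⟩
    have h3 : f - g ∈ fibreIdeal R e := Ideal.Quotient.eq.1 hgf.symm
    have h4 : f - g ∈ ptIdeal R e • (⊤ : Submodule R S) := by
      rw [← SetLike.mem_coe, ← fibreIdeal_eq_smul]; exact h3
    have hgR : g ∈ R' := by
      have : Submodule.span k (Set.range w) ≤ R'.toSubmodule :=
        Submodule.span_le.2 (by rintro _ ⟨i, rfl⟩; exact hw i)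
      exact this hg
    have h5 := Submodule.mem_map_of_mem (f := avgH) h4
    rw [Submodule.map_smul'', Submodule.map_top, havg _ (sub_mem hf' hgR)] at h5
    exact h5)
  -- Dedekind's independence of characters, applied to the maps `R' → S/p` attached to the cosets;
  -- `hH` says precisely that they are distinct. The denominator `u` is harmless because `u ∉ p`.
  have key : ∀ p : Ideal S, p.IsPrime → p.IsPrincipal → p ≤ RingHom.ker e →
      LinearIndependent (S ⧸ p) (fun (c : Γ ⧸ H) i => Ideal.Quotient.mk p (a c.out (w i))) := by
    intro p hp hpp hpe
    let φ : Γ ⧸ H → (R' →* S ⧸ p) := fun c =>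
      ((Ideal.Quotient.mk p : S →+* S ⧸ p) : S →* S ⧸ p).comp
        (((a c.out : S →ₐ[k] S) : S →* S).comp (R'.val : R' →* S))
    have hφ : Function.Injective φ := by
      intro c c' h
      have := hH p c.out c'.out hp hpp hpe (fun f hf =>
        Ideal.Quotient.eq.1 (DFunLike.congr_fun h ⟨f, hf⟩))
      rw [← QuotientGroup.eq, QuotientGroup.out_eq', QuotientGroup.out_eq'] at this
      exact this
    have hli := (linearIndependent_monoidHom R' (S ⧸ p)).comp _ hφ
    rw [Fintype.linearIndependent_iff] at hli ⊢
    intro α hα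
    refine hli α ?_
    funext f
    have h7 : ∀ g ∈ Submodule.span R (Set.range w),
        ∑ c : Γ ⧸ H, α c * Ideal.Quotient.mk p (a c.out g) = 0 := by
      intro g hg
      refine Submodule.span_induction
        (p := fun g _ => ∑ c : Γ ⧸ H, α c * Ideal.Quotient.mk p (a c.out g) = 0) ?_ ?_ ?_ ?_ hg
      · rintro _ ⟨i, rfl⟩
        have := congrFun hα i
        simpa [Finset.sum_apply] using this
      · simp
      · intro f g _ _ hf hg
        simp only [map_add, mul_add, Finset.sum_add_distrib, hf, hg, add_zero]
      · intro c f _ hf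
        have : ∀ d : Γ ⧸ H, α d * Ideal.Quotient.mk p (a d.out (c • f))
            = Ideal.Quotient.mk p c * (α d * Ideal.Quotient.mk p (a d.out f)) := fun γ => by
          change α γ * Ideal.Quotient.mk p (a _ ((c : S) * f)) = _
          rw [map_mul, map_mul, (hR c).1 c.2 _]; ring
        simp only [this, ← Finset.mul_sum, hf, mul_zero]
    have h8 := h7 _ (hu f ((hrange f).2 f.2))
    have h9 : ∀ c : Γ ⧸ H, α c * Ideal.Quotient.mk p (a c.out ((u : S) * f))
        = Ideal.Quotient.mk p u * (α c * Ideal.Quotient.mk p (a c.out f)) := fun c => by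
      rw [map_mul, map_mul, (hR u).1 u.2 _]; ring
    simp only [h9, ← Finset.mul_sum] at h8
    rcases mul_eq_zero.1 h8 with h | h
    · have : e u = 0 := hpe (Ideal.Quotient.eq_zero_iff_mem.1 h)
      rw [hu1] at this
      exact absurd this one_ne_zero
    · simpa [φ, Finset.sum_apply] using h
  -- The zero ideal counts as a principal prime: independence over `S` itself gives the missing
  -- inequality and makes the matrix below square.
  have hcard : Nat.card (Γ ⧸ H) = Module.finrank k U := by
    refine le_antisymm ?_ hle
    have := (key ⊥ Ideal.isPrime_bot inferInstance bot_le).fintype_card_le_finrank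
    rwa [Module.finrank_fintype_fun_eq_card, Fintype.card_fin, ← Nat.card_eq_fintype_card] at this
  by_contra hne
  obtain ⟨q⟩ : Nonempty (Γ ⧸ H ≃ Fin (Module.finrank k U)) := by
    rw [← Fintype.card_eq, Fintype.card_fin, ← hcard, Nat.card_eq_fintype_card]
  let M : Matrix (Γ ⧸ H) (Γ ⧸ H) S := Matrix.of fun c d => a c.out (w (q d))
  have hdet : ∀ p : Ideal S, p.IsPrime → p.IsPrincipal → p ≤ RingHom.ker e → M.det ∉ p := by
    intro p hp hpp hpe h0
    have h1 : ((Ideal.Quotient.mk p).mapMatrix M).det = 0 := by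
      rw [← RingHom.map_det]
      exact Ideal.Quotient.eq_zero_iff_mem.2 h0
    obtain ⟨v, hv0, hv⟩ := Matrix.exists_vecMul_eq_zero_iff.2 h1
    refine hv0 (funext (Fintype.linearIndependent_iff.1 (key p hp hpp hpe) v ?_))
    funext i
    have := congrFun hv (q.symm i)
    simpa [M, Matrix.vecMul, dotProduct, Finset.sum_apply] using this
  have hdet0 : M.det ≠ 0 := hdet ⊥ Ideal.isPrime_bot inferInstance bot_le
  -- The point `e` is fixed by `Γ`, so at `e` the rows of all cosets coincide, and there are two
  -- different cosets.
  have hedet : e M.det = 0 := by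
    have h1 : e M.det = ((e : S →+* k).mapMatrix M).det := RingHom.map_det (e : S →+* k) M
    rw [h1]
    obtain ⟨γ, hγ⟩ : ∃ γ, γ ∉ H := by
      by_contra! h
      exact hne ((Subgroup.eq_top_iff' H).2 h)
    refine Matrix.det_zero_of_row_eq (i := (QuotientGroup.mk γ : Γ ⧸ H))
      (j := QuotientGroup.mk 1) ?_ ?_
    · intro h
      rw [QuotientGroup.eq, mul_one, inv_mem_iff] at h
      exact hγ h
    · funext d
      simp [M, he]
  -- Some prime factor of the determinant vanishes at `e` and generates a prime ideal excluded by
  -- `hdet`; this is where factoriality of `S` enters.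
  obtain ⟨f, hf, v, hv⟩ := UniqueFactorizationMonoid.exists_prime_factors _ hdet0
  have h2 : ∃ π ∈ f, e π = 0 := by
    rw [← hv, map_mul, map_multiset_prod] at hedet
    rcases mul_eq_zero.1 hedet with h | h
    · have := Multiset.prod_eq_zero_iff.1 h
      obtain ⟨π, hπ, hπ0⟩ := Multiset.mem_map.1 this
      exact ⟨π, hπ, hπ0⟩
    · exact absurd h ((v.map (e : S →* k)).ne_zero)
  obtain ⟨π, hπf, hπ⟩ := h2
  have hπp := hf π hπf
  refine hdet (Ideal.span {π}) ((Ideal.span_singleton_prime hπp.ne_zero).2 hπp)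
    ⟨π, rfl⟩ ((Ideal.span_singleton_le_iff_mem _).2 hπ) ?_
  rw [Ideal.mem_span_singleton, ← hv]
  exact dvd_mul_of_dvd_left (Multiset.dvd_prod hπf) _

end Coset

end GoodQuotient

namespace GoodQuotient

/-! ### Symmetric algebras -/

section Sym

variable {k M : Type*} [Field k] [AddCommGroup M] [Module k M]

open SymmetricAlgebra in
theorem algHom_sub_mem {T : Type*} [CommRing T] [Algebra k T] (F G : SymmetricAlgebra k M →ₐ[k] T)
    (J : Ideal T) (h : ∀ m, F (ι k M m) - G (ι k M m) ∈ J) (f : SymmetricAlgebra k M) :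
    F f - G f ∈ J := by
  have h1 : (Ideal.Quotient.mkₐ k J).comp F = (Ideal.Quotient.mkₐ k J).comp G := by
    apply algHom_ext
    ext m
    exact Ideal.Quotient.eq.2 (h m)
  exact Ideal.Quotient.eq.1 (DFunLike.congr_fun h1 f)

theorem ι_injective : Function.Injective (SymmetricAlgebra.ι k M) := by
  intro m m' h
  by_contra hne
  obtain ⟨l, hl⟩ : ∃ l : Module.Dual k M, l (m - m') ≠ 0 := by
    by_contra! hc
    exact hne (sub_eq_zero.1 ((Module.forall_dual_apply_eq_zero_iff k _).1 hc))
  apply hl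
  rw [map_sub, ← SymmetricAlgebra.lift_ι_apply l m, ← SymmetricAlgebra.lift_ι_apply l m', h, sub_self]

open SymmetricAlgebra in
/-- For a nonzero vector `m`, an endomorphism of the symmetric algebra that kills exactly the
ideal generated by `m`. -/
theorem exists_endomorphism_killing {m : M} (hm : m ≠ 0) :
    ∃ Q : SymmetricAlgebra k M →ₐ[k] SymmetricAlgebra k M,
      (∀ f, Q f = 0 ↔ ι k M m ∣ f) ∧ ∀ m', Q (ι k M m') = 0 → m' ∈ Submodule.span k {m} := by
  obtain ⟨l, hl⟩ : ∃ l : Module.Dual k M, l m ≠ 0 := by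
    by_contra! hc
    exact hm ((Module.forall_dual_apply_eq_zero_iff k _).1 hc)
  let q : M →ₗ[k] M := LinearMap.id - (l m)⁻¹ • l.smulRight m
  have hq : ∀ m', q m' = m' - ((l m)⁻¹ * l m') • m := fun m' => by
    simp [q, mul_smul]
  let Q : SymmetricAlgebra k M →ₐ[k] SymmetricAlgebra k M := lift (ι k M ∘ₗ q)
  have hQ : ∀ m', Q (ι k M m') = ι k M (q m') := fun m' => lift_ι_apply _ _
  refine ⟨Q, fun f => ⟨fun h => ?_, ?_⟩, fun m' h => ?_⟩
  · have h1 := algHom_sub_mem (AlgHom.id k _) Q (Ideal.span {ι k M m}) (fun m' => by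
      rw [hQ, AlgHom.id_apply, ← map_sub, hq, sub_sub_cancel, map_smul]
      exact Submodule.smul_of_tower_mem _ _ (Ideal.mem_span_singleton_self _)) f
    rw [h, sub_zero] at h1
    exact Ideal.mem_span_singleton.1 h1
  · rintro ⟨g, rfl⟩
    rw [map_mul, hQ, hq, inv_mul_cancel₀ hl, one_smul, sub_self, map_zero, zero_mul]
  · rw [hQ] at h
    have h0 : q m' = 0 := ι_injective (by rw [h, map_zero])
    rw [hq, sub_eq_zero] at h0
    rw [h0]
    exact Submodule.smul_mem _ _ (Submodule.mem_span_singleton_self m)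

/-- The ideal generated by the form is the kernel of an endomorphism of a domain. -/
theorem ι_prime {m : M} (hm : m ≠ 0) : Prime (SymmetricAlgebra.ι k M m) := by
  obtain ⟨Q, hQ, -⟩ := exists_endomorphism_killing (k := k) hm
  refine ⟨fun h => hm (ι_injective (k := k) (by rw [h, map_zero])), fun h => ?_, fun f g h => ?_⟩
  · have := h.map (SymmetricAlgebra.algebraMapInv (R := k) (M := M))
    rw [SymmetricAlgebra.algebraMapInv_ι] at this
    exact not_isUnit_zero this
  · rw [← hQ, map_mul, mul_eq_zero] at h
    exact h.imp (hQ f).1 (hQ g).1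

/-- A generator of `p` that divides a nonzero linear form is associated to it, as the form is prime;
every other form in `p` is then divisible by it, hence proportional to it. -/
theorem finrank_linear_forms_le_one (p : Ideal (SymmetricAlgebra k M)) [p.IsPrime]
    (hp : p.IsPrincipal) (L : Submodule k M) (hL : ∀ m ∈ L, SymmetricAlgebra.ι k M m ∈ p) :
    Module.finrank k L ≤ 1 := by
  obtain ⟨π, rfl⟩ := hp
  by_cases h0 : ∃ m ∈ L, m ≠ 0
  · obtain ⟨m, hmL, hm⟩ := h0
    have h1 : π ∣ SymmetricAlgebra.ι k M m := Ideal.mem_span_singleton.1 (hL m hmL)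
    have hπu : ¬ IsUnit π := fun h => Ideal.IsPrime.ne_top ‹_› (Ideal.span_singleton_eq_top.2 h)
    have h2 : SymmetricAlgebra.ι k M m ∣ π :=
      (((ι_prime hm).irreducible.dvd_iff.1 h1).resolve_left hπu).dvd
    obtain ⟨Q, hQ, hQ'⟩ := exists_endomorphism_killing (k := k) hm
    refine finrank_le_one (⟨m, hmL⟩ : L) fun w => ?_
    have h3 := hQ' w ((hQ _).2 (h2.trans (Ideal.mem_span_singleton.1 (hL w w.2))))
    obtain ⟨c, hc⟩ := Submodule.mem_span_singleton.1 h3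
    exact ⟨c, Subtype.ext hc⟩
  · push Not at h0
    refine finrank_le_one (0 : L) fun w => ⟨0, ?_⟩
    rw [smul_zero]
    exact Subtype.ext (h0 w w.2).symm

variable [FiniteDimensional k M]

instance finiteType_symmetricAlgebra : Algebra.FiniteType k (SymmetricAlgebra k M) :=
  Algebra.FiniteType.equiv inferInstance
    (SymmetricAlgebra.equivMvPolynomial (Module.finBasis k M)).symm

instance isNoetherianRing_symmetricAlgebra : IsNoetherianRing (SymmetricAlgebra k M) :=
  Algebra.FiniteType.isNoetherianRing k _

instance ufd_symmetricAlgebra : UniqueFactorizationMonoid (SymmetricAlgebra k M) :=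
  (SymmetricAlgebra.equivMvPolynomial (Module.finBasis k M)).symm.toMulEquiv.uniqueFactorizationMonoid
    inferInstance

theorem ringKrullDim_symmetricAlgebra :
    ringKrullDim (SymmetricAlgebra k M) = Module.finrank k M := by
  rw [ringKrullDim_eq_of_ringEquiv
    (SymmetricAlgebra.equivMvPolynomial (Module.finBasis k M)).toRingEquiv]
  simp

end Sym

/-! ### Reflection groups and the length of the zero fibre -/

section SymAct

variable {k Γ M : Type*} [Field k] [Group Γ] [AddCommGroup M] [Module k M]
  (r : Representation k Γ M)

@[simp] theorem symAct_ι (γ : Γ) (m : M) :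
    symAct r γ (SymmetricAlgebra.ι k M m) = SymmetricAlgebra.ι k M (r γ m) :=
  SymmetricAlgebra.lift_ι_apply _ _

theorem algebraMapInv_symAct (γ : Γ) (f : SymmetricAlgebra k M) :
    SymmetricAlgebra.algebraMapInv (symAct r γ f)
      = (SymmetricAlgebra.algebraMapInv f : k) := by
  have h : (SymmetricAlgebra.algebraMapInv (R := k) (M := M)).comp (symAct r γ)
      = SymmetricAlgebra.algebraMapInv := by
    apply SymmetricAlgebra.algHom_ext
    ext m
    simp [SymmetricAlgebra.algebraMapInv_ι]
  exact DFunLike.congr_fun h f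

variable {r}

theorem symAct_injective (hr : Function.Injective r) : Function.Injective (symAct r) := by
  intro γ δ h
  refine hr (LinearMap.ext fun m => ι_injective (k := k) ?_)
  rw [← symAct_ι, h, symAct_ι]

theorem isReflection_of_finrank_range_le_one [Finite Γ] [FiniteDimensional k M] {γ : Γ}
    (h1 : r γ ≠ 1) (h : Module.finrank k (LinearMap.range (r γ - 1)) ≤ 1) :
    IsReflection (r γ) := by
  refine ⟨MonoidHom.isOfFinOrder r (isOfFinOrder_of_finite γ), ?_⟩
  have h2 := LinearMap.finrank_range_add_finrank_ker (r γ - 1)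
  have h3 : Module.finrank k (LinearMap.range (r γ - 1)) ≠ 0 := by
    intro h0
    rw [Submodule.finrank_eq_zero, LinearMap.range_eq_bot, sub_eq_zero] at h0
    exact h1 h0
  omega

-- The orbit polynomial of `b` under `H` has coefficients in `R'`, so its transforms by `γ` and `δ`
-- agree modulo `p`. As `δ b` is a root of one of them, it equals in the domain `S/p` one of the
-- roots `γ η b` of the other.
open Polynomial in
theorem exists_sub_mem_of_forall_invariant {S : Type*} [CommRing S] [Algebra k S] {H : Subgroup Γ}
    [Finite H] {a : Γ →* (S →ₐ[k] S)} {R' : Subalgebra k S} (hR' : IsInv (a.comp H.subtype) R')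
    (p : Ideal S) [p.IsPrime] {γ δ : Γ} (h : ∀ f ∈ R', a γ f - a δ f ∈ p) (b : S) :
    ∃ η : H, a δ b - a (γ * η) b ∈ p := by
  let := Fintype.ofFinite H
  have h1 : ((orbitPoly (a.comp H.subtype) b).map (a γ : S →+* S)).map (Ideal.Quotient.mk p)
      = ((orbitPoly (a.comp H.subtype) b).map (a δ : S →+* S)).map (Ideal.Quotient.mk p) := by
    ext i
    simp only [coeff_map]
    exact Ideal.Quotient.eq.2 (h _ (orbitPoly_coeff_mem hR' b i))
  have h2 : (((orbitPoly (a.comp H.subtype) b).map (a δ : S →+* S)).map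
      (Ideal.Quotient.mk p)).eval (Ideal.Quotient.mk p (a δ b)) = 0 := by
    rw [eval_map_apply]
    have : (eval (a δ b)) ((orbitPoly (a.comp H.subtype) b).map (a δ : S →+* S)) = 0 := by
      have := eval_map_apply (p := orbitPoly (a.comp H.subtype) b) (a δ : S →+* S) b
      rw [orbitPoly_eval, map_zero] at this
      exact this
    rw [this, map_zero]
  rw [← h1, orbitPoly, Polynomial.map_prod, Polynomial.map_prod, eval_prod] at h2
  obtain ⟨η, -, hη⟩ := Finset.prod_eq_zero_iff.1 h2
  refine ⟨η, ?_⟩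
  rw [act_mul]
  refine Ideal.Quotient.eq.1 ?_
  simpa [sub_eq_zero] using hη

variable [Finite Γ] [FiniteDimensional k M] [CharZero k]

/-- A finite group of automorphisms is generated by reflections as soon as the zero fibre of the
quotient map has length at most the order of the group. -/
theorem isReflectionGroup_of_finrank_le (hr : Function.Injective r)
    {R : Subalgebra k (SymmetricAlgebra k M)} (hR : IsInv (symAct r) R)
    (hd : Module.finrank k (SymmetricAlgebra k M ⧸ fibreIdeal R SymmetricAlgebra.algebraMapInv)
      ≤ Nat.card Γ) : IsReflectionGroup r := by
  refine ⟨hr, ?_⟩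
  have : Module.Finite R (SymmetricAlgebra k M) := finite_of_isInv hR
  set H := Subgroup.closure {γ : Γ | IsReflection (r γ)} with hH
  refine eq_top_of_finrank_le (symAct_injective hr) hR _ (algebraMapInv_symAct r) hd
    (isInv_inv ((symAct r).comp H.subtype)) fun p γ δ hp hpp _ h => ?_
  let P : H → Submodule k M := fun η =>
    (p.restrictScalars k).comap (SymmetricAlgebra.ι k M ∘ₗ (r δ - r (γ * η)))
  -- A priori `η` depends on the linear form. A vector space over an infinite field is not a finite
  -- union of proper subspaces, so a single `η` serves for all forms.
  obtain ⟨η, hη⟩ := Subspace.exists_eq_top_of_iUnion_eq_univ (p := P) (by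
    rw [Set.eq_univ_iff_forall]
    intro m
    obtain ⟨η, hη⟩ := exists_sub_mem_of_forall_invariant
      (isInv_inv ((symAct r).comp H.subtype)) p h (SymmetricAlgebra.ι k M m)
    rw [symAct_ι, symAct_ι, ← map_sub] at hη
    exact Set.mem_iUnion.2 ⟨η, hη⟩)
  -- The image of `r g - 1` is, up to `r (γ * η)`, a space of linear forms contained in `p`, hence
  -- at most a line: `g` is `1` or a reflection.
  let g := (γ * η)⁻¹ * δ
  have hgl : Module.finrank k (LinearMap.range (r g - 1)) ≤ 1 := by
    have h1 : LinearMap.range (r δ - r (γ * η))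
        = (LinearMap.range (r g - 1)).map (r (γ * η)) := by
      rw [← LinearMap.range_comp]
      congr 1
      change _ = r (γ * η) * (r g - 1)
      have h3 : r δ = r (γ * η) * r g := by
        rw [← map_mul]
        exact congrArg r (mul_inv_cancel_left _ _).symm
      rw [mul_sub, ← h3, mul_one]
    have h2 : Module.finrank k (LinearMap.range (r δ - r (γ * η))) ≤ 1 := by
      refine finrank_linear_forms_le_one p hpp _ ?_
      rintro _ ⟨m, rfl⟩
      have : m ∈ P η := by rw [hη]; trivial
      exact this
    have hinj : Function.Injective (r (γ * η)) := fun m m' hm => by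
      have := congrArg (r (γ * η)⁻¹) hm
      simpa only [← Module.End.mul_apply, ← map_mul, inv_mul_cancel, map_one,
        Module.End.one_apply] using this
    rwa [h1, ← (Submodule.equivMapOfInjective _ hinj _).finrank_eq] at h2
  have hg : g ∈ H := by
    by_cases h1 : r g = 1
    · rw [hr (h1.trans (map_one r).symm)]
      exact one_mem _
    · exact Subgroup.subset_closure (isReflection_of_finrank_range_le_one h1 hgl)
  have : γ⁻¹ * δ = η * g := by simp [g, mul_assoc]
  rw [this]
  exact mul_mem η.2 hg

end SymAct

end GoodQuotient

/-! ### Divided differences and Chevalley's theorem. -/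

namespace GoodQuotient

section Chevalley

variable {k Γ M : Type*} [Field k] [Group Γ] [AddCommGroup M] [Module k M]
  {r : Representation k Γ M} {R : Subalgebra k (SymmetricAlgebra k M)}

open SymmetricAlgebra

/-- The divided difference operator of a reflection. -/
theorem exists_root (γ : Γ) (hγ : IsReflection (r γ)) :
    ∃ v : M, v ≠ 0 ∧ ∀ f, ι k M v ∣ symAct r γ f - f := by
  obtain ⟨v, hv⟩ : ∃ v : M, LinearMap.range (r γ - 1) = Submodule.span k {v} := by
    have hpos : 0 < Module.finrank k M := by have := hγ.2; omega
    have : FiniteDimensional k M := Module.finite_of_finrank_pos hpos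
    have h1 := LinearMap.finrank_range_add_finrank_ker (r γ - 1)
    have h2 := hγ.2
    have h3 : Module.finrank k (LinearMap.range (r γ - 1)) = 1 := by omega
    obtain ⟨v, -, hv⟩ := finrank_eq_one_iff'.1 h3
    refine ⟨v, le_antisymm (fun w hw => ?_) ((Submodule.span_singleton_le_iff_mem _ _).2 v.2)⟩
    obtain ⟨c, hc⟩ := hv ⟨w, hw⟩
    exact Submodule.mem_span_singleton.2 ⟨c, congrArg Subtype.val hc⟩
  refine ⟨v, ?_, fun f => ?_⟩
  · rintro rfl
    rw [Submodule.span_zero_singleton, LinearMap.range_eq_bot, sub_eq_zero] at hv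
    have := hγ.2
    rw [hv, sub_self, LinearMap.ker_zero, finrank_top] at this
    omega
  · rw [← Ideal.mem_span_singleton]
    refine algHom_sub_mem (symAct r γ) (AlgHom.id k _) _ (fun m => ?_) f
    rw [symAct_ι, AlgHom.id_apply, ← map_sub]
    have : (r γ - 1) m ∈ Submodule.span k {v} := by rw [← hv]; exact ⟨m, rfl⟩
    obtain ⟨c, hc⟩ := Submodule.mem_span_singleton.1 this
    have h2 : r γ m - m = c • v := hc.symm
    rw [h2, map_smul]
    exact Submodule.smul_of_tower_mem _ _ (Ideal.mem_span_singleton_self _)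

variable [Finite Γ] [FiniteDimensional k M] [CharZero k]

/-- By induction on the order at `0`: for a reflection, `γ f - f` is a linear form times an element
of `Q`, which gains one order. Since reflections generate, `f` is congruent to its average, an
invariant in `Q`, which vanishes at `0` by `h3`. The induction may stop because the fibre ideal
contains a power of the ideal of `0`. -/
theorem le_fibreIdeal_of_stable (hr : IsReflectionGroup r) (hR : IsInv (symAct r) R)
    (Q : Submodule k (SymmetricAlgebra k M)) (h1 : ∀ γ, ∀ f ∈ Q, symAct r γ f ∈ Q)
    (h2 : ∀ γ, IsReflection (r γ) → ∃ v : M, ∀ f ∈ Q, ∃ d ∈ Q, symAct r γ f - f = ι k M v * d)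
    (h3 : ∀ f ∈ Q, f ∈ R → algebraMapInv f = (0 : k)) :
    ∀ f ∈ Q, f ∈ fibreIdeal R algebraMapInv := by
  have key : ∀ n : ℕ, ∀ f ∈ Q, f ∈ fibreIdeal R algebraMapInv
      ⊔ RingHom.ker (algebraMapInv : SymmetricAlgebra k M →ₐ[k] k) ^ n := by
    intro n
    induction n with
    | zero => intro f _; rw [pow_zero, Ideal.one_eq_top, sup_top_eq]; trivial
    | succ n ih =>
      set T := fibreIdeal R algebraMapInv
        ⊔ RingHom.ker (algebraMapInv : SymmetricAlgebra k M →ₐ[k] k) ^ (n + 1) with hT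
      have hγ : ∀ γ : Γ, ∀ f ∈ Q, symAct r γ f - f ∈ T := by
        intro γ
        have : γ ∈ Subgroup.closure {γ : Γ | IsReflection (r γ)} := by rw [hr.2]; trivial
        induction this using Subgroup.closure_induction with
        | mem γ hγ =>
          intro f hf
          obtain ⟨v, hv⟩ := h2 γ hγ
          obtain ⟨d, hd, hfd⟩ := hv f hf
          rw [hfd]
          obtain ⟨x, hx, y, hy, hxy⟩ := Submodule.mem_sup.1 (ih d hd)
          rw [← hxy, mul_add]
          refine Submodule.add_mem_sup (Ideal.mul_mem_left _ _ hx) ?_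
          rw [pow_succ']
          exact Ideal.mul_mem_mul (algebraMapInv_ι v) hy
        | one => intro f _; simp
        | mul γ δ _ _ ihγ ihδ =>
          intro f hf
          rw [act_mul, ← sub_add_sub_cancel _ (symAct r δ f) f]
          exact add_mem (ihγ _ (h1 _ _ hf)) (ihδ _ hf)
        | inv γ _ ihγ =>
          intro f hf
          have := ihγ _ (h1 γ⁻¹ _ hf)
          rw [act_act_inv] at this
          rw [← neg_sub]
          exact neg_mem this
      intro f hf
      have h4 : avg (actRep (symAct r)) f - f ∈ T.restrictScalars k :=
        avg_sub_mem _ (T.restrictScalars k) fun γ => hγ γ f hf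
      have h5 : avg (actRep (symAct r)) f ∈ R := avg_mem_of_isInv hR f
      have h6 : avg (actRep (symAct r)) f ∈ T := by
        refine Submodule.mem_sup_left (mem_fibreIdeal_of_mem h5 (h3 _ ?_ h5))
        exact avg_mem _ Q fun γ => h1 γ f hf
      rw [← sub_sub_cancel (avg (actRep (symAct r)) f) f]
      exact sub_mem h6 h4
  obtain ⟨n, hn⟩ := exists_pow_le_map_ptIdeal hR algebraMapInv
    (q := RingHom.ker (algebraMapInv : SymmetricAlgebra k M →ₐ[k] k))
    (fun b hb γ => by rw [algebraMapInv_symAct]; exact hb)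
  intro f hf
  exact sup_le le_rfl hn (key n f hf)

/-- Freeness in Chevalley's theorem: independence in the zero fibre lifts to independence over the
invariants. A relation among `n + 1` elements is turned into one among `n` elements that are still
independent in the fibre. -/
theorem eq_zero_of_sum_eq_zero (hr : IsReflectionGroup r) (hR : IsInv (symAct r) R) :
    ∀ (n : ℕ) (z : Fin n → SymmetricAlgebra k M),
    LinearIndependent k (fun i => Ideal.Quotient.mk (fibreIdeal R algebraMapInv) (z i)) →
    ∀ y : Fin n → R, ∑ i, (y i : SymmetricAlgebra k M) * z i = 0 → y = 0 := by
  intro n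
  induction n with
  | zero => intro z _ y _; exact Subsingleton.elim _ _
  | succ n ih =>
    intro z hz y hy
    rw [Fin.sum_univ_succ] at hy
    let J : Ideal R := Ideal.span (Set.range fun i : Fin n => y i.succ)
    let JS : Ideal (SymmetricAlgebra k M) := J.map (algebraMap R _)
    have hJS : ∀ γ, ∀ f ∈ JS, symAct r γ f ∈ JS := by
      intro γ
      have : JS ≤ JS.comap (symAct r γ) := Ideal.map_le_iff_le_comap.2 fun g hg => by
        change symAct r γ (g : SymmetricAlgebra k M) ∈ JS
        rw [(hR g).1 g.2 γ]
        exact Ideal.mem_map_of_mem _ hg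
      exact this
    -- The colon ideal of `J S` by `y 0`. The divided differences are `R`-linear, hence preserve `J
    -- S` and `Q`; it contains `z 0`, which is nonzero in the fibre, so `Q` must contain an
    -- invariant `f` that does not vanish at `0`.
    let Q : Submodule k (SymmetricAlgebra k M) :=
      (JS.restrictScalars k).comap (LinearMap.mulLeft k (y 0 : SymmetricAlgebra k M))
    have hQ : ∀ f, f ∈ Q ↔ (y 0 : SymmetricAlgebra k M) * f ∈ JS := fun f => Iff.rfl
    have hz0 : z 0 ∈ Q := by
      rw [hQ, eq_neg_of_add_eq_zero_left hy]
      refine neg_mem (sum_mem fun i _ => Ideal.mul_mem_right _ _ ?_)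
      exact Ideal.mem_map_of_mem _ (Ideal.subset_span ⟨i, rfl⟩)
    obtain ⟨f, hfQ, hfR, hf0⟩ : ∃ f ∈ Q, f ∈ R ∧ algebraMapInv f ≠ (0 : k) := by
      by_contra! hc
      have hmem := le_fibreIdeal_of_stable hr hR Q (fun γ f hf => by
        rw [hQ] at hf ⊢
        have := hJS γ _ hf
        rwa [map_mul, (hR _).1 (y 0).2 γ] at this) (fun γ hγ => by
        obtain ⟨v, hv0, hv⟩ := exists_root γ hγ
        have hιv : ι k M v ≠ 0 := (ι_prime hv0).ne_zero
        refine ⟨v, fun f hf => ?_⟩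
        obtain ⟨d, hd⟩ := hv f
        refine ⟨d, ?_, hd⟩
        have hΔ : ∀ g ∈ JS, ∃ h ∈ JS, symAct r γ g - g = ι k M v * h := by
          intro g hg
          have hg' : g ∈ J • (⊤ : Submodule R (SymmetricAlgebra k M)) := by
            rw [Ideal.smul_top_eq_map]; exact hg
          refine Submodule.smul_induction_on hg' (fun c hc g _ => ?_) fun g g' hg hg' => ?_
          · obtain ⟨h, hh⟩ := hv g
            refine ⟨c * h, Ideal.mul_mem_right _ _ (Ideal.mem_map_of_mem _ hc), ?_⟩
            change symAct r γ ((c : SymmetricAlgebra k M) * g) - c * g = _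
            rw [map_mul, (hR _).1 c.2 γ, ← mul_sub, hh]
            ring
          · obtain ⟨h, hh, e⟩ := hg
            obtain ⟨h', hh', e'⟩ := hg'
            refine ⟨h + h', add_mem hh hh', ?_⟩
            rw [map_add, mul_add, ← e, ← e']
            ring
        obtain ⟨h, hh, e⟩ := hΔ _ ((hQ f).1 hf)
        rw [map_mul, (hR _).1 (y 0).2 γ, ← mul_sub, hd] at e
        rw [hQ]
        have : (y 0 : SymmetricAlgebra k M) * d = h := by
          apply mul_left_cancel₀ hιv
          rw [← e]; ring
        rwa [this]) hc _ hz0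
      exact hz.ne_zero 0 (Ideal.Quotient.eq_zero_iff_mem.2 hmem)
    have hyf : y 0 * ⟨f, hfR⟩ ∈ J := mem_of_coe_mem_map hR hfQ
    obtain ⟨c, hc⟩ := (Submodule.mem_span_range_iff_exists_fun R).1 hyf
    have hc' : ∑ i, (c i : SymmetricAlgebra k M) * y i.succ = y 0 * f := by
      have := congrArg Subtype.val hc
      simpa using this
    -- Multiplying the relation by `f` and substituting `y 0 * f = ∑ c i * y i.succ` eliminates `y
    -- 0`. The new elements `f z i.succ + c i z 0` remain independent in the fibre because `f` is a
    -- nonzero scalar there.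
    have htail : (fun i : Fin n => y i.succ) = 0 := by
      refine ih (fun i => f * z i.succ + c i * z 0) ?_ _ ?_
      · rw [Fintype.linearIndependent_iff] at hz ⊢
        intro α hα
        have hred : ∀ g : R, ∀ h : SymmetricAlgebra k M,
            Ideal.Quotient.mk (fibreIdeal R algebraMapInv) ((g : SymmetricAlgebra k M) * h)
            = (algebraMapInv (g : SymmetricAlgebra k M) : k)
              • Ideal.Quotient.mk (fibreIdeal R algebraMapInv) h := by
          intro g h
          rw [← Ideal.Quotient.mkₐ_eq_mk k, ← map_smul, Ideal.Quotient.mkₐ_eq_mk,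
            Ideal.Quotient.eq, Algebra.smul_def, ← sub_mul]
          refine Ideal.mul_mem_right _ _
            (mem_fibreIdeal_of_mem (sub_mem g.2 (R.algebraMap_mem _)) ?_)
          rw [map_sub, AlgHom.commutes]
          exact sub_self _
        have h1 := hz (Fin.cons (∑ i, α i * algebraMapInv (c i : SymmetricAlgebra k M))
          fun i => α i * algebraMapInv f) (by
            rw [Fin.sum_univ_succ, ← hα]
            simp only [Fin.cons_zero, Fin.cons_succ, map_add, smul_add, Finset.sum_add_distrib]
            rw [add_comm, Finset.sum_smul]
            congr 1
            · refine Finset.sum_congr rfl fun i _ => ?_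
              rw [hred ⟨f, hfR⟩, mul_smul]
            · refine Finset.sum_congr rfl fun i _ => ?_
              rw [hred, mul_smul])
        intro i
        have h2 := h1 i.succ
        rw [Fin.cons_succ] at h2
        exact (mul_eq_zero.1 h2).resolve_right hf0
      · have : ∀ i : Fin n, (y i.succ : SymmetricAlgebra k M) * (f * z i.succ + c i * z 0)
            = f * (y i.succ * z i.succ) + c i * y i.succ * z 0 := fun i => by ring
        simp only [this, Finset.sum_add_distrib, ← Finset.mul_sum, ← Finset.sum_mul, hc']
        rw [mul_comm (y 0 : SymmetricAlgebra k M) f, mul_assoc, ← mul_add, add_comm, hy, mul_zero]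
    have h0 : y 0 = 0 := by
      have h1 : ∀ i : Fin n, y i.succ = 0 := fun i => congrFun htail i
      simp only [h1, ZeroMemClass.coe_zero, zero_mul, Finset.sum_const_zero, add_zero] at hy
      rcases mul_eq_zero.1 hy with h | h
      · exact Subtype.ext h
      · exfalso
        refine hz.ne_zero 0 ?_
        simp only [h, map_zero]
    funext i
    refine Fin.cases h0 (fun j => congrFun htail j) i

end Chevalley

/-! ### Independence over the invariants and the order of the group. -/

section Artin

variable {k S Γ : Type*} [Field k] [CommRing S] [Algebra k S] [Group Γ]
  {a : Γ →* (S →ₐ[k] S)} {R : Subalgebra k S} [IsDomain S] [Finite Γ]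

/-- A family that is linearly independent over the invariants has at most `|Γ|` elements. -/
theorem le_card_of_independent (ha : Function.Injective a) (hR : IsInv a R) {n : ℕ} (z : Fin n → S)
    (hz : ∀ y : Fin n → R, ∑ i, (y i : S) * z i = 0 → y = 0) : n ≤ Nat.card Γ := by
  classical
  have := Fintype.ofFinite Γ
  have hli : LinearIndependent S fun (i : Fin n) (γ : Γ) => a γ (z i) := by
    rw [Fintype.linearIndependent_iff]
    intro c hc
    have hc' : ∀ γ, ∑ i, c i * a γ (z i) = 0 := fun γ => by
      have := congrFun hc γ
      simpa [Finset.sum_apply] using this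
    have htr : ∀ b : S, ∑ γ, a γ b ∈ R := fun b => (hR _).2 fun δ => by
      rw [map_sum]
      simp only [← act_mul]
      exact Fintype.sum_equiv (Equiv.mulLeft δ) _ _ fun _ => rfl
    -- An `S`-linear relation is multiplied by an arbitrary `b` and summed over its conjugates,
    -- which gives a relation with coefficients the traces of `b * c i`. They vanish for all `b`,
    -- and independence of characters then kills `c i`.
    have h1 : ∀ b i, ∑ γ, a γ (b * c i) = 0 := by
      intro b
      have := hz (fun i => ⟨_, htr (b * c i)⟩) (by
        simp only [Finset.sum_mul]
        rw [Finset.sum_comm]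
        refine Finset.sum_eq_zero fun γ _ => ?_
        have h2 : ∀ i, a γ (b * c i) * z i = a γ b * a γ (c i * a γ⁻¹ (z i)) := fun i => by
          rw [map_mul, map_mul, act_act_inv, mul_assoc]
        simp only [h2, ← Finset.mul_sum, ← map_sum, hc', map_zero, mul_zero])
      intro i
      exact congrArg Subtype.val (congrFun this i)
    have hinj : Function.Injective fun γ : Γ => ((a γ : S →* S)) := by
      intro γ δ h
      exact ha (AlgHom.ext fun f => DFunLike.congr_fun h f)
    have h2 := (linearIndependent_monoidHom S S).comp _ hinj
    rw [Fintype.linearIndependent_iff] at h2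
    intro i
    have h3 := h2 (fun γ => a γ (c i)) (by
      funext b
      have := h1 b i
      simp only [map_mul] at this
      simpa [Finset.sum_apply, mul_comm] using this) 1
    simpa using h3
  have := hli.fintype_card_le_finrank
  rwa [Module.finrank_fintype_fun_eq_card, Fintype.card_fin, ← Nat.card_eq_fintype_card] at this

end Artin

section Chevalley

variable {k Γ M : Type*} [Field k] [Group Γ] [AddCommGroup M] [Module k M]
  {r : Representation k Γ M} {R : Subalgebra k (SymmetricAlgebra k M)}
  [Finite Γ] [FiniteDimensional k M] [CharZero k]

open SymmetricAlgebra

/-- The zero fibre of the quotient by a finite reflection group has length at most the order of the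
group. -/
theorem finrank_fibre_le_of_isReflectionGroup (hr : IsReflectionGroup r)
    (hR : IsInv (symAct r) R) :
    Module.finrank k (SymmetricAlgebra k M ⧸ fibreIdeal R algebraMapInv) ≤ Nat.card Γ := by
  have : Module.Finite R (SymmetricAlgebra k M) := finite_of_isInv hR
  have := finite_quotient_fibreIdeal (R := R) (algebraMapInv (R := k) (M := M))
  let b := Module.finBasis k (SymmetricAlgebra k M ⧸ fibreIdeal R algebraMapInv)
  choose z hz using fun i => Ideal.Quotient.mk_surjective (b i)
  refine le_card_of_independent (symAct_injective hr.1) hR z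
    (eq_zero_of_sum_eq_zero hr hR _ z ?_)
  simp only [hz]
  exact b.linearIndependent

end Chevalley

end GoodQuotient

namespace GoodQuotient

/-! ### Dimensions -/

section Dimension

/-- Going up lifts chains of primes from `R` to `S`; incomparability shows that chains of `S`
contract to strict chains. -/
theorem ringKrullDim_eq_of_isIntegral {R S : Type*} [CommRing R] [CommRing S] [IsDomain S]
    [Algebra R S]
    [Algebra.IsIntegral R S] (hinj : Function.Injective (algebraMap R S)) :
    ringKrullDim R = ringKrullDim S := by
  apply le_antisymm
  · refine iSup_le fun l => ?_
    obtain ⟨Q, hQ, hQ'⟩ := Ideal.exists_ideal_over_prime_of_isIntegral_of_isDomain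
      (S := S) (RelSeries.head l).asIdeal (by
        rw [(RingHom.injective_iff_ker_eq_bot _).1 hinj]; exact bot_le)
    have : Q.LiesOver (RelSeries.head l).asIdeal := ⟨hQ'.symm⟩
    obtain ⟨L, hL, -⟩ := Ideal.exists_ltSeries_of_hasGoingUp l Q
    rw [← hL]
    exact le_iSup (fun L : LTSeries (PrimeSpectrum S) => ((L.length : ℕ∞) : WithBot ℕ∞)) L
  · refine Order.krullDim_le_of_strictMono (PrimeSpectrum.comap (algebraMap R S)) fun P Q h => ?_
    exact Ideal.IsIntegral.comap_lt_comap (R := R) (I := P.asIdeal) (J := Q.asIdeal) h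

variable {k M : Type*} [Field k] [AddCommGroup M] [Module k M] [FiniteDimensional k M]

-- Killing the first `i` basis vectors, for increasing `i`, gives a strict chain of prime kernels
-- inside the ideal of `0`.
open SymmetricAlgebra in
theorem finrank_le_height : ((Module.finrank k M : ℕ) : ℕ∞)
    ≤ (RingHom.ker (algebraMapInv : SymmetricAlgebra k M →ₐ[k] k)).height := by
  let b := Module.finBasis k M
  let q : ℕ → M →ₗ[k] M := fun i => b.constr k fun j => if (j : ℕ) < i then 0 else b j
  have hq : ∀ i j, q i (b j) = if (j : ℕ) < i then 0 else b j := fun i j => b.constr_basis k _ j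
  let Q : ℕ → SymmetricAlgebra k M →ₐ[k] SymmetricAlgebra k M := fun i => lift (ι k M ∘ₗ q i)
  have hQ : ∀ i m, Q i (ι k M m) = ι k M (q i m) := fun i m => lift_ι_apply _ _
  have hprime : ∀ i, (RingHom.ker (Q i)).IsPrime := fun i => RingHom.ker_isPrime _
  have hlt : ∀ i < Module.finrank k M, RingHom.ker (Q i) < RingHom.ker (Q (i + 1)) := by
    intro i hi
    have hcomp : (Q (i + 1)).comp (Q i) = Q (i + 1) := by
      apply algHom_ext
      refine b.ext fun j => ?_
      change Q (i + 1) (Q i (ι k M (b j))) = Q (i + 1) (ι k M (b j))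
      rw [hQ, hQ, hQ, hq, hq]
      split_ifs with h1 h2 h2
      · simp
      · omega
      · rw [hq, if_pos h2]
      · rw [hq, if_neg h2]
    refine lt_of_le_of_ne (fun f hf => ?_) fun h => ?_
    · have := DFunLike.congr_fun hcomp f
      rw [RingHom.mem_ker] at hf ⊢
      rw [← this, AlgHom.comp_apply, hf, map_zero]
    · have h1 : ι k M (b ⟨i, hi⟩) ∈ RingHom.ker (Q (i + 1)) := by
        rw [RingHom.mem_ker, hQ, hq, if_pos (Nat.lt_succ_self i), map_zero]
      rw [← h, RingHom.mem_ker, hQ, hq, if_neg (lt_irrefl i)] at h1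
      exact b.ne_zero _ (ι_injective (k := k) (by rw [h1, map_zero]))
  have hheight : ∀ i ≤ Module.finrank k M, (i : ℕ∞) ≤ (RingHom.ker (Q i)).height := by
    intro i
    induction i with
    | zero => intro _; exact bot_le
    | succ i ih =>
      intro hi
      have h1 := ih (by omega)
      have h2 := Ideal.height_add_one_le_of_lt_of_isPrime (hlt i hi)
      push_cast
      exact (add_le_add_left h1 1).trans h2
  refine (hheight _ le_rfl).trans (Ideal.height_mono fun f hf => ?_)
  have h1 : (algebraMapInv (R := k) (M := M)).comp (Q (Module.finrank k M)) = algebraMapInv := by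
    apply algHom_ext
    ext m
    change algebraMapInv (Q _ (ι k M m)) = (algebraMapInv (ι k M m) : k)
    rw [hQ, algebraMapInv_ι, algebraMapInv_ι]
  rw [RingHom.mem_ker] at hf ⊢
  have := DFunLike.congr_fun h1 f
  rw [← this, AlgHom.comp_apply, hf, map_zero]

-- A closed subscheme through the origin needs at least as many equations as its codimension. For
-- the goodness of `G_x` this is the inequality that does not come from comparing equations.
open SymmetricAlgebra in
theorem finrank_le_dim_add_spanFinrank {I : Ideal (SymmetricAlgebra k M)}
    (hI : I ≤ RingHom.ker (algebraMapInv : SymmetricAlgebra k M →ₐ[k] k)) :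
    ((Module.finrank k M : ℕ) : WithBot ℕ∞)
      ≤ ringKrullDim (SymmetricAlgebra k M ⧸ I) + (Submodule.spanFinrank I : ℕ) := by
  have : (RingHom.ker (algebraMapInv : SymmetricAlgebra k M →ₐ[k] k)).IsPrime :=
    RingHom.ker_isPrime _
  refine le_trans ?_ (height_le_ringKrullDim_quotient_add_spanFinrank hI)
  exact_mod_cast finrank_le_height (k := k) (M := M)

end Dimension

/-! ### Weights -/

section Weights

variable {k X : Type*} [Field k] [AddCommGroup X] [Module k X]

/-- The weight spaces of a linear action of `k^×`. -/
def wt (β : Representation k kˣ X) (n : ℕ) : Submodule k X where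
  carrier := {x | ∀ t : kˣ, β t x = (t : k) ^ n • x}
  add_mem' hx hy t := by rw [map_add, hx t, hy t, smul_add]
  zero_mem' t := by rw [map_zero, smul_zero]
  smul_mem' c x hx t := by rw [map_smul, hx t, smul_comm]

/-- The sum of the weight spaces of weight at least `N`. -/
def wtGE (β : Representation k kˣ X) (N : ℕ) : Submodule k X := ⨆ j, wt β (N + j)

variable {β : Representation k kˣ X}

theorem wt_le_wtGE {n N : ℕ} (h : N ≤ n) : wt β n ≤ wtGE β N := by
  obtain ⟨j, rfl⟩ := Nat.exists_eq_add_of_le h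
  exact le_iSup (fun j => wt β (N + j)) j

theorem wtGE_anti {m n : ℕ} (h : m ≤ n) : wtGE β n ≤ wtGE β m :=
  iSup_le fun _ => wt_le_wtGE (h.trans (Nat.le_add_right _ _))

variable [CharZero k]

theorem wt_iSupIndep (β : Representation k kˣ X) : iSupIndep (wt β) := by
  -- One scalar separates all weights: the powers of `2` are distinct in characteristic zero, so
  -- weight spaces lie in different eigenspaces of `2`.
  let u : kˣ := Units.mk0 2 two_ne_zero
  have hinj : Function.Injective fun n : ℕ => (2 : k) ^ n := fun m n h => by
    have h' : ((2 ^ m : ℕ) : k) = ((2 ^ n : ℕ) : k) := by push_cast; exact h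
    exact Nat.pow_right_injective le_rfl (Nat.cast_injective h')
  refine ((Module.End.eigenspaces_iSupIndep (β u)).comp hinj).mono fun n x hx => ?_
  exact Module.End.mem_eigenspace_iff.2 (hx u)

theorem eq_zero_of_mem_wt_of_mem_wtGE {n N : ℕ} (h : n < N) {x : X} (hx : x ∈ wt β n)
    (hx' : x ∈ wtGE β N) : x = 0 := by
  refine (Submodule.disjoint_def.1 (wt_iSupIndep β n)) x hx ?_
  have h1 : wtGE β N ≤ ⨆ j, ⨆ (_ : j ≠ n), wt β j :=
    iSup_le fun j => le_iSup₂_of_le (N + j) (by omega) le_rfl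
  exact h1 hx'

/-- The action on the quotient by a stable subspace. -/
def quotRep (β : Representation k kˣ X) (J : Submodule k X) (hJ : ∀ t, ∀ x ∈ J, β t x ∈ J) :
    Representation k kˣ (X ⧸ J) where
  toFun t := J.mapQ J (β t) (hJ t)
  map_one' := by
    apply Submodule.linearMap_qext
    ext x
    simp
  map_mul' s t := by
    apply Submodule.linearMap_qext
    ext x
    simp

omit [CharZero k] in
theorem mkQ_mem_wt {J : Submodule k X} (hJ : ∀ t, ∀ x ∈ J, β t x ∈ J) {n : ℕ} {x : X}
    (hx : x ∈ wt β n) : J.mkQ x ∈ wt (quotRep β J hJ) n := by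
  intro t
  change J.mkQ (β t x) = _
  rw [hx t, map_smul]

omit [CharZero k] in
theorem mkQ_mem_wtGE {J : Submodule k X} (hJ : ∀ t, ∀ x ∈ J, β t x ∈ J) {n : ℕ} {x : X}
    (hx : x ∈ wtGE β n) : J.mkQ x ∈ wtGE (quotRep β J hJ) n := by
  have : wtGE β n ≤ (wtGE (quotRep β J hJ) n).comap J.mkQ :=
    iSup_le fun j x hx => le_iSup (fun j => wt (quotRep β J hJ) (n + j)) j (mkQ_mem_wt hJ hx)
  exact this hx

/-- A stable subspace is the sum of its weight spaces. -/
theorem le_iSup_inf_wt {J : Submodule k X} (hJ : ∀ t, ∀ x ∈ J, β t x ∈ J) {N : ℕ}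
    (h : J ≤ wtGE β N) : J ≤ ⨆ j, J ⊓ wt β (N + j) := by
  intro x hx
  obtain ⟨g, hg, hgx⟩ := (Submodule.mem_iSup_iff_exists_finsupp _ _).1 (h hx)
  have hind : iSupIndep fun j => wt (quotRep β J hJ) (N + j) :=
    (wt_iSupIndep (quotRep β J hJ)).comp (add_right_injective N)
  have h1 := (iSupIndep_iff_finsetSum_eq_zero_imp_eq_zero _).1 hind g.support
    (fun j => J.mkQ (g j)) (fun j _ => mkQ_mem_wt hJ (hg j)) (by
      rw [← map_sum]
      have : ∑ i ∈ g.support, g i = x := hgx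
      rw [this]
      exact (Submodule.Quotient.mk_eq_zero J).2 hx)
  refine (Submodule.mem_iSup_iff_exists_finsupp _ _).2 ⟨g, fun j => ⟨?_, hg j⟩, hgx⟩
  by_cases hj : j ∈ g.support
  · exact (Submodule.Quotient.mk_eq_zero J).1 (h1 j hj)
  · rw [Finsupp.notMem_support_iff.1 hj]
    exact zero_mem _

end Weights

section WeightsAlgebra

variable {k A : Type*} [Field k] [CommRing A] [Algebra k A] {a : kˣ →* (A →ₐ[k] A)}

theorem mul_mem_wtGE {m n : ℕ} {f g : A} (hf : f ∈ wtGE (actRep a) m) (hg : g ∈ wtGE (actRep a) n) :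
    f * g ∈ wtGE (actRep a) (m + n) := by
  have h : wtGE (actRep a) m * wtGE (actRep a) n ≤ wtGE (actRep a) (m + n) := by
    rw [wtGE, wtGE, Submodule.iSup_mul]
    refine iSup_le fun i => ?_
    rw [Submodule.mul_iSup]
    refine iSup_le fun j => Submodule.mul_le.2 fun f hf g hg => ?_
    refine wt_le_wtGE (n := (m + i) + (n + j)) (by omega) fun t => ?_
    have h1 := hf t
    have h2 := hg t
    rw [actRep_apply] at h1 h2 ⊢
    rw [map_mul, h1, h2, smul_mul_smul_comm, pow_add _ (m + i)]
  exact h (Submodule.mul_mem_mul hf hg)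

theorem pow_le_wtGE {n : Ideal A} (hn : n.restrictScalars k ≤ wtGE (actRep a) 1)
    (h0 : wtGE (actRep a) 0 = ⊤) (N : ℕ) : (n ^ N).restrictScalars k ≤ wtGE (actRep a) N := by
  induction N with
  | zero => rw [h0]; exact le_top
  | succ N ih =>
    intro f hf
    have hf' : f ∈ n ^ N * n := by rw [← pow_succ]; exact hf
    refine Submodule.mul_induction_on hf' (fun x hx y hy => ?_) fun x y hx hy => add_mem hx hy
    exact mul_mem_wtGE (ih hx) (hn hy)

/-- The graded Nakayama lemma. -/
theorem graded_nakayama [CharZero k] {n : Ideal A} (hn : n.restrictScalars k ≤ wtGE (actRep a) 1)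
    (h0 : wtGE (actRep a) 0 = ⊤) {I J : Ideal A} (hI : ∀ t, ∀ f ∈ I, a t f ∈ I)
    (hJ : ∀ t, ∀ f ∈ J, a t f ∈ J) (h : I ≤ J ⊔ n * I) : I ≤ J := by
  have hN : ∀ N, I ≤ J ⊔ n ^ N := by
    have h1 : ∀ N, I ≤ J ⊔ n ^ N * I := by
      intro N
      induction N with
      | zero => rw [pow_zero, one_mul]; exact le_sup_right
      | succ N ih =>
        refine h.trans (sup_le le_sup_left ((Ideal.mul_mono_right ih).trans ?_))
        rw [Ideal.mul_sup, ← mul_assoc, ← pow_succ']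
        exact sup_le_sup_right Ideal.mul_le_right _
    exact fun N => (h1 N).trans (sup_le_sup_left Ideal.mul_le_left _)
  have h2 : I.restrictScalars k ≤ ⨆ j, I.restrictScalars k ⊓ wt (actRep a) (0 + j) :=
    le_iSup_inf_wt (fun t x hx => hI t x hx) (by rw [h0]; exact le_top)
  refine fun f hf => (h2.trans (iSup_le fun j => ?_) : I.restrictScalars k ≤ J.restrictScalars k) hf
  rintro g ⟨hgI, hgj⟩
  rw [zero_add] at hgj
  -- Modulo `J`, the element `g` has weight `j` and is also a sum of elements of weight at least `j
  -- + 1`, so it vanishes. This replaces completeness or a local hypothesis.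
  obtain ⟨x, hx, y, hy, hxy⟩ := Submodule.mem_sup.1 (hN (j + 1) hgI)
  have hJ' : ∀ t, ∀ x ∈ J.restrictScalars k, actRep a t x ∈ J.restrictScalars k :=
    fun t x hx => hJ t x hx
  have h3 : (J.restrictScalars k).mkQ g = (J.restrictScalars k).mkQ y := by
    rw [← hxy, map_add, (Submodule.Quotient.mk_eq_zero (J.restrictScalars k)).2 hx |>
      fun (h : (J.restrictScalars k).mkQ x = 0) => h, zero_add]
  have h4 := mkQ_mem_wt hJ' hgj
  have h5 := mkQ_mem_wtGE hJ' (pow_le_wtGE hn h0 (j + 1) hy)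
  rw [← h3] at h5
  exact (Submodule.Quotient.mk_eq_zero (J.restrictScalars k)).1
    (eq_zero_of_mem_wt_of_mem_wtGE (Nat.lt_succ_self j) h4 h5)

/-- A graded ideal is generated by as many elements as the dimension of its special fibre. -/
theorem spanFinrank_le_of_graded [CharZero k] {n : Ideal A}
    (hn : n.restrictScalars k ≤ wtGE (actRep a) 1)
    (h0 : wtGE (actRep a) 0 = ⊤) {I : Ideal A} (hI : ∀ t, ∀ f ∈ I, a t f ∈ I)
    [Module.Finite k ((I.restrictScalars k).map (Ideal.Quotient.mkₐ k (n * I)).toLinearMap)] :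
    Submodule.spanFinrank I
      ≤ Module.finrank k ((I.restrictScalars k).map (Ideal.Quotient.mkₐ k (n * I)).toLinearMap) := by
  set π := (Ideal.Quotient.mkₐ k (n * I)).toLinearMap with hπ
  set U := (I.restrictScalars k).map π with hU
  let s : Set U := {x | ∃ f ∈ I, ∃ j, f ∈ wt (actRep a) j ∧ π f = x}
  have h2 : I.restrictScalars k ≤ ⨆ j, I.restrictScalars k ⊓ wt (actRep a) (0 + j) :=
    le_iSup_inf_wt (fun t x hx => hI t x hx) (by rw [h0]; exact le_top)
  have hs : ⊤ ≤ Submodule.span k s := by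
    have h3 : I.restrictScalars k ≤ ((Submodule.span k s).map U.subtype).comap π := by
      refine h2.trans (iSup_le fun j f hf => ?_)
      exact ⟨⟨π f, f, hf.1, rfl⟩, Submodule.subset_span ⟨f, hf.1, 0 + j, hf.2, rfl⟩, rfl⟩
    rintro ⟨x, f, hf, rfl⟩ -
    obtain ⟨y, hy, hy'⟩ := h3 hf
    have : y = ⟨π f, f, hf, rfl⟩ := Subtype.ext hy'
    rwa [← this]
  -- The basis of the special fibre is extracted from classes of weight vectors, so that the ideal
  -- generated by the lifts is stable under the grading and graded Nakayama applies.
  let b := Module.Basis.ofSpan hs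
  have hb : ∀ i, b i ∈ s := fun i => Module.Basis.ofSpan_subset hs ⟨i, rfl⟩
  choose f hf j hj hfb using hb
  have hle : I ≤ Ideal.span (Set.range f) := by
    refine graded_nakayama hn h0 hI (fun t => ?_) fun g hg => ?_
    · have : Ideal.span (Set.range f) ≤ (Ideal.span (Set.range f)).comap (a t) := by
        refine Ideal.span_le.2 ?_
        rintro _ ⟨i, rfl⟩
        change a t (f i) ∈ Ideal.span (Set.range f)
        have := hj i t
        rw [actRep_apply] at this
        rw [this]
        exact Submodule.smul_of_tower_mem _ _ (Ideal.subset_span ⟨i, rfl⟩)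
      exact this
    · have h3 : (⟨π g, g, hg, rfl⟩ : U) ∈ Submodule.span k (Set.range b) := by
        rw [b.span_eq]; trivial
      have h4 : π g ∈ (Submodule.span k (Set.range b)).map U.subtype := ⟨_, h3, rfl⟩
      have h5 : U.subtype '' Set.range b = π '' Set.range f := by
        rw [← Set.range_comp, ← Set.range_comp]
        exact congrArg Set.range (funext fun i => (hfb i).symm)
      rw [Submodule.map_span, h5, ← Submodule.map_span] at h4
      obtain ⟨y, hy, hyg⟩ := h4
      rw [← add_sub_cancel y g]
      refine Submodule.add_mem_sup ?_ (Ideal.Quotient.eq.1 hyg.symm)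
      exact Submodule.span_subset_span k A _ hy
  have heq : I = Ideal.span (Set.range f) :=
    le_antisymm hle (Ideal.span_le.2 (by rintro _ ⟨i, rfl⟩; exact hf i))
  have hfin : Finite _ := Module.Finite.finite_basis b
  rw [Module.finrank_eq_nat_card_basis b]
  conv_lhs => rw [heq]
  refine (Submodule.spanFinrank_span_le_ncard_of_finite (Set.finite_range f)).trans ?_
  rw [← Set.image_univ]
  refine (Set.ncard_image_le Set.finite_univ).trans ?_
  rw [Set.ncard_univ]

end WeightsAlgebra

section WeightsSym

variable {k M : Type*} [Field k] [AddCommGroup M] [Module k M]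
  {s : Representation k kˣ M} (hs : wtGE s 1 = ⊤)

open SymmetricAlgebra

include hs in
theorem sub_algebraMap_mem_wtGE (f : SymmetricAlgebra k M) :
    f - algebraMap k _ (algebraMapInv f) ∈ wtGE (actRep (symAct s)) 1 := by
  induction f using SymmetricAlgebra.induction with
  | algebraMap c => rw [AlgHom.commutes]; simp
  | ι m =>
    rw [algebraMapInv_ι, map_zero, sub_zero]
    have h : wtGE s 1 ≤ (wtGE (actRep (symAct s)) 1).comap (ι k M) := by
      refine iSup_le fun j x hx => le_iSup (fun j => wt (actRep (symAct s)) (1 + j)) j fun t => ?_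
      rw [actRep_apply, symAct_ι, hx t, map_smul]
    exact h (by rw [hs]; trivial)
  | mul f g hf hg =>
    have h1 := wtGE_anti (by omega : 1 ≤ 1 + 1) (mul_mem_wtGE hf hg)
    have h2 := (wtGE (actRep (symAct s)) 1).smul_mem (algebraMapInv f) hg
    have h3 := (wtGE (actRep (symAct s)) 1).smul_mem (algebraMapInv g) hf
    convert add_mem (add_mem h1 h2) h3 using 1
    simp only [Algebra.smul_def, map_mul]
    ring
  | add f g hf hg =>
    convert add_mem hf hg using 1
    simp only [map_add]
    ring

include hs in
theorem ker_le_wtGE_one : (RingHom.ker (algebraMapInv : SymmetricAlgebra k M →ₐ[k] k)).restrictScalars k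
    ≤ wtGE (actRep (symAct s)) 1 := by
  intro f hf
  have h1 : algebraMapInv f = (0 : k) := hf
  have := sub_algebraMap_mem_wtGE hs f
  rwa [h1, map_zero, sub_zero] at this

include hs in
theorem wtGE_zero_eq_top : wtGE (actRep (symAct s)) 0 = ⊤ := by
  rw [eq_top_iff]
  rintro f -
  rw [← sub_add_cancel f (algebraMap k _ (algebraMapInv f))]
  refine add_mem (wtGE_anti (by omega) (sub_algebraMap_mem_wtGE hs f))
    (wt_le_wtGE (n := 0) le_rfl fun t => ?_)
  rw [actRep_apply, AlgHom.commutes, pow_zero, one_smul]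

end WeightsSym

end GoodQuotient

namespace GoodQuotient

open SymmetricAlgebra

/-! ### First order expansions -/

section FirstOrder

variable {k M : Type*} [Field k] [AddCommGroup M] [Module k M] (e : SymmetricAlgebra k M →ₐ[k] k)

variable (k M) in
/-- The right action of `k` on `M`. -/
abbrev opModule : Module kᵐᵒᵖ M :=
  Module.compHom M ((RingHom.id k).fromOpposite fun _ _ => Commute.all _ _)

attribute [local instance] opModule

variable (k M) in
theorem isCentralScalar_opModule : IsCentralScalar k M := ⟨fun _ _ => rfl⟩

attribute [local instance] isCentralScalar_opModule

/-- The first order expansion at a point. -/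
def firstOrder : SymmetricAlgebra k M →ₐ[k] TrivSqZeroExt k M :=
  lift ((TrivSqZeroExt.inlAlgHom k k M).toLinearMap ∘ₗ e.toLinearMap ∘ₗ ι k M
    + TrivSqZeroExt.inrHom k M)

/-- The differential at a point. -/
def differential : SymmetricAlgebra k M →ₗ[k] M :=
  TrivSqZeroExt.sndHom k M ∘ₗ (firstOrder e).toLinearMap

theorem firstOrder_ι (m : M) :
    firstOrder e (ι k M m) = TrivSqZeroExt.inl (e (ι k M m)) + TrivSqZeroExt.inr m :=
  lift_ι_apply _ _

theorem fst_firstOrder (f : SymmetricAlgebra k M) : (firstOrder e f).fst = e f := by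
  have h : (TrivSqZeroExt.fstHom k k M).comp (firstOrder e) = e := by
    apply algHom_ext
    ext m
    change (firstOrder e (ι k M m)).fst = e (ι k M m)
    rw [firstOrder_ι]
    simp
  exact DFunLike.congr_fun h f

theorem differential_ι (m : M) : differential e (ι k M m) = m := by
  change (firstOrder e (ι k M m)).snd = m
  rw [firstOrder_ι]
  simp

theorem differential_algebraMap (c : k) : differential e (algebraMap k _ c) = 0 := by
  change (firstOrder e (algebraMap k _ c)).snd = 0
  rw [AlgHom.commutes]
  rfl

theorem differential_mul (f g : SymmetricAlgebra k M) :
    differential e (f * g) = e f • differential e g + e g • differential e f := by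
  change (firstOrder e (f * g)).snd = _
  rw [map_mul, TrivSqZeroExt.snd_mul, fst_firstOrder, fst_firstOrder]
  rfl

theorem differential_eq_zero {f : SymmetricAlgebra k M} (hf : f ∈ RingHom.ker e ^ 2) :
    differential e f = 0 := by
  rw [pow_two] at hf
  refine Submodule.mul_induction_on hf (fun x hx y hy => ?_) fun x y hx hy => ?_
  · rw [differential_mul, RingHom.mem_ker.1 hx, RingHom.mem_ker.1 hy]; simp
  · rw [map_add, hx, hy, add_zero]

theorem sub_first_order_mem (f : SymmetricAlgebra k M) :
    f - algebraMap k _ (e f) - (ι k M (differential e f) - algebraMap k _ (e (ι k M (differential e f))))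
      ∈ RingHom.ker e ^ 2 := by
  have hℓ : ∀ m, ι k M m - algebraMap k _ (e (ι k M m)) ∈ RingHom.ker e := fun m => by
    rw [RingHom.mem_ker, map_sub, AlgHom.commutes]
    exact sub_self _
  induction f using SymmetricAlgebra.induction with
  | algebraMap c =>
    rw [differential_algebraMap, AlgHom.commutes]
    simp
  | ι m => rw [differential_ι, sub_self]; exact zero_mem _
  | add f g hf hg =>
    convert add_mem hf hg using 1
    simp only [map_add]
    ring
  | mul f g hf hg =>
    have h1 := Ideal.mul_mem_right g _ hf
    have h2 := Ideal.mul_mem_left _ (algebraMap k _ (e f) + (ι k M (differential e f)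
      - algebraMap k _ (e (ι k M (differential e f))))) hg
    have h3 : (ι k M (differential e f) - algebraMap k _ (e (ι k M (differential e f))))
        * (ι k M (differential e g) - algebraMap k _ (e (ι k M (differential e g))))
        ∈ RingHom.ker e ^ 2 := by
      rw [pow_two]; exact Ideal.mul_mem_mul (hℓ _) (hℓ _)
    convert add_mem (add_mem h1 h2) h3 using 1
    simp only [differential_mul, map_mul, map_add, map_smul, Algebra.smul_def, AlgHom.commutes,
      Algebra.algebraMap_self,
      RingHom.id_apply]
    ring

theorem mem_ker_sq_of_differential_eq_zero {f : SymmetricAlgebra k M} (hf : e f = 0)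
    (hd : differential e f = 0) : f ∈ RingHom.ker e ^ 2 := by
  have := sub_first_order_mem e f
  rw [hf, hd] at this
  simpa using this

end FirstOrder

/-! ### Counting equations by linear algebra. -/

section LinearAlgebra

variable {k V X Y : Type*} [Field k] [AddCommGroup V] [Module k V] [AddCommGroup X] [Module k X]
  [AddCommGroup Y] [Module k Y]

/-- Rank–nullity for the map induced by `T` on `V ⧸ V₀`: its kernel is at least as large as its
image under `D`, which contains `K`. -/
theorem finrank_range_add_finrank_map_ker_le (V₀ : Submodule k V) [Module.Finite k (V ⧸ V₀)]
    (T : V →ₗ[k] X) (D : V →ₗ[k] Y) (hT : V₀ ≤ LinearMap.ker T) (hD : V₀ ≤ LinearMap.ker D)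
    (K : Submodule k Y) (hK : K ≤ (LinearMap.ker T).map D) :
    Module.Finite k (LinearMap.range T) ∧
    Module.finrank k (LinearMap.range T) + Module.finrank k K ≤ Module.finrank k (V ⧸ V₀) := by
  let T' := V₀.liftQ T hT
  let D' := V₀.liftQ D hD
  have h1 : LinearMap.range T' = LinearMap.range T := Submodule.range_liftQ _ _ _
  have h2 : K ≤ (LinearMap.ker T').map D' := by
    intro y hy
    obtain ⟨v, hv, rfl⟩ := hK hy
    exact ⟨V₀.mkQ v, hv, rfl⟩
  have h3 := LinearMap.finrank_range_add_finrank_ker T'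
  have h4 := Submodule.finrank_mono h2
  have h5 := Submodule.finrank_map_le D' (LinearMap.ker T')
  rw [← h1]
  exact ⟨inferInstance, by omega⟩

end LinearAlgebra

/-- Modulo `ker e * I`, the coefficients of a combination of generators of `I` may be replaced by
their values at `e`, so a minimal generating family spans over `k`. -/
theorem finite_quotient_and_finrank_le {k A : Type*} [Field k] [CommRing A] [Algebra k A]
    (e : A →ₐ[k] k) (I : Ideal A) (hI : I.FG) (V₀ : Submodule k (I.restrictScalars k))
    (hV₀ : ∀ f : I.restrictScalars k, (f : A) ∈ RingHom.ker e * I → f ∈ V₀) :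
    Module.Finite k (↥(I.restrictScalars k) ⧸ V₀) ∧
      Module.finrank k (↥(I.restrictScalars k) ⧸ V₀) ≤ Submodule.spanFinrank I := by
  classical
  obtain ⟨s, hs, hsI⟩ := Submodule.FG.exists_span_finset_card_eq_spanFinrank hI
  have hsub : ∀ f ∈ s, f ∈ I := fun f hf => by
    rw [← hsI]; exact Submodule.subset_span hf
  let t : Finset (↥(I.restrictScalars k) ⧸ V₀) :=
    s.attach.image fun f => V₀.mkQ ⟨f.1, hsub f.1 f.2⟩
  have ht : Submodule.span k (t : Set (↥(I.restrictScalars k) ⧸ V₀)) = ⊤ := by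
    rw [eq_top_iff]
    rintro x -
    obtain ⟨⟨f, hf⟩, rfl⟩ := V₀.mkQ_surjective x
    have hf' : f ∈ Submodule.span A (s : Set A) := by rw [hsI]; exact hf
    obtain ⟨c, hc⟩ := Submodule.mem_span_finset'.1 hf'
    have h1 : V₀.mkQ ⟨f, hf⟩ = ∑ i : s, e (c i) • V₀.mkQ ⟨i.1, hsub i.1 i.2⟩ := by
      simp only [← map_smul]
      rw [← map_sum, ← sub_eq_zero, ← map_sub]
      refine (Submodule.Quotient.mk_eq_zero V₀).2 (hV₀ _ ?_)
      have : ((⟨f, hf⟩ - ∑ i : s, e (c i) • (⟨i.1, hsub i.1 i.2⟩ : I.restrictScalars k) :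
          I.restrictScalars k) : A) = ∑ i : s, (c i - algebraMap k A (e (c i))) * i.1 := by
        rw [AddSubgroupClass.coe_sub, AddSubmonoidClass.coe_finsetSum]
        simp only [sub_mul, Finset.sum_sub_distrib, Submodule.coe_smul_of_tower,
          Algebra.smul_def]
        rw [← hc]
        simp only [smul_eq_mul]
      rw [this]
      refine sum_mem fun i _ => Ideal.mul_mem_mul ?_ (hsub i.1 i.2)
      rw [RingHom.mem_ker, map_sub, AlgHom.commutes]
      exact sub_self _
    rw [h1]
    refine sum_mem fun i _ => Submodule.smul_mem _ _ (Submodule.subset_span ?_)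
    exact Finset.mem_coe.2 (Finset.mem_image_of_mem _ (Finset.mem_attach s i))
  refine ⟨⟨⟨t, ht⟩⟩, ?_⟩
  rw [← finrank_top k (↥(I.restrictScalars k) ⧸ V₀), ← ht, ← hs]
  refine (finrank_span_finset_le_card t).trans (Finset.card_image_le.trans ?_)
  rw [Finset.card_attach]

/-! ### Comparison of two presentations of an algebra -/

section Transfer

variable {k Γ M M' R' : Type*} [Field k] [CharZero k] [Group Γ] [Finite Γ]
  [AddCommGroup M] [Module k M] [FiniteDimensional k M]
  [AddCommGroup M'] [Module k M'] [FiniteDimensional k M'] [CommRing R'] [Algebra k R']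
  {r : Representation k Γ M} {r' : Representation k Γ M'} {c : Γ →* (R' →ₐ[k] R')}
  {φ : SymmetricAlgebra k M →ₐ[k] R'} {ψ : SymmetricAlgebra k M' →ₐ[k] R'}

omit [FiniteDimensional k M] [FiniteDimensional k M'] in
/-- An equivariant lift of `φ` along the surjective map `ψ`. -/
theorem exists_equivariant_lift (hψ : Function.Surjective ψ)
    (hφr : ∀ γ f, φ (symAct r γ f) = c γ (φ f)) (hψr : ∀ γ f, ψ (symAct r' γ f) = c γ (ψ f)) :
    ∃ Θ : SymmetricAlgebra k M →ₐ[k] SymmetricAlgebra k M',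
      (∀ f, ψ (Θ f) = φ f) ∧ ∀ γ f, Θ (symAct r γ f) = symAct r' γ (Θ f) := by
  obtain ⟨s, hs⟩ := ψ.toLinearMap.exists_rightInverse_of_surjective (LinearMap.range_eq_top.2 hψ)
  have hs' : ∀ x, ψ (s x) = x := fun x => LinearMap.congr_fun hs x
  -- An arbitrary linear lift of the generators is averaged for the action by conjugation; it stays
  -- a lift since its conjugates are lifts too.
  let ρ := Representation.linHom r (actRep (symAct r'))
  let π₀ : M →ₗ[k] SymmetricAlgebra k M' := s ∘ₗ φ.toLinearMap ∘ₗ ι k M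
  let π := avg ρ π₀
  let N : Submodule k (M →ₗ[k] SymmetricAlgebra k M') :=
    LinearMap.ker (LinearMap.compRight k (ψ.toLinearMap) : (M →ₗ[k] SymmetricAlgebra k M') →ₗ[k] _)
  have hπ : ∀ m, ψ (π m) = φ (ι k M m) := by
    have h1 : π - π₀ ∈ N := by
      refine avg_sub_mem _ N fun γ => ?_
      rw [LinearMap.mem_ker]
      ext m
      change ψ (symAct r' γ (s (φ (ι k M (r γ⁻¹ m)))) - s (φ (ι k M m))) = 0
      rw [map_sub, hψr, hs', hs', ← symAct_ι, hφr, act_act_inv, sub_self]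
    intro m
    have h2 : ψ (π m - s (φ (ι k M m))) = 0 := LinearMap.congr_fun h1 m
    rwa [map_sub, hs', sub_eq_zero] at h2
  have hπr : ∀ γ m, π (r γ m) = symAct r' γ (π m) := by
    intro γ m
    have h1 : symAct r' γ (π (r γ⁻¹ (r γ m))) = π (r γ m) :=
      LinearMap.congr_fun (avg_invariant ρ γ π₀) (r γ m)
    rw [← h1, ← Module.End.mul_apply, ← map_mul, inv_mul_cancel, map_one, Module.End.one_apply]
  have hΘ : ∀ m, lift π (ι k M m) = π m := fun m => lift_ι_apply _ _
  refine ⟨lift π, fun f => ?_, fun γ f => ?_⟩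
  · have : ψ.comp (lift π) = φ := by
      apply algHom_ext
      ext m
      change ψ (lift π (ι k M m)) = φ (ι k M m)
      rw [hΘ, hπ]
    exact DFunLike.congr_fun this f
  · have : (lift π).comp (symAct r γ) = (symAct r' γ).comp (lift π) := by
      apply algHom_ext
      ext m
      change lift π (symAct r γ (ι k M m)) = symAct r' γ (lift π (ι k M m))
      rw [symAct_ι, hΘ, hΘ, hπr]
    exact DFunLike.congr_fun this f

variable {e : SymmetricAlgebra k M →ₐ[k] k} {m' : Ideal R'}

omit [CharZero k] [FiniteDimensional k M] in
/-- Let `A → R'` be a presentation of a neighbourhood of a point, and let `A' → R'` be a minimal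
one. The equations of the minimal presentation come from those of the first one. -/
theorem transfer_surjective (hψ : Function.Surjective ψ)
    (hφm : ∀ f, φ f ∈ m' ↔ e f = 0) (hψm : ∀ f, ψ f ∈ m' ↔ algebraMapInv f = (0 : k))
    (hmin : RingHom.ker ψ ≤ RingHom.ker (algebraMapInv : SymmetricAlgebra k M' →ₐ[k] k) ^ 2)
    (hsurj : ∀ x ∈ m', ∃ f, e f = 0 ∧ x - φ f ∈ m' ^ 2)
    (hsep : ∀ n, ∃ K, ∀ f, φ f ∈ m' ^ K → f ∈ RingHom.ker φ ⊔ RingHom.ker e ^ n)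
    (Θ : SymmetricAlgebra k M →ₐ[k] SymmetricAlgebra k M') (hΘ : ∀ f, ψ (Θ f) = φ f) :
    (∀ f, e f = 0 → algebraMapInv (Θ f) = (0 : k)) ∧
    (∀ x ∈ RingHom.ker ψ, ∃ f ∈ RingHom.ker φ, x - Θ f
      ∈ RingHom.ker (algebraMapInv : SymmetricAlgebra k M' →ₐ[k] k) * RingHom.ker ψ) ∧
    ∀ f, e f = 0 → Θ f ∈ RingHom.ker (algebraMapInv : SymmetricAlgebra k M' →ₐ[k] k) ^ 2 →
      ∃ g ∈ RingHom.ker φ, f - g ∈ RingHom.ker e ^ 2 ∧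
        Θ g ∈ RingHom.ker (algebraMapInv : SymmetricAlgebra k M' →ₐ[k] k) * RingHom.ker ψ := by
  set n := RingHom.ker e with hn
  set n' := RingHom.ker (algebraMapInv : SymmetricAlgebra k M' →ₐ[k] k) with hn'
  have hΘn : ∀ f, e f = 0 → algebraMapInv (Θ f) = (0 : k) := fun f hf => by
    rw [← hψm, hΘ, hφm]; exact hf
  have hΘpow : ∀ j, ∀ f ∈ n ^ j, Θ f ∈ n' ^ j := by
    intro j f hf
    have h1 : Θ f ∈ (n ^ j).map Θ := Ideal.mem_map_of_mem _ hf
    rw [Ideal.map_pow] at h1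
    have h2 : n.map Θ ≤ n' := Ideal.map_le_iff_le_comap.2 fun g hg => hΘn g hg
    exact Ideal.pow_right_mono h2 j h1
  have hm'n' : n'.map ψ = m' := by
    apply le_antisymm
    · exact Ideal.map_le_iff_le_comap.2 fun g hg => (hψm g).2 hg
    · intro x hx
      obtain ⟨g, rfl⟩ := hψ x
      exact Ideal.mem_map_of_mem _ ((hψm g).1 hx)
  have hψpow : ∀ j, ∀ x ∈ m' ^ j, ∃ g ∈ n' ^ j, ψ g = x := by
    intro j x hx
    rw [← hm'n', ← Ideal.map_pow] at hx
    exact (Ideal.mem_map_iff_of_surjective ψ hψ).1 hx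
  have hψpow' : ∀ j, ∀ g ∈ n' ^ j, ψ g ∈ m' ^ j := by
    intro j g hg
    rw [← hm'n', ← Ideal.map_pow]
    exact Ideal.mem_map_of_mem _ hg
  -- Minimality (`hmin`) lifts the approximation of cotangent vectors from `R'` to the symmetric
  -- algebra: the ambiguity is in `ker ψ`, hence of order two.
  have h1 : ∀ x ∈ n', ∃ f ∈ n, x - Θ f ∈ n' ^ 2 := by
    intro x hx
    obtain ⟨f, hf, hfx⟩ := hsurj (ψ x) ((hψm x).2 hx)
    obtain ⟨g, hg, hgx⟩ := hψpow 2 _ hfx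
    refine ⟨f, hf, ?_⟩
    have : x - Θ f - g ∈ n' ^ 2 := hmin (by
      rw [RingHom.mem_ker, map_sub, map_sub, hΘ, hgx, sub_self])
    rw [← sub_add_cancel (x - Θ f) g]
    exact add_mem this hg
  have h2 : ∀ j, ∀ x ∈ n' ^ j, ∃ f ∈ n ^ j, x - Θ f ∈ n' ^ (j + 1) := by
    intro j
    induction j with
    | zero =>
      intro x _
      refine ⟨algebraMap k _ (algebraMapInv x), by rw [pow_zero, Ideal.one_eq_top]; trivial, ?_⟩
      rw [zero_add, pow_one, RingHom.mem_ker, map_sub, AlgHom.commutes, AlgHom.commutes]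
      exact sub_self _
    | succ j ih =>
      intro x hx
      rw [pow_succ] at hx
      refine Submodule.mul_induction_on hx (fun y hy z hz => ?_) fun x y hx hy => ?_
      · obtain ⟨f, hf, hfy⟩ := ih y hy
        obtain ⟨g, hg, hgz⟩ := h1 z hz
        refine ⟨f * g, by rw [pow_succ]; exact Ideal.mul_mem_mul hf hg, ?_⟩
        have h3 : y * z - Θ (f * g) = (y - Θ f) * z + Θ f * (z - Θ g) := by rw [map_mul]; ring
        rw [h3]
        refine add_mem ?_ ?_
        · rw [pow_succ _ (j + 1)]
          exact Ideal.mul_mem_mul hfy hz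
        · rw [show j + 1 + 1 = j + 2 from rfl, pow_add]
          exact Ideal.mul_mem_mul (hΘpow j f hf) hgz
      · obtain ⟨f, hf, hfx⟩ := hx
        obtain ⟨g, hg, hgy⟩ := hy
        refine ⟨f + g, add_mem hf hg, ?_⟩
        rw [map_add, add_sub_add_comm]
        exact add_mem hfx hgy
  have h3 : ∀ N j, ∀ x ∈ n' ^ j, ∃ f ∈ n ^ j, x - Θ f ∈ n' ^ (j + N) := by
    intro N
    induction N with
    | zero => intro j x hx; exact ⟨0, zero_mem _, by simpa using hx⟩
    | succ N ih =>
      intro j x hx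
      obtain ⟨f, hf, hfx⟩ := ih j x hx
      obtain ⟨g, hg, hgx⟩ := h2 _ _ hfx
      refine ⟨f + g, add_mem hf (Ideal.pow_le_pow_right (Nat.le_add_right j N) hg), ?_⟩
      rw [map_add, ← sub_sub]
      exact hgx
  -- Artin–Rees: an equation of sufficiently high order is negligible in the special fibre of the
  -- equations.
  obtain ⟨N₀, hN₀⟩ : ∃ N, n' ^ N ⊓ RingHom.ker ψ ≤ n' * RingHom.ker ψ := by
    obtain ⟨κ, hκ⟩ := Ideal.exists_pow_inf_eq_pow_smul n' (RingHom.ker ψ)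
    refine ⟨κ + 1, ?_⟩
    have := hκ (κ + 1) (Nat.le_succ κ)
    rw [Nat.add_sub_cancel_left, pow_one] at this
    rw [smul_eq_mul, Ideal.mul_top] at this
    rw [this]
    exact Ideal.mul_mono_right inf_le_right
  refine ⟨hΘn, fun x hx => ?_, fun f hf hf2 => ?_⟩
  -- Since `ψ x = 0`, a good approximation `Θ f` of `x` makes `φ f` of high order, so by `hsep` the
  -- element `f` is an equation `g` up to order `N₀`. The remaining error is an equation of order
  -- `N₀`, absorbed by `hN₀`.
  · obtain ⟨K, hK⟩ := hsep N₀
    obtain ⟨f, -, hfx⟩ := h3 (K + N₀) 0 x (by rw [pow_zero, Ideal.one_eq_top]; trivial)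
    rw [zero_add] at hfx
    have hφf : φ f ∈ m' ^ K := by
      have := hψpow' K _ (Ideal.pow_le_pow_right (Nat.le_add_right K N₀) hfx)
      rw [map_sub, RingHom.mem_ker.1 hx, zero_sub, hΘ] at this
      simpa using neg_mem this
    obtain ⟨g, hg, q, hq, rfl⟩ := Submodule.mem_sup.1 (hK f hφf)
    refine ⟨g, hg, hN₀ ⟨?_, ?_⟩⟩
    · have : x - Θ g = (x - Θ (g + q)) + Θ q := by rw [map_add]; ring
      rw [this]
      exact add_mem (Ideal.pow_le_pow_right (Nat.le_add_left N₀ K) hfx) (hΘpow _ _ hq)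
    · refine sub_mem hx ?_
      rw [RingHom.mem_ker, hΘ]
      exact hg
  -- First `q`, of order two, is subtracted so that `Θ (f - q)` has high order. The exponent `2 +
  -- N₀` makes the last correction both of order two, as needed for `f - g`, and of order `N₀`, as
  -- needed for `Θ g`.
  · obtain ⟨K, hK⟩ := hsep (2 + N₀)
    obtain ⟨q, hq, hqf⟩ := h3 (K + N₀) 2 _ hf2
    rw [← map_sub] at hqf
    have hφf : φ (f - q) ∈ m' ^ K := by
      rw [← hΘ]
      exact hψpow' K _ (Ideal.pow_le_pow_right (by omega) hqf)
    obtain ⟨g, hg, q', hq', hgq⟩ := Submodule.mem_sup.1 (hK _ hφf)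
    refine ⟨g, hg, ?_, hN₀ ⟨?_, ?_⟩⟩
    · have : f - g = q + q' := by linear_combination -hgq
      rw [this]
      exact add_mem hq (Ideal.pow_le_pow_right (by omega) hq')
    · have : Θ g = Θ (f - q) - Θ q' := by rw [← map_sub, ← hgq, add_sub_cancel_right]
      rw [this]
      exact sub_mem (Ideal.pow_le_pow_right (by omega) hqf)
        (Ideal.pow_le_pow_right (by omega) (hΘpow _ _ hq'))
    · rw [SetLike.mem_coe, RingHom.mem_ker, hΘ]
      exact hg

/-- The map `Θ` induces a surjection from `ker φ`, modulo the ideal of `e`, onto the special fibre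
of `ker ψ`, which therefore inherits the trivial action. The elements that it kills account for the
excess of `M` over `M'`: every cotangent vector killed by `Θ` is the differential of such an
equation. This gives the inequality between numbers of equations and embedding dimensions. -/
theorem transfer (hψ : Function.Surjective ψ)
    (hφr : ∀ γ f, φ (symAct r γ f) = c γ (φ f)) (hψr : ∀ γ f, ψ (symAct r' γ f) = c γ (ψ f))
    (hφm : ∀ f, φ f ∈ m' ↔ e f = 0) (hψm : ∀ f, ψ f ∈ m' ↔ algebraMapInv f = (0 : k))
    (hmin : RingHom.ker ψ ≤ RingHom.ker (algebraMapInv : SymmetricAlgebra k M' →ₐ[k] k) ^ 2)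
    (hsurj : ∀ x ∈ m', ∃ f, e f = 0 ∧ x - φ f ∈ m' ^ 2)
    (hsep : ∀ n, ∃ K, ∀ f, φ f ∈ m' ^ K → f ∈ RingHom.ker φ ⊔ RingHom.ker e ^ n)
    (htriv : ∀ γ, ∀ f ∈ RingHom.ker φ, symAct r γ f - f ∈ RingHom.ker e * RingHom.ker φ) :
    (∀ γ, ∀ f ∈ RingHom.ker ψ, symAct r' γ f - f
      ∈ RingHom.ker (algebraMapInv : SymmetricAlgebra k M' →ₐ[k] k) * RingHom.ker ψ) ∧
    Module.Finite k (((RingHom.ker ψ).restrictScalars k).map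
      (Ideal.Quotient.mkₐ k (RingHom.ker (algebraMapInv : SymmetricAlgebra k M' →ₐ[k] k)
        * RingHom.ker ψ)).toLinearMap) ∧
    Module.finrank k (((RingHom.ker ψ).restrictScalars k).map
      (Ideal.Quotient.mkₐ k (RingHom.ker (algebraMapInv : SymmetricAlgebra k M' →ₐ[k] k)
        * RingHom.ker ψ)).toLinearMap) + Module.finrank k M
      ≤ Submodule.spanFinrank (RingHom.ker φ) + Module.finrank k M' := by
  obtain ⟨Θ, hΘ, hΘr⟩ := exists_equivariant_lift hψ hφr hψr
  obtain ⟨hn, hlift, hker⟩ := transfer_surjective hψ hφm hψm hmin hsurj hsep Θ hΘ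
  set n := RingHom.ker e
  set n' := RingHom.ker (algebraMapInv : SymmetricAlgebra k M' →ₐ[k] k) with hn'
  set I := RingHom.ker φ
  set I' := RingHom.ker ψ
  have hΘI : ∀ f ∈ I, Θ f ∈ I' := fun f hf => by
    rw [RingHom.mem_ker, hΘ]; exact hf
  have hΘnI : ∀ f ∈ n * I, Θ f ∈ n' * I' := by
    intro f hf
    refine Submodule.mul_induction_on hf (fun x hx y hy => ?_) fun x y hx hy => ?_
    · rw [map_mul]; exact Ideal.mul_mem_mul (hn x hx) (hΘI y hy)
    · rw [map_add]; exact add_mem hx hy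
  refine ⟨fun γ x hx => ?_, ?_⟩
  · obtain ⟨f, hf, hfx⟩ := hlift x hx
    have h1 : symAct r' γ (x - Θ f) ∈ n' * I' := by
      refine Submodule.mul_induction_on hfx (fun y hy z hz => ?_) fun y z hy hz => ?_
      · rw [map_mul]
        refine Ideal.mul_mem_mul ?_ ?_
        · rw [RingHom.mem_ker, algebraMapInv_symAct]; exact hy
        · rw [RingHom.mem_ker, hψr, RingHom.mem_ker.1 hz, map_zero]
      · rw [map_add]; exact add_mem hy hz
    have h2 := hΘnI _ (htriv γ f hf)
    rw [map_sub, hΘr] at h2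
    have h3 : symAct r' γ x - x
        = symAct r' γ (x - Θ f) + (symAct r' γ (Θ f) - Θ f) - (x - Θ f) := by
      rw [map_sub]; ring
    rw [h3]
    exact sub_mem (add_mem h1 h2) hfx
  · let V₀ : Submodule k (I.restrictScalars k) :=
      ((n * I).restrictScalars k).comap (I.restrictScalars k).subtype
    obtain ⟨hfin, hle⟩ := finite_quotient_and_finrank_le e I (IsNoetherian.noetherian I) V₀
      (fun f hf => hf)
    let π' := (Ideal.Quotient.mkₐ k (n' * I')).toLinearMap
    let T : I.restrictScalars k →ₗ[k] _ := π' ∘ₗ Θ.toLinearMap ∘ₗ (I.restrictScalars k).subtype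
    let D : I.restrictScalars k →ₗ[k] M := differential e ∘ₗ (I.restrictScalars k).subtype
    have hrange : LinearMap.range T = (I'.restrictScalars k).map π' := by
      apply le_antisymm
      · rintro _ ⟨f, rfl⟩
        exact ⟨Θ f, hΘI f f.2, rfl⟩
      · rintro _ ⟨x, hx, rfl⟩
        obtain ⟨f, hf, hfx⟩ := hlift x hx
        exact ⟨⟨f, hf⟩, (Ideal.Quotient.eq.2 hfx).symm⟩
    -- The map induced by `Θ` on cotangent spaces; a linear form is first made to vanish at `e`. Its
    -- kernel has dimension at least `dim M - dim M'`.
    let χ : M →ₗ[k] M' := differential algebraMapInv ∘ₗ Θ.toLinearMap ∘ₗ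
      (ι k M - (Algebra.linearMap k _) ∘ₗ e.toLinearMap ∘ₗ ι k M)
    have hχ := LinearMap.finrank_range_add_finrank_ker χ
    have hχ' := Submodule.finrank_le (LinearMap.range χ)
    obtain ⟨h1, h2⟩ := finrank_range_add_finrank_map_ker_le V₀ T D
      (fun f hf => Ideal.Quotient.eq_zero_iff_mem.2 (hΘnI f hf))
      (fun f hf => differential_eq_zero e (by
        have hf' : (f : SymmetricAlgebra k M) ∈ n * I := hf
        rw [pow_two]
        refine Ideal.mul_mono_right (fun g hg => ?_) hf'
        rw [RingHom.mem_ker, ← hφm, RingHom.mem_ker.1 hg]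
        exact zero_mem _))
      (LinearMap.ker χ) (fun m hm => by
        have he : e (ι k M m - algebraMap k _ (e (ι k M m))) = 0 := by
          rw [map_sub, AlgHom.commutes]; exact sub_self _
        obtain ⟨g, hg, hmg, hgI⟩ := hker (ι k M m - algebraMap k _ (e (ι k M m))) he
          (mem_ker_sq_of_differential_eq_zero _ (hn _ he) hm)
        refine ⟨⟨g, hg⟩, Ideal.Quotient.eq_zero_iff_mem.2 hgI, ?_⟩
        have := differential_eq_zero e hmg
        rw [map_sub, map_sub, differential_ι, differential_algebraMap, sub_zero, sub_eq_zero] at this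
        exact this.symm)
    rw [hrange] at h1 h2
    refine ⟨h1, ?_⟩
    change Module.finrank k ((I'.restrictScalars k).map π') + _ ≤ _
    omega

end Transfer

end GoodQuotient

namespace GoodQuotient

open SymmetricAlgebra

/-! ### Separation of orbits -/

section Separation

variable {k S Γ : Type*} [Field k] [CommRing S] [Algebra k S] [Group Γ] [Finite Γ]
  {a : Γ →* (S →ₐ[k] S)} {R : Subalgebra k S}

theorem algHom_eq_of_ker_le {e e' : S →ₐ[k] k} (h : RingHom.ker e ≤ RingHom.ker e') : e' = e := by
  refine AlgHom.ext fun f => ?_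
  have h1 : f - algebraMap k S (e f) ∈ RingHom.ker e := by
    rw [RingHom.mem_ker, map_sub, AlgHom.commutes]
    exact sub_self _
  have h2 := RingHom.mem_ker.1 (h h1)
  rw [map_sub, AlgHom.commutes] at h2
  exact sub_eq_zero.1 h2

/-- A function that vanishes on the orbit of `e` has a power in the ideal of the fibre, so it
vanishes at `e'`. The prime ideal `ker e'` thus contains a finite intersection of kernels, hence one
of them. The base field need not be algebraically closed. -/
theorem exists_comp_eq_of_eq_on (hR : IsInv a R) {e e' : S →ₐ[k] k} (h : ∀ f ∈ R, e' f = e f) :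
    ∃ γ, e' = e.comp (a γ) := by
  have := Fintype.ofFinite Γ
  have h1 : ⨅ γ ∈ Finset.univ, RingHom.ker (e.comp (a γ)) ≤ RingHom.ker e' := by
    intro b hb
    obtain ⟨n, hn⟩ := pow_mem_map_ptIdeal hR e (b := b) fun γ => by
      have := (Submodule.mem_iInf _).1 ((Submodule.mem_iInf _).1 hb γ) (Finset.mem_univ γ)
      exact this
    have h2 : (ptIdeal R e).map (algebraMap R S) ≤ RingHom.ker e' :=
      Ideal.map_le_iff_le_comap.2 fun f hf => (h f f.2).trans hf
    have h3 := RingHom.mem_ker.1 (h2 hn)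
    rw [map_pow] at h3
    exact by_contra fun h0 => pow_ne_zero n h0 h3
  have hp : (RingHom.ker e').IsPrime := RingHom.ker_isPrime _
  obtain ⟨γ, -, hγ⟩ := (Ideal.IsPrime.inf_le' hp).1 (by
    rwa [Finset.inf_eq_iInf])
  exact ⟨γ, algHom_eq_of_ker_le hγ⟩

end Separation

/-! ### Reflections of the dual space -/

section Dual

variable {k Γ M : Type*} [Field k] [Group Γ] [AddCommGroup M] [Module k M]
  [FiniteDimensional k M] {r : Representation k Γ M}

omit [FiniteDimensional k M] in
theorem isReflection_iff [Finite Γ] (γ : Γ) : IsReflection (r γ) ↔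
    Module.finrank k (LinearMap.ker (r γ - 1)) + 1 = Module.finrank k M :=
  and_iff_right (MonoidHom.isOfFinOrder r (isOfFinOrder_of_finite γ))

theorem dual_injective_iff : Function.Injective r.dual ↔ Function.Injective r := by
  have h : ∀ γ δ, r.dual γ = r.dual δ ↔ r γ⁻¹ = r δ⁻¹ := fun γ δ =>
    ⟨fun h => LinearMap.ext fun m => by
      rw [← sub_eq_zero]
      refine (Module.forall_dual_apply_eq_zero_iff k _).1 fun l => ?_
      rw [map_sub, sub_eq_zero]
      exact LinearMap.congr_fun (LinearMap.congr_fun h l) m,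
    fun h => congrArg Module.Dual.transpose h⟩
  constructor
  · intro hr γ δ h1
    have := hr ((h γ⁻¹ δ⁻¹).2 (by rwa [inv_inv, inv_inv]))
    exact inv_injective this
  · intro hr γ δ h1
    exact inv_injective (hr ((h γ δ).1 h1))

theorem finrank_ker_dual_sub_one (γ : Γ) : Module.finrank k (LinearMap.ker (r.dual γ - 1))
    = Module.finrank k (LinearMap.ker (r γ - 1)) := by
  have h1 : r.dual γ - 1 = (r γ⁻¹ - 1).dualMap := by
    ext l m
    simp [Representation.dual_apply, Module.Dual.transpose_apply]
  have h2 : LinearMap.ker (r γ⁻¹ - 1) = LinearMap.ker (r γ - 1) := by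
    have : ∀ γ : Γ, LinearMap.ker (r γ - 1) ≤ LinearMap.ker (r γ⁻¹ - 1) := by
      intro γ m hm
      rw [LinearMap.mem_ker, LinearMap.sub_apply, Module.End.one_apply, sub_eq_zero] at hm ⊢
      conv_lhs => rw [← hm]
      rw [← Module.End.mul_apply, ← map_mul, inv_mul_cancel, map_one, Module.End.one_apply]
    refine le_antisymm ?_ (this γ)
    have h3 := this γ⁻¹
    rwa [inv_inv] at h3
  have h3 := LinearMap.finrank_range_dualMap_eq_finrank_range (r γ⁻¹ - 1)
  have h4 := LinearMap.finrank_range_add_finrank_ker (r γ⁻¹ - 1)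
  have h5 := LinearMap.finrank_range_add_finrank_ker (r γ⁻¹ - 1).dualMap
  rw [Subspace.dual_finrank_eq] at h5
  rw [h1, ← h2]
  omega

theorem isReflection_dual_iff [Finite Γ] (γ : Γ) : IsReflection (r.dual γ) ↔ IsReflection (r γ) := by
  rw [isReflection_iff, isReflection_iff, finrank_ker_dual_sub_one, Subspace.dual_finrank_eq]

theorem isReflectionGroup_dual_iff [Finite Γ] : IsReflectionGroup r.dual ↔ IsReflectionGroup r := by
  rw [IsReflectionGroup, IsReflectionGroup, dual_injective_iff]
  simp only [isReflection_dual_iff]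

end Dual

/-! ### Groups of automorphisms of a vector space -/

section Linear

variable {k V : Type*} [Field k] [AddCommGroup V] [Module k V]

theorem evalAt_ι (x : V) (l : Module.Dual k V) : evalAt x (ι k _ l) = l x :=
  lift_ι_apply _ _

theorem evalAt_zero : evalAt (0 : V) = (algebraMapInv : Poly k V →ₐ[k] k) := by
  apply algHom_ext
  ext l
  change evalAt (0 : V) (ι k _ l) = algebraMapInv (ι k _ l)
  rw [evalAt_ι, map_zero, algebraMapInv_ι]

theorem evalAt_comp_polyAct (g : V ≃ₗ[k] V) (x : V) :
    (evalAt x).comp (polyAct g) = evalAt (k := k) (g⁻¹ x) :=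
  AlgHom.ext fun f => evalAt_polyAct g x f

theorem evalAt_injective : Function.Injective (evalAt (k := k) (V := V)) := by
  intro x y h
  rw [← sub_eq_zero]
  refine (Module.forall_dual_apply_eq_zero_iff k _).1 fun l => ?_
  rw [map_sub, ← evalAt_ι, ← evalAt_ι, h, sub_self]

theorem polyAct_comp_eq_symAct {Γ : Type*} [Group Γ] (f : Γ →* (V ≃ₗ[k] V)) :
    (polyAct (k := k) (V := V)).comp f = symAct (Representation.dual ((natRep k V).comp f)) := by
  refine MonoidHom.ext fun γ => ?_
  apply algHom_ext
  ext l
  change polyAct (f γ) (ι k _ l) = symAct _ γ (ι k _ l)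
  rw [polyAct, symAct_ι, symAct_ι]
  simp [Representation.dual_apply]

variable (H K : Subgroup (V ≃ₗ[k] V))

theorem isInv_invariants : IsInv (polyAct.comp H.subtype) (invariants H) := fun _ =>
  ⟨fun h γ => h γ γ.2, fun h g hg => h ⟨g, hg⟩⟩

variable {H K} in
theorem isInv_subgroupOf (h : H ≤ K) :
    IsInv ((polyAct.comp K.subtype).comp (H.subgroupOf K).subtype) (invariants H) := fun _ =>
  ⟨fun hf γ => hf γ.1 γ.2, fun hf g hg => hf ⟨⟨g, h hg⟩, hg⟩⟩

theorem isStab_evalAt (x : V) : IsStab (polyAct.comp K.subtype) (evalAt x)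
    ((K ⊓ fixingSubgroup (V ≃ₗ[k] V) {x}).subgroupOf K) := by
  intro γ
  have h0 : (evalAt x).comp ((polyAct.comp K.subtype) γ) = evalAt (k := k) ((γ : V ≃ₗ[k] V)⁻¹ x) :=
    evalAt_comp_polyAct _ _
  rw [h0, evalAt_injective.eq_iff, Subgroup.mem_subgroupOf, Subgroup.mem_inf,
    mem_fixingSubgroup_iff]
  constructor
  · intro h
    have h1 : (γ : V ≃ₗ[k] V) x = x := h.2 x rfl
    exact (LinearEquiv.symm_apply_eq _).2 h1.symm
  · intro h
    refine ⟨γ.2, fun y hy => ?_⟩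
    rw [Set.mem_singleton_iff.1 hy]
    exact ((LinearEquiv.symm_apply_eq (γ : V ≃ₗ[k] V)).1 h).symm

variable {K} in
theorem polyAct_comp_subtype_injective :
    Function.Injective ((polyAct (k := k) (V := V)).comp K.subtype) := by
  intro g h hgh
  apply Subtype.ext
  apply inv_injective
  refine LinearEquiv.ext fun x => evalAt_injective (k := k) ?_
  have : polyAct (g : V ≃ₗ[k] V) = polyAct (h : V ≃ₗ[k] V) := hgh
  rw [← evalAt_comp_polyAct, ← evalAt_comp_polyAct, this]

theorem exists_apply_eq_of_evalAt_eq [Finite H] {x y : V}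
    (h : ∀ f ∈ invariants H, evalAt y f = evalAt x f) : ∃ g ∈ H, g x = y := by
  obtain ⟨γ, hγ⟩ := exists_comp_eq_of_eq_on (isInv_invariants H) h
  refine ⟨γ⁻¹, inv_mem γ.2, evalAt_injective (k := k) ?_⟩
  rw [hγ]
  exact (evalAt_comp_polyAct _ _).symm

/-- Such a `w` preserves every `H`-orbit, so `V` is the union of the finitely many subspaces on
which `w⁻¹` agrees with an element of `H`; one of them is everything. -/
theorem mem_of_forall_invariants [CharZero k] [Finite H] {w : V ≃ₗ[k] V}
    (h : ∀ f ∈ invariants H, polyAct w f = f) : w ∈ H := by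
  have h1 : ⋃ g : H, (LinearMap.ker ((w⁻¹ : V ≃ₗ[k] V).toLinearMap
      - (g : V ≃ₗ[k] V).toLinearMap) : Set V) = Set.univ := by
    refine Set.eq_univ_of_forall fun x => ?_
    obtain ⟨g, hg, hx⟩ := exists_apply_eq_of_evalAt_eq H (x := x) (y := w⁻¹ x) fun f hf => by
      rw [← evalAt_polyAct, h f hf]
    exact Set.mem_iUnion.2 ⟨⟨g, hg⟩, sub_eq_zero.2 hx.symm⟩
  obtain ⟨g, hg⟩ := Subspace.exists_eq_top_of_iUnion_eq_univ h1
  have h2 : w⁻¹ = g := by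
    ext x
    have := LinearMap.mem_ker.1 (hg ▸ Submodule.mem_top : x ∈ LinearMap.ker _)
    exact sub_eq_zero.1 this
  rw [← inv_inv w, h2]
  exact inv_mem g.2

/-! ### Translations -/

/-- Translation of polynomial functions, `(T_x f)(v) = f (v + x)`. -/
def transl (x : V) : Poly k V →ₐ[k] Poly k V :=
  lift (ι k (Module.Dual k V) + (Algebra.linearMap k _) ∘ₗ Module.Dual.eval k V x)

theorem transl_ι (x : V) (l : Module.Dual k V) :
    transl x (ι k _ l) = ι k _ l + algebraMap k _ (l x) :=
  lift_ι_apply _ _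

theorem transl_neg_transl (x : V) (f : Poly k V) : transl (-x) (transl x f) = f := by
  have : (transl (-x)).comp (transl x) = AlgHom.id k (Poly k V) := by
    apply algHom_ext
    ext l
    change transl (-x) (transl x (ι k _ l)) = ι k _ l
    rw [transl_ι, map_add, AlgHom.commutes, transl_ι, map_neg, map_neg]
    ring
  exact DFunLike.congr_fun this f

theorem transl_transl_neg (x : V) (f : Poly k V) : transl x (transl (-x) f) = f := by
  have := transl_neg_transl (-x) f
  rwa [neg_neg] at this

theorem evalAt_transl (x y : V) (f : Poly k V) :
    evalAt y (transl x f) = evalAt (y + x) f := by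
  have : (evalAt y).comp (transl x) = evalAt (k := k) (y + x) := by
    apply algHom_ext
    ext l
    change evalAt y (transl x (ι k _ l)) = evalAt (y + x) (ι k _ l)
    rw [transl_ι, map_add, AlgHom.commutes, evalAt_ι, evalAt_ι, map_add]
    rfl
  exact DFunLike.congr_fun this f

theorem polyAct_ι (g : V ≃ₗ[k] V) (l : Module.Dual k V) :
    polyAct g (ι k _ l) = ι k _ ((natRep k V).dual g l) :=
  symAct_ι _ _ _

theorem transl_polyAct {x : V} {g : V ≃ₗ[k] V} (hg : g x = x) (f : Poly k V) :
    transl x (polyAct g f) = polyAct g (transl x f) := by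
  have h1 : g⁻¹ x = x := (LinearEquiv.symm_apply_eq g).2 hg.symm
  have : (transl x).comp (polyAct g) = (polyAct g).comp (transl (k := k) x) := by
    apply algHom_ext
    ext l
    change transl x (polyAct g (ι k _ l)) = polyAct g (transl x (ι k _ l))
    rw [transl_ι, polyAct_ι, transl_ι, map_add, AlgHom.commutes, polyAct_ι]
    congr 2
    exact congrArg l h1
  exact DFunLike.congr_fun this f

variable {H} in
/-- Translation of invariant functions by an invariant vector. -/
def translInv {x : V} (hx : ∀ g ∈ H, g x = x) : invariants H →ₐ[k] invariants H :=
  ((transl x).comp (invariants H).val).codRestrict (invariants H) fun f g hg => by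
    change polyAct g (transl x (f : Poly k V)) = transl x (f : Poly k V)
    rw [← transl_polyAct (hx g hg), f.2 g hg]

variable {H} in
theorem neg_fixed {x : V} (hx : ∀ g ∈ H, g x = x) : ∀ g ∈ H, g (-x) = -x := fun g hg => by
  rw [map_neg, hx g hg]

variable {H} in
theorem coe_translInv {x : V} (hx : ∀ g ∈ H, g x = x) (f : invariants H) :
    (translInv hx f : Poly k V) = transl x (f : Poly k V) := rfl

end Linear

/-! ### Stabilizers of points in reflection groups -/

section Stabilizer

variable {k S Γ : Type*} [Field k] [CommRing S] [Algebra k S] [Group Γ] [Finite Γ]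
  [IsNoetherianRing S] {a : Γ →* (S →ₐ[k] S)} {R R' : Subalgebra k S} {e : S →ₐ[k] k}
  {H : Subgroup Γ}

omit [IsNoetherianRing S] in
theorem fibreIdeal_anti (h : R ≤ R') (e : S →ₐ[k] k) : fibreIdeal R e ≤ fibreIdeal R' e :=
  Ideal.map_le_iff_le_comap.2 fun f hf => mem_fibreIdeal_of_mem (h f.2) hf

/-- The degrees of the fibres of the quotients by a group and by the stabilizer of a point. -/
theorem index_mul_finrank_fibre_le [Module.Finite k (S ⧸ fibreIdeal R e)]
    (hR : IsInv a R) (hH : IsStab a e H) (hR' : IsInv (a.comp H.subtype) R') :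
    H.index * Module.finrank k (S ⧸ fibreIdeal R' e) ≤ Module.finrank k (S ⧸ fibreIdeal R e) := by
  classical
  have := Fintype.ofFinite (Γ ⧸ H)
  have hRR' : R ≤ R' := fun f hf => (hR' f).2 fun γ => (hR f).1 hf γ
  obtain ⟨N, hN⟩ := ker_pow_le_of_isStab hH hR'
  let F : S →ₗ[k] (Γ ⧸ H → S ⧸ fibreIdeal R' e) := LinearMap.pi fun q =>
    (Ideal.Quotient.mkₐ k (fibreIdeal R' e)).toLinearMap ∘ₗ (a (q.out)⁻¹).toLinearMap
  have hF : ∀ f q, F f q = Ideal.Quotient.mk (fibreIdeal R' e) (a (q.out)⁻¹ f) := fun _ _ => rfl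
  -- Values in the fibres at the points of the orbit can be prescribed independently: each is
  -- realized near `e`, with high order of vanishing at the other points, and moved by a
  -- representative of the coset.
  have hsurj : Function.Surjective F := by
    intro v
    choose g hg using fun q => Ideal.Quotient.mk_surjective (v q)
    choose b hb hb' using fun q => exists_localized_at (a := a) hH (g q) N
    refine ⟨∑ q : Γ ⧸ H, a q.out (b q), funext fun q => ?_⟩
    rw [hF, map_sum, map_sum, Finset.sum_eq_single q]
    · rw [act_inv_act, ← hg q]
      exact Ideal.Quotient.eq.2 (hN (hb q))
    · intro q' _ hq'
      rw [← act_mul]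
      refine Ideal.Quotient.eq_zero_iff_mem.2 (hN (act_mem_ker_pow e _ (hb' q' _ fun hc => hq' ?_)))
      rw [← q.out_eq', ← q'.out_eq']
      exact (QuotientGroup.eq.2 hc).symm
    · intro h; exact absurd (Finset.mem_univ q) h
  have hker : (fibreIdeal R e).restrictScalars k ≤ LinearMap.ker F := by
    intro f hf
    rw [LinearMap.mem_ker]
    funext q
    rw [hF]
    exact Ideal.Quotient.eq_zero_iff_mem.2 (fibreIdeal_anti hRR' e (act_mem_fibreIdeal hR hf _))
  let F' : (S ⧸ fibreIdeal R e) →ₗ[k] (Γ ⧸ H → S ⧸ fibreIdeal R' e) :=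
    ((fibreIdeal R e).restrictScalars k).liftQ F hker
  have hsurj' : Function.Surjective F' := fun v => by
    obtain ⟨f, hf⟩ := hsurj v
    exact ⟨Ideal.Quotient.mk _ f, hf⟩
  have : Module.Finite k (S ⧸ fibreIdeal R' e) := by
    refine Module.Finite.of_surjective (LinearMap.proj (QuotientGroup.mk 1 : Γ ⧸ H) ∘ₗ F') ?_
    exact (Function.surjective_eval _).comp hsurj'
  have h1 := LinearMap.finrank_le_finrank_of_surjective hsurj'
  rwa [Module.finrank_pi_fintype, Finset.sum_const, Finset.card_univ, smul_eq_mul,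
    ← Nat.card_eq_fintype_card] at h1

end Stabilizer

end GoodQuotient

/-! ### Semicontinuity of fibre lengths and Steinberg's theorem. -/

namespace GoodQuotient

open SymmetricAlgebra

section Semicontinuity

variable {k S : Type*} [Field k] [CommRing S] [Algebra k S] {R : Subalgebra k S}

theorem mk_mul_eq_smul {e : S →ₐ[k] k} {c : S} (hc : c ∈ R) (g : S) :
    Ideal.Quotient.mk (fibreIdeal R e) (c * g) = e c • Ideal.Quotient.mk (fibreIdeal R e) g := by
  rw [← Ideal.Quotient.mkₐ_eq_mk k, ← map_smul, Ideal.Quotient.mkₐ_eq_mk, Ideal.Quotient.eq,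
    Algebra.smul_def (e c) g, ← sub_mul]
  refine Ideal.mul_mem_right _ _ (mem_fibreIdeal_of_mem (sub_mem hc (R.algebraMap_mem _)) ?_)
  rw [map_sub, AlgHom.commutes]
  exact sub_self _

/-- The degree of the fibres of a quotient is upper semicontinuous. -/
theorem exists_finrank_fibre_le [Module.Finite R S] (e : S →ₐ[k] k) :
    ∃ u : S, e u = 1 ∧ ∀ e' : S →ₐ[k] k, e' u ≠ 0 →
      Module.finrank k (S ⧸ fibreIdeal R e') ≤ Module.finrank k (S ⧸ fibreIdeal R e) := by
  have := finite_quotient_fibreIdeal (R := R) e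
  let B := Module.finBasis k (S ⧸ fibreIdeal R e)
  choose z hz using fun i => Ideal.Quotient.mk_surjective (B i)
  have : Module.Finite R (⊤ : Submodule R S) := Module.Finite.equiv Submodule.topEquiv.symm
  obtain ⟨u, hu1, hu⟩ := exists_mul_mem_span (R := R) ⊤ z e (by
    intro f _
    have h1 : Ideal.Quotient.mk (fibreIdeal R e) f ∈ Submodule.span k (Set.range B) := by
      rw [B.span_eq]; trivial
    have h2 : Set.range B = (Ideal.Quotient.mkₐ k (fibreIdeal R e)).toLinearMap '' Set.range z := by
      rw [← Set.range_comp]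
      exact congrArg Set.range (funext fun i => (hz i).symm)
    rw [h2, Submodule.span_image] at h1
    obtain ⟨g, hg, hgf⟩ := h1
    refine ⟨g, hg, ?_⟩
    have h3 : f - g ∈ fibreIdeal R e := Ideal.Quotient.eq.1 hgf.symm
    rw [← SetLike.mem_coe, ← fibreIdeal_eq_smul R e]
    exact h3)
  refine ⟨u, hu1, fun e' he' => ?_⟩
  -- The same finite family still generates wherever the denominator `u` does not vanish.
  have hspan : Submodule.span k (Set.range fun i => Ideal.Quotient.mk (fibreIdeal R e') (z i))
      = ⊤ := by
    rw [eq_top_iff]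
    rintro x -
    obtain ⟨f, rfl⟩ := Ideal.Quotient.mk_surjective x
    obtain ⟨c, hc⟩ := (Submodule.mem_span_range_iff_exists_fun R).1 (hu f trivial)
    have h1 : e' u • Ideal.Quotient.mk (fibreIdeal R e') f
        = ∑ i, e' (c i) • Ideal.Quotient.mk (fibreIdeal R e') (z i) := by
      rw [← mk_mul_eq_smul u.2, ← hc, map_sum]
      exact Finset.sum_congr rfl fun i _ => mk_mul_eq_smul (c i).2 _
    rw [← inv_smul_smul₀ he' (Ideal.Quotient.mk (fibreIdeal R e') f), h1]
    exact Submodule.smul_mem _ _ (sum_mem fun i _ => Submodule.smul_mem _ _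
      (Submodule.subset_span ⟨i, rfl⟩))
  rw [← finrank_top k (S ⧸ fibreIdeal R e'), ← hspan]
  exact (finrank_range_le_card _).trans (by rw [Fintype.card_fin])

end Semicontinuity

section Steinberg

variable {k V : Type*} [Field k] [CharZero k] [AddCommGroup V] [Module k V]

open Polynomial in
theorem exists_evalAt_smul_ne_zero {u : Poly k V} (hu : evalAt (0 : V) u ≠ 0) (x : V) :
    ∃ t : k, t ≠ 0 ∧ evalAt (t • x) u ≠ 0 := by
  let Q : Poly k V →ₐ[k] k[X] :=
    lift ((LinearMap.toSpanSingleton k k[X] X) ∘ₗ Module.Dual.eval k V x)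
  have hQ : ∀ t : k, ∀ f, (Q f).eval t = evalAt (t • x) f := by
    intro t f
    have : (Polynomial.aeval t).comp Q = evalAt (k := k) (t • x) := by
      apply SymmetricAlgebra.algHom_ext
      ext l
      change Polynomial.aeval t (Q (ι k _ l)) = evalAt (t • x) (ι k _ l)
      rw [evalAt_ι, lift_ι_apply]
      simp [mul_comm]
    rw [← this]
    exact (Polynomial.coe_aeval_eq_eval t).symm ▸ rfl
  by_contra! hc
  -- `Q u` is the restriction of `u` to the line through `x`. The factor `X` covers `t = 0`, about
  -- which `hc` says nothing.
  have h0 : Q u * X = 0 := Polynomial.funext fun t => by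
    rw [Polynomial.eval_mul, hQ, Polynomial.eval_X, Polynomial.eval_zero]
    rcases eq_or_ne t 0 with rfl | ht
    · rw [mul_zero]
    · rw [hc t ht, zero_mul]
  have h1 : Q u = 0 := (mul_eq_zero.1 h0).resolve_right Polynomial.X_ne_zero
  apply hu
  rw [← zero_smul k x, ← hQ, h1, Polynomial.eval_zero]

variable [FiniteDimensional k V]

omit [CharZero k] in
theorem finite_invariants (K : Subgroup (V ≃ₗ[k] V)) [Finite K] :
    Module.Finite (invariants K) (Poly k V) :=
  finite_of_isInv (isInv_invariants K)

-- Translation by an `H`-fixed vector commutes with `H`, hence carries the fibre ideal at `x` into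
-- the one at `0`.
omit [CharZero k] in
theorem finrank_quotient_fibreIdeal_zero_le {H : Subgroup (V ≃ₗ[k] V)} [Finite H] {x : V}
    (hx : ∀ g ∈ H, g x = x) :
    Module.finrank k (Poly k V ⧸ fibreIdeal (invariants H) (evalAt 0))
      ≤ Module.finrank k (Poly k V ⧸ fibreIdeal (invariants H) (evalAt x)) := by
  have := finite_invariants H
  have := finite_quotient_fibreIdeal (R := invariants H) (evalAt x)
  let F : Poly k V →ₗ[k] Poly k V ⧸ fibreIdeal (invariants H) (evalAt 0) :=
    (Ideal.Quotient.mkₐ k _).toLinearMap ∘ₗ (transl x).toLinearMap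
  have hF : (fibreIdeal (invariants H) (evalAt x)).restrictScalars k ≤ LinearMap.ker F := by
    intro f hf
    refine Ideal.Quotient.eq_zero_iff_mem.2 ?_
    have h1 : fibreIdeal (invariants H) (evalAt x)
        ≤ (fibreIdeal (invariants H) (evalAt 0)).comap (transl x) := by
      refine Ideal.map_le_iff_le_comap.2 fun g hg => ?_
      refine mem_fibreIdeal_of_mem (translInv hx g).2 ?_
      change evalAt 0 (transl x (g : Poly k V)) = 0
      rw [evalAt_transl, zero_add]
      exact hg
    exact h1 hf
  refine LinearMap.finrank_le_finrank_of_surjective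
    (f := ((fibreIdeal (invariants H) (evalAt x)).restrictScalars k).liftQ F hF) fun y => ?_
  obtain ⟨f, rfl⟩ := Ideal.Quotient.mk_surjective y
  refine ⟨Ideal.Quotient.mk _ (transl (-x) f), ?_⟩
  change Ideal.Quotient.mk _ (transl x (transl (-x) f)) = _
  rw [transl_transl_neg]

/-- Pointwise stabilizers in a reflection group are reflection groups. -/
theorem isReflectionGroup_stabilizer {K : Subgroup (V ≃ₗ[k] V)} [Finite K]
    (hK : IsReflectionGroup ((natRep k V).comp K.subtype)) (x : V) :
    IsReflectionGroup ((natRep k V).comp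
      (K ⊓ fixingSubgroup (V ≃ₗ[k] V) ({x} : Set V)).subtype) := by
  have hfin := finite_invariants K
  have h1 : Module.finrank k (Poly k V ⧸ fibreIdeal (invariants K) (evalAt 0)) ≤ Nat.card K := by
    rw [evalAt_zero]
    refine finrank_fibre_le_of_isReflectionGroup (isReflectionGroup_dual_iff.2 hK) ?_
    rw [← polyAct_comp_eq_symAct]
    exact isInv_invariants K
  obtain ⟨u, hu, hu'⟩ := exists_finrank_fibre_le (R := invariants K) (evalAt 0)
  -- For `t ≠ 0` the points `x` and `t • x` have the same stabilizer, and `t • x` can be taken in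
  -- the open set where the fibre is no longer than the zero fibre, that is, of length at most
  -- `|K|`.
  obtain ⟨t, ht, htu⟩ := exists_evalAt_smul_ne_zero (u := u) (by rw [hu]; exact one_ne_zero) x
  have hH : fixingSubgroup (V ≃ₗ[k] V) ({t • x} : Set V)
      = fixingSubgroup (V ≃ₗ[k] V) ({x} : Set V) := by
    ext g
    simp only [mem_fixingSubgroup_iff, Set.mem_singleton_iff, forall_eq]
    change g (t • x) = t • x ↔ g x = x
    rw [map_smul, smul_right_inj ht]
  set H := K ⊓ fixingSubgroup (V ≃ₗ[k] V) ({x} : Set V) with hHdef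
  have hHK : H ≤ K := inf_le_left
  have : Finite H := Finite.of_injective _ (Subgroup.inclusion_injective hHK)
  have hst := isStab_evalAt K (t • x)
  rw [hH] at hst
  have := finite_quotient_fibreIdeal (R := invariants K) (evalAt (t • x))
  -- Dividing by the index bounds the length of the fibre for `H` at `t • x` by `|H|`; translation
  -- to the origin then brings it within the numerical criterion.
  have h2 := index_mul_finrank_fibre_le (isInv_invariants K) hst (isInv_subgroupOf hHK)
  have h3 : Module.finrank k (Poly k V ⧸ fibreIdeal (invariants H) (evalAt (t • x)))
      ≤ Nat.card H := by
    have h4 := (H.subgroupOf K).index_mul_card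
    rw [Nat.card_congr (Subgroup.subgroupOfEquivOfLe hHK).toEquiv] at h4
    have h5 : (H.subgroupOf K).index ≠ 0 := Subgroup.index_ne_zero_of_finite
    refine Nat.le_of_mul_le_mul_left ?_ (Nat.pos_of_ne_zero h5)
    rw [h4]
    exact h2.trans ((hu' _ htu).trans h1)
  have hx : ∀ g ∈ H, g (t • x) = t • x := fun g hg => by
    have := (mem_fixingSubgroup_iff _).1 hg.2 x rfl
    rw [map_smul]
    exact congrArg (t • ·) this
  rw [← isReflectionGroup_dual_iff]
  refine isReflectionGroup_of_finrank_le (R := invariants H) ?_ ?_ ?_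
  · rw [dual_injective_iff]
    intro g h hgh
    exact Subtype.ext (LinearEquiv.toLinearMap_injective hgh)
  · rw [← polyAct_comp_eq_symAct]
    exact isInv_invariants H
  · rw [← evalAt_zero]
    exact (finrank_quotient_fibreIdeal_zero_le hx).trans h3

end Steinberg

end GoodQuotient

namespace GoodQuotient

open SymmetricAlgebra

/-! ### Functoriality of weights -/

section WeightMaps

variable {k X Y : Type*} [Field k] [AddCommGroup X] [Module k X] [AddCommGroup Y] [Module k Y]
  {β : Representation k kˣ X} {β' : Representation k kˣ Y}

theorem mem_wt {n : ℕ} {x : X} : x ∈ wt β n ↔ ∀ t : kˣ, β t x = (t : k) ^ n • x := Iff.rfl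

theorem map_mem_wt {F : X →ₗ[k] Y} (hF : ∀ t x, F (β t x) = β' t (F x)) {n : ℕ} {x : X}
    (hx : x ∈ wt β n) : F x ∈ wt β' n := fun t => by
  rw [← hF, mem_wt.1 hx t, map_smul]

theorem map_wtGE_le {F : X →ₗ[k] Y} (hF : ∀ t x, F (β t x) = β' t (F x)) (N : ℕ) :
    (wtGE β N).map F ≤ wtGE β' N := by
  rw [wtGE, Submodule.map_iSup]
  refine iSup_le fun j => ?_
  rintro _ ⟨x, hx, rfl⟩
  exact wt_le_wtGE (Nat.le_add_right N j) (map_mem_wt hF hx)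

theorem wtGE_eq_top_of_surjective {F : X →ₗ[k] Y} (hF : ∀ t x, F (β t x) = β' t (F x))
    (hs : Function.Surjective F) {N : ℕ} (h : wtGE β N = ⊤) : wtGE β' N = ⊤ := by
  rw [eq_top_iff, ← LinearMap.range_eq_top.2 hs, ← Submodule.map_top, ← h]
  exact map_wtGE_le hF N

theorem wtGE_eq_top_of_injective [CharZero k] {F : Y →ₗ[k] X}
    (hF : ∀ t y, F (β' t y) = β t (F y)) (hi : Function.Injective F) {N : ℕ}
    (h : LinearMap.range F ≤ wtGE β N) : wtGE β' N = ⊤ := by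
  have h1 := le_iSup_inf_wt (J := LinearMap.range F) (by
    rintro t _ ⟨y, rfl⟩
    exact ⟨β' t y, hF t y⟩) h
  have h2 : ∀ j, LinearMap.range F ⊓ wt β (N + j) ≤ (wtGE β' N).map F := by
    rintro j _ ⟨⟨y, rfl⟩, hy⟩
    refine ⟨y, wt_le_wtGE (Nat.le_add_right N j) fun t => hi ?_, rfl⟩
    rw [hF, mem_wt.1 hy t, map_smul]
  rw [eq_top_iff]
  intro y _
  obtain ⟨y', hy', h'⟩ := (h1.trans (iSup_le h2)) ⟨y, rfl⟩
  rwa [← hi h']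

/-- A surjective map that commutes with a finite group and with weights has a section with the
same properties. -/
theorem exists_equivariant_section [CharZero k] {Γ : Type*} [Group Γ] [Finite Γ]
    {r : Representation k Γ X} {r' : Representation k Γ Y} {T : X →ₗ[k] Y}
    (hT : Function.Surjective T) (hβ : ∀ t x, T (β t x) = β' t (T x))
    (hr : ∀ γ x, T (r γ x) = r' γ (T x)) (hc : ∀ t γ x, β t (r γ x) = r γ (β t x))
    (hc' : ∀ t γ y, β' t (r' γ y) = r' γ (β' t y)) {N : ℕ} (h : wtGE β N = ⊤) :
    ∃ s : Y →ₗ[k] X, (∀ y, T (s y) = y) ∧ (∀ γ y, s (r' γ y) = r γ (s y)) ∧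
      ∀ t y, s (β' t y) = β t (s y) := by
  let A : Set Y := {y | ∃ x, T x = y ∧ ∃ n, x ∈ wt β n}
  have hA : (⊤ : Submodule k Y) ≤ Submodule.span k A := by
    rw [← LinearMap.range_eq_top.2 hT, ← Submodule.map_top, ← h, wtGE, Submodule.map_iSup]
    refine iSup_le fun j => ?_
    rintro _ ⟨x, hx, rfl⟩
    exact Submodule.subset_span ⟨x, rfl, _, hx⟩
  -- A basis of images of weight vectors: sending each of its members to its chosen weight vector
  -- gives a section compatible with the weights. Averaging over the group keeps this compatibility
  -- since the two actions commute.
  let b := Module.Basis.ofSpan hA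
  have hb : ∀ i, b i ∈ A := fun i => Module.Basis.ofSpan_subset hA ⟨i, rfl⟩
  choose x hx n hn using hb
  let s₀ : Y →ₗ[k] X := b.constr k x
  have hs₀ : ∀ i, s₀ (b i) = x i := fun i => b.constr_basis k x i
  have hTs₀ : T ∘ₗ s₀ = LinearMap.id := b.ext fun i => by
    rw [LinearMap.comp_apply, hs₀, hx]; rfl
  have hβs₀ : ∀ t, s₀ ∘ₗ β' t = β t ∘ₗ s₀ := fun t => b.ext fun i => by
    rw [LinearMap.comp_apply, LinearMap.comp_apply, hs₀]
    have h1 : b i ∈ wt β' (n i) := by rw [← hx]; exact map_mem_wt hβ (hn i)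
    rw [mem_wt.1 h1 t, map_smul, hs₀, mem_wt.1 (hn i) t]
  let ϖ := Representation.linHom r' r
  let s := avg ϖ s₀
  refine ⟨s, fun y => ?_, fun γ y => ?_, fun t y => ?_⟩
  · have h1 : s - s₀ ∈ LinearMap.ker
        (LinearMap.compRight k T : (Y →ₗ[k] X) →ₗ[k] (Y →ₗ[k] Y)) := by
      refine avg_sub_mem _ _ fun γ => ?_
      rw [LinearMap.mem_ker]
      ext y
      change T (r γ (s₀ (r' γ⁻¹ y)) - s₀ y) = 0
      have h2 : ∀ y, T (s₀ y) = y := fun y => LinearMap.congr_fun hTs₀ y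
      rw [map_sub, hr, h2, h2, ← Module.End.mul_apply, ← map_mul, mul_inv_cancel, map_one,
        Module.End.one_apply, sub_self]
    have h2 : T (s y - s₀ y) = 0 := LinearMap.congr_fun h1 y
    rw [map_sub, sub_eq_zero] at h2
    rw [h2]
    exact LinearMap.congr_fun hTs₀ y
  · have h1 : r γ (s (r' γ⁻¹ (r' γ y))) = s (r' γ y) :=
      LinearMap.congr_fun (avg_invariant ϖ γ s₀) (r' γ y)
    rw [← h1, ← Module.End.mul_apply (r' γ⁻¹), ← map_mul, inv_mul_cancel, map_one,
      Module.End.one_apply]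
  · let N : Submodule k (Y →ₗ[k] X) :=
      { carrier := {f | ∀ t y, f (β' t y) = β t (f y)}
        add_mem' := fun hf hg t y => by
          rw [LinearMap.add_apply, LinearMap.add_apply, map_add, hf t y, hg t y]
        zero_mem' := fun t y => by simp
        smul_mem' := fun c f hf t y => by
          rw [LinearMap.smul_apply, LinearMap.smul_apply, map_smul, hf t y] }
    have h1 : s ∈ N := avg_mem ϖ N fun γ t y => by
      change r γ (s₀ (r' γ⁻¹ (β' t y))) = β t (r γ (s₀ (r' γ⁻¹ y)))
      rw [← hc', hc]
      exact congrArg (r γ) (LinearMap.congr_fun (hβs₀ t) _)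
    exact h1 t y

end WeightMaps

/-! ### Generators of a graded algebra. -/

section Generation

variable {k R : Type*} [Field k] [CharZero k] [CommRing R] [Algebra k R] {a : kˣ →* (R →ₐ[k] R)}

/-- A stable subalgebra that contains generators of the augmentation ideal modulo its square. -/
theorem subalgebra_eq_top_of_graded {ε : R →ₐ[k] k}
    (h1 : (RingHom.ker ε).restrictScalars k ≤ wtGE (actRep a) 1) (h0 : wtGE (actRep a) 0 = ⊤)
    {R₁ : Subalgebra k R} (hR₁ : ∀ t, ∀ f ∈ R₁, a t f ∈ R₁)
    (h : ∀ x ∈ RingHom.ker ε, ∃ y ∈ R₁, x - y ∈ RingHom.ker ε ^ 2) : R₁ = ⊤ := by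
  set m := RingHom.ker ε
  have hsucc : ∀ j, ∀ x ∈ m ^ j, ∃ y ∈ R₁, x - y ∈ m ^ (j + 1) := by
    intro j
    induction j with
    | zero =>
      intro x _
      refine ⟨algebraMap k R (ε x), R₁.algebraMap_mem _, ?_⟩
      rw [zero_add, pow_one, RingHom.mem_ker, map_sub, AlgHom.commutes]
      exact sub_self _
    | succ j ih =>
      intro x hx
      rw [pow_succ] at hx
      refine Submodule.mul_induction_on hx (fun y hy z hz => ?_) fun x y hx hy => ?_
      · obtain ⟨f, hf, hfy⟩ := ih y hy
        obtain ⟨g, hg, hgz⟩ := h z hz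
        refine ⟨f * g, mul_mem hf hg, ?_⟩
        have hf' : f ∈ m ^ j := by
          rw [← sub_sub_cancel y f]
          exact sub_mem hy (Ideal.pow_le_pow_right (Nat.le_succ j) hfy)
        have h3 : y * z - f * g = (y - f) * z + f * (z - g) := by ring
        rw [h3]
        refine add_mem ?_ ?_
        · rw [pow_succ _ (j + 1)]
          exact Ideal.mul_mem_mul hfy hz
        · rw [show j + 1 + 1 = j + 2 from rfl, pow_add]
          exact Ideal.mul_mem_mul hf' hgz
      · obtain ⟨f, hf, hfx⟩ := hx
        obtain ⟨g, hg, hgy⟩ := hy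
        exact ⟨f + g, add_mem hf hg, by rw [add_sub_add_comm]; exact add_mem hfx hgy⟩
  have hpow : ∀ N, ∀ x, ∃ y ∈ R₁, x - y ∈ m ^ N := by
    intro N
    induction N with
    | zero => exact fun x => ⟨0, zero_mem _, by rw [pow_zero, Ideal.one_eq_top]; trivial⟩
    | succ N ih =>
      intro x
      obtain ⟨y, hy, hxy⟩ := ih x
      obtain ⟨z, hz, hyz⟩ := hsucc N _ hxy
      exact ⟨y + z, add_mem hy hz, by rwa [← sub_sub]⟩
  -- In the quotient by `R₁`, an element of weight `n` is also a sum of elements of weight above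
  -- `n`, hence zero.
  have hwt : ∀ n, wt (actRep a) n ≤ R₁.toSubmodule := by
    intro n x hx
    obtain ⟨y, hy, hxy⟩ := hpow (n + 1) x
    have hst : ∀ t, ∀ x ∈ R₁.toSubmodule, actRep a t x ∈ R₁.toSubmodule := hR₁
    have h3 := mkQ_mem_wt hst hx
    have h4 := mkQ_mem_wtGE hst (pow_le_wtGE h1 h0 (n + 1) hxy)
    have h5 : R₁.toSubmodule.mkQ y = 0 := (Submodule.Quotient.mk_eq_zero _).2 hy
    rw [map_sub, h5, sub_zero] at h4
    exact (Submodule.Quotient.mk_eq_zero _).1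
      (eq_zero_of_mem_wt_of_mem_wtGE (Nat.lt_succ_self n) h3 h4)
  rw [← Algebra.toSubmodule_eq_top, eq_top_iff, ← h0]
  exact iSup_le fun j => hwt _

end Generation

/-! ### The grading of the polynomial functions -/

section Grading

variable {k V : Type*} [Field k] [AddCommGroup V] [Module k V]

/-- The action of `t` on functions, for a grading, is induced by the inverse of `t` on `V`. -/
def gradHom (ρ : kˣ →* (V ≃ₗ[k] V)) : kˣ →* (V ≃ₗ[k] V) := ρ.comp invMonoidHom

theorem wtGE_dual_eq_top [FiniteDimensional k V] {ρ : kˣ →* (V ≃ₗ[k] V)} (hρ : IsGrading ρ) :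
    wtGE (Representation.dual ((natRep k V).comp (gradHom ρ))) 1 = ⊤ := by
  let b := Module.Basis.ofSpan (le_of_eq hρ.symm)
  have hb : ∀ i, ∃ n : ℕ, 0 < n ∧ ∀ t : kˣ, ρ t (b i) = (t : k) ^ n • b i :=
    fun i => Module.Basis.ofSpan_subset (le_of_eq hρ.symm) ⟨i, rfl⟩
  choose n hn hn' using hb
  have : Finite _ := Module.Finite.finite_basis b
  classical
  rw [eq_top_iff, ← b.dualBasis.span_eq, Submodule.span_le]
  rintro _ ⟨i, rfl⟩
  refine wt_le_wtGE (hn i) fun t => b.ext fun j => ?_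
  have h1 : Representation.dual ((natRep k V).comp (gradHom ρ)) t (b.dualBasis i) (b j)
      = b.dualBasis i (ρ (t⁻¹)⁻¹ (b j)) := rfl
  rw [h1, inv_inv, hn', map_smul, LinearMap.smul_apply, b.dualBasis_apply_self]
  split_ifs with hij
  · rw [hij]
  · rw [smul_zero, smul_zero]

end Grading

end GoodQuotient

namespace GoodQuotient

open SymmetricAlgebra

theorem finiteDimensional_cotangent {k R : Type*} [Field k] [CommRing R] [Algebra k R]
    [IsNoetherianRing R] (ε : R →ₐ[k] k) : FiniteDimensional k (RingHom.ker ε).Cotangent := by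
  have : IsNoetherian R (RingHom.ker ε).Cotangent := isNoetherian_of_surjective
    (RingHom.ker ε).toCotangent (LinearMap.range_eq_top.2 (Ideal.toCotangent_surjective _))
  obtain ⟨s, hs⟩ := IsNoetherian.noetherian (⊤ : Submodule R (RingHom.ker ε).Cotangent)
  refine ⟨⟨s, ?_⟩⟩
  rw [eq_top_iff]
  intro f _
  have hf : f ∈ Submodule.span R (s : Set (RingHom.ker ε).Cotangent) := by rw [hs]; trivial
  induction hf using Submodule.span_induction with
  | mem f hf => exact Submodule.subset_span hf
  | zero => exact zero_mem _
  | add f g _ _ hf hg => exact add_mem (hf trivial) (hg trivial)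
  | smul c f _ hf =>
    have h1 : c • f = ε c • f := by
      obtain ⟨f, rfl⟩ := Ideal.toCotangent_surjective _ f
      rw [← algebraMap_smul R (ε c), ← map_smul, ← map_smul, ← sub_eq_zero, ← map_sub,
        Ideal.toCotangent_eq_zero, pow_two, ← sub_smul]
      refine Ideal.mul_mem_mul ?_ f.2
      rw [RingHom.mem_ker, map_sub, AlgHom.commutes]
      exact sub_self _
    rw [h1]
    exact Submodule.smul_mem _ _ (hf trivial)

/-! ### Cotangent spaces of quotients. -/

section Cotangent

variable {k V : Type*} [Field k] [AddCommGroup V] [Module k V] (G : Subgroup (V ≃ₗ[k] V)) (x : V)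

instance addCommGroup_maxIdeal : AddCommGroup (maxIdeal G x) := Submodule.addCommGroup _

instance module_maxIdeal : Module k (maxIdeal G x) := Submodule.module' _

instance addCommGroup_cot : AddCommGroup (Cot G x) :=
  (maxIdeal G x).instAddCommGroupCotangent

instance module_cot : Module k (Cot G x) := (maxIdeal G x).instModuleCotangentOfAlgebra

instance commRing_invariants : CommRing (invariants G) := (invariants G).toCommRing

instance algebra_invariants : Algebra k (invariants G) := (invariants G).algebra

/-- The inclusion of the maximal ideal of a point in the algebra of invariants. -/
def maxIncl : maxIdeal G x →ₗ[k] invariants G where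
  toFun f := f
  map_add' _ _ := rfl
  map_smul' _ _ := rfl

/-- The action on the maximal ideal of a point of the quotient. -/
def maxRep : Representation k (normFix G x) (maxIdeal G x) where
  toFun n :=
    { toFun := fun f => ⟨invAct G n f, maxIdeal_le_comap G x n f.2⟩
      map_add' := fun f g => Subtype.ext (map_add (invAct G n) (f : invariants G) g)
      map_smul' := fun c f => Subtype.ext (map_smul (invAct G n) c (f : invariants G)) }
  map_one' := by
    ext f
    change ((invAct G 1 (f : invariants G) : invariants G) : Poly k V) = (f : invariants G)
    rw [map_one]; rfl
  map_mul' a b := by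
    ext f
    change ((invAct G (a.1 * b.1) (f : invariants G) : invariants G) : Poly k V) = _
    rw [map_mul]; rfl

/-- The class in the cotangent space. -/
def toCot : maxIdeal G x →ₗ[k] Cot G x := (maxIdeal G x).toCotangent.restrictScalars k

variable {G x}

theorem toCot_surjective : Function.Surjective (toCot G x) := Ideal.toCotangent_surjective _

theorem toCot_eq_zero {f : maxIdeal G x} :
    toCot G x f = 0 ↔ (f : invariants G) ∈ maxIdeal G x ^ 2 := Ideal.toCotangent_eq_zero _ f

theorem toCot_maxRep (n : normFix G x) (f : maxIdeal G x) :
    toCot G x (maxRep G x n f) = cotRep G x n (toCot G x f) :=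
  (Ideal.mapCotangent_toCotangent _ _ (invAct G n) (maxIdeal_le_comap G x n) f).symm

theorem mem_maxIdeal {f : invariants G} : f ∈ maxIdeal G x ↔ evalAt x (f : Poly k V) = 0 := Iff.rfl

instance finiteDimensional_cot [CharZero k] [FiniteDimensional k V] [Finite G] :
    FiniteDimensional k (Cot G x) := by
  have := isNoetherianRing_of_isInv (isInv_invariants G)
  exact finiteDimensional_cotangent ((evalAt x).comp (invariants G).val)

/-! ### Translation to the origin -/

variable (hx : ∀ g ∈ G, g x = x)

theorem translInv_mem {f : invariants G} : translInv hx f ∈ maxIdeal G 0 ↔ f ∈ maxIdeal G x := by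
  rw [mem_maxIdeal, coe_translInv, evalAt_transl, zero_add]; rfl

theorem translInv_neg_mem {f : invariants G} :
    translInv (neg_fixed hx) f ∈ maxIdeal G x ↔ f ∈ maxIdeal G 0 := by
  rw [mem_maxIdeal, coe_translInv, evalAt_transl, add_neg_cancel]; rfl

theorem translInv_translInv_neg (f : invariants G) :
    translInv hx (translInv (neg_fixed hx) f) = f :=
  Subtype.ext (transl_transl_neg x (f : Poly k V))

theorem translInv_neg_translInv (f : invariants G) :
    translInv (neg_fixed hx) (translInv hx f) = f :=
  Subtype.ext (transl_neg_transl x (f : Poly k V))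

/-- Translation on cotangent spaces. -/
def translCot : Cot G x →ₗ[k] Cot G 0 :=
  Ideal.mapCotangent _ _ (translInv hx) fun _ hf => (translInv_mem hx).2 hf

theorem translCot_toCot (f : maxIdeal G x) :
    translCot hx (toCot G x f) = toCot G 0 ⟨translInv hx f, (translInv_mem hx).2 f.2⟩ :=
  Ideal.mapCotangent_toCotangent _ _ _ _ _

theorem translCot_bijective : Function.Bijective (translCot hx) := by
  constructor
  · rw [injective_iff_map_eq_zero]
    intro f hf
    obtain ⟨f, rfl⟩ := toCot_surjective f
    rw [translCot_toCot, toCot_eq_zero] at hf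
    rw [toCot_eq_zero]
    have h1 : translInv (neg_fixed hx) (translInv hx f)
        ∈ (maxIdeal G 0 ^ 2).map (translInv (neg_fixed hx)) := Ideal.mem_map_of_mem _ hf
    rw [translInv_neg_translInv, Ideal.map_pow] at h1
    refine Ideal.pow_right_mono (Ideal.map_le_iff_le_comap.2 fun g hg => ?_) 2 h1
    exact (translInv_neg_mem hx).2 hg
  · intro f
    obtain ⟨f, rfl⟩ := toCot_surjective f
    refine ⟨toCot G x ⟨translInv (neg_fixed hx) f, (translInv_neg_mem hx).2 f.2⟩, ?_⟩
    rw [translCot_toCot]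
    exact congrArg _ (Subtype.ext (translInv_translInv_neg hx f))

end Cotangent

namespace NormalPair

variable {k V : Type*} [Field k] [AddCommGroup V] [Module k V] (P : NormalPair k V)

theorem quotCotRep_mk (x : V) (hx : ∀ w ∈ P.W, w x = x) (w : P.W) (f : Cot P.G x) :
    P.quotCotRep x hx (QuotientGroup.mk w) f = cotRep P.G x (P.toNormFix x hx w) f := rfl

theorem translCot_quotCotRep (x : V) (hx : ∀ w ∈ P.W, w x = x) (γ : P.Quot) (f : Cot P.G x) :
    translCot (fun g hg => hx g (P.le hg)) (P.quotCotRep x hx γ f)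
      = P.cotRepZero γ (translCot (fun g hg => hx g (P.le hg)) f) := by
  obtain ⟨w, rfl⟩ := QuotientGroup.mk_surjective γ
  obtain ⟨f, rfl⟩ := toCot_surjective f
  rw [quotCotRep_mk, quotCotRep_mk, ← toCot_maxRep, translCot_toCot, translCot_toCot,
    ← toCot_maxRep]
  refine congrArg _ (Subtype.ext (Subtype.ext ?_))
  exact transl_polyAct (hx w w.2) _

/-! ### Weights on the invariants -/

variable {P} {ρ : kˣ →* (V ≃ₗ[k] V)} (hc : ∀ w ∈ P.W, ∀ t : kˣ, Commute w (ρ t))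

include hc in
theorem gradHom_mem_normalizer (t : kˣ) :
    gradHom ρ t ∈ Subgroup.normalizer (P.G : Set (V ≃ₗ[k] V)) := by
  rw [Subgroup.mem_normalizer_iff]
  have h : ∀ t : kˣ, ∀ g ∈ P.G, gradHom ρ t * g * (gradHom ρ t)⁻¹ ∈ P.G := fun t g hg => by
    have : gradHom ρ t * g * (gradHom ρ t)⁻¹ = g := by
      rw [mul_inv_eq_iff_eq_mul]
      exact (hc g (P.le hg) t⁻¹).symm
    rwa [this]
  refine fun g => ⟨h t g, fun hg => ?_⟩
  have h1 := h t⁻¹ _ hg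
  rw [map_inv] at h1
  simpa [mul_assoc] using h1

/-- The grading as a group of automorphisms of the quotient by `G`. -/
def gradFix : kˣ →* normFix P.G 0 :=
  ((gradHom ρ).codRestrict _ (gradHom_mem_normalizer hc)).codRestrict (normFix P.G 0)
    fun t => map_zero (gradHom ρ t)

theorem coe_gradFix (t : kˣ) : ((gradFix hc t : normFix P.G 0) : V ≃ₗ[k] V) = ρ t⁻¹ := rfl

/-- The group `W` acting on the quotient by `G`. -/
abbrev fixZero : P.W →* normFix P.G 0 := P.toNormFix 0 fun w _ => map_zero w

theorem gradFix_mul_fixZero (t : kˣ) (w : P.W) :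
    gradFix hc t * fixZero w = fixZero w * gradFix hc t :=
  Subtype.ext (Subtype.ext (hc w w.2 t⁻¹).symm)

theorem rep_gradFix_fixZero (t : kˣ) (w : P.W) {Z : Type*} [AddCommGroup Z] [Module k Z]
    (r : Representation k (normFix P.G 0) Z) (z : Z) :
    r (gradFix hc t) (r (fixZero w) z) = r (fixZero w) (r (gradFix hc t) z) := by
  rw [← Module.End.mul_apply, ← map_mul, gradFix_mul_fixZero, map_mul]; rfl

/-- The grading of the maximal ideal. -/
def maxGrad : Representation k kˣ (maxIdeal P.G 0) := (maxRep P.G 0).comp (gradFix hc)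

/-- The grading of the cotangent space. -/
def cotGrad : Representation k kˣ (Cot P.G 0) := (cotRep P.G 0).comp (gradFix hc)

/-- The grading of the invariants. -/
def invGrad : kˣ →* (invariants P.G →ₐ[k] invariants P.G) :=
  (invAct P.G).comp ((normFix P.G 0).subtype.comp (gradFix hc))

theorem toCot_maxGrad (t : kˣ) (f : maxIdeal P.G 0) :
    toCot P.G 0 (maxGrad hc t f) = cotGrad hc t (toCot P.G 0 f) := toCot_maxRep _ _

variable [CharZero k] [FiniteDimensional k V] (hρ : IsGrading ρ)

include hρ in
theorem wtGE_maxIdeal_eq_top : wtGE (maxGrad (P := P) hc) 1 = ⊤ := by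
  have hs := wtGE_dual_eq_top hρ
  refine wtGE_eq_top_of_injective
    (β := actRep (symAct (Representation.dual ((natRep k V).comp (gradHom ρ)))))
    (Y := maxIdeal P.G 0) (F := (invariants P.G).val.toLinearMap ∘ₗ maxIncl P.G 0) ?_ ?_ ?_
  · intro t f
    rw [← polyAct_comp_eq_symAct]
    rfl
  · exact fun f g h => Subtype.ext (Subtype.ext h)
  · rintro _ ⟨f, rfl⟩
    refine ker_le_wtGE_one hs ?_
    rw [← evalAt_zero]
    exact f.2

include hρ in
theorem wtGE_cot_eq_top : wtGE (cotGrad (P := P) hc) 1 = ⊤ :=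
  wtGE_eq_top_of_surjective (X := maxIdeal P.G 0) (β := maxGrad hc) (F := toCot P.G 0)
    (toCot_maxGrad hc) toCot_surjective (wtGE_maxIdeal_eq_top hc hρ)

include hρ in
theorem wtGE_invariants_eq_top : wtGE (actRep (invGrad (P := P) hc)) 0 = ⊤ := by
  have hs := wtGE_dual_eq_top hρ
  refine wtGE_eq_top_of_injective
    (β := actRep (symAct (Representation.dual ((natRep k V).comp (gradHom ρ)))))
    (F := (invariants P.G).val.toLinearMap) ?_ (fun f g h => Subtype.ext h) ?_
  · intro t f
    rw [← polyAct_comp_eq_symAct]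
    rfl
  · rw [wtGE_zero_eq_top hs]
    exact le_top

include hρ in
theorem maxIdeal_le_wtGE : (maxIdeal P.G 0).restrictScalars k ≤ wtGE (actRep (invGrad (P := P) hc)) 1 := by
  have h := map_wtGE_le (X := maxIdeal P.G 0) (β := maxGrad hc) (β' := actRep (invGrad hc))
    (F := maxIncl P.G 0) (fun _ _ => rfl) 1
  rw [wtGE_maxIdeal_eq_top hc hρ, Submodule.map_top] at h
  exact fun f hf => h ⟨⟨f, hf⟩, rfl⟩

include hc hρ in
/-- Graded equivariant splittings exist. -/
theorem nonempty_splitting [Finite P.W] : Nonempty (P.Splitting ρ) := by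
  obtain ⟨s, hs, hsW, hsρ⟩ := exists_equivariant_section (N := 1) (X := maxIdeal P.G 0)
    (β := maxGrad hc) (β' := cotGrad hc) (r := (maxRep P.G 0).comp fixZero)
    (r' := (cotRep P.G 0).comp fixZero) (T := toCot P.G 0) toCot_surjective (toCot_maxGrad hc)
    (fun _ _ => toCot_maxRep _ _) (fun t w z => rep_gradFix_fixZero hc t w (maxRep P.G 0) z)
    (fun t w z => rep_gradFix_fixZero hc t w (cotRep P.G 0) z) (wtGE_maxIdeal_eq_top hc hρ)
  refine ⟨⟨s, hs, fun n hn f => ?_, ?_⟩⟩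
  · have h1 : n = fixZero ⟨n.1, hn⟩ := rfl
    exact congrArg _ (hsW ⟨n.1, hn⟩ f)
  · rintro n ⟨t, ht⟩ f
    have h1 : n = gradFix hc t⁻¹ := Subtype.ext (Subtype.ext (by
      rw [coe_gradFix, inv_inv, ht]))
    rw [h1]
    exact congrArg _ (hsρ t⁻¹ f)

end NormalPair

end GoodQuotient

/-! ### The quotient of a reflection group by a good subgroup. -/

namespace GoodQuotient

open SymmetricAlgebra

/-- Equations on which a group acts trivially follow from invariant equations. -/
theorem le_fibreIdeal_of_trivial {k A Γ : Type*} [Field k] [CharZero k] [CommRing A] [Algebra k A]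
    [IsNoetherianRing A] [Group Γ] [Finite Γ] {a : Γ →* (A →ₐ[k] A)} {R : Subalgebra k A}
    (hR : IsInv a R) {e : A →ₐ[k] k} (he : ∀ γ f, e (a γ f) = e f) {I : Ideal A}
    (hI : I ≤ RingHom.ker e) (h : ∀ γ, ∀ f ∈ I, a γ f - f ∈ RingHom.ker e * I) :
    I ≤ fibreIdeal R e := by
  have h1 : I ≤ fibreIdeal R e ⊔ RingHom.ker e * I := by
    intro f hf
    have h2 : avg (actRep a) f - f ∈ RingHom.ker e * I :=
      avg_sub_mem (actRep a) ((RingHom.ker e * I).restrictScalars k) fun γ => h γ f hf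
    have h3 : avg (actRep a) f ∈ fibreIdeal R e := by
      refine mem_fibreIdeal_of_mem (avg_mem_of_isInv hR f) ?_
      have h4 : e (avg (actRep a) f - f) = 0 := Ideal.mul_le_left h2
      rw [map_sub, RingHom.mem_ker.1 (hI hf), sub_zero] at h4
      exact h4
    rw [← sub_sub_cancel (avg (actRep a) f) f]
    exact sub_mem (Submodule.mem_sup_left h3) (Submodule.mem_sup_right h2)
  have h5 : ∀ N, I ≤ fibreIdeal R e ⊔ RingHom.ker e ^ N * I := by
    intro N
    induction N with
    | zero => rw [pow_zero, one_mul]; exact le_sup_right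
    | succ N ih =>
      refine ih.trans (sup_le le_sup_left ((Ideal.mul_mono_right h1).trans ?_))
      rw [Ideal.mul_sup, ← mul_assoc, ← pow_succ]
      exact sup_le_sup_right Ideal.mul_le_right _
  obtain ⟨N, hN⟩ := exists_pow_le_map_ptIdeal hR e (q := RingHom.ker e) fun b hb γ => by
    rw [he]; exact hb
  exact (h5 N).trans (sup_le le_rfl (Ideal.mul_le_left.trans hN))

theorem finrank_quotient_le_finrank_range {k A X : Type*} [Field k] [CommRing A] [Algebra k A]
    [AddCommGroup X] [Module k X] [Module.Finite k X] (J : Ideal A) (q : A →ₗ[k] X)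
    (hq : LinearMap.ker q ≤ J.restrictScalars k) :
    Module.finrank k (A ⧸ J) ≤ Module.finrank k (LinearMap.range q) := by
  let π : A →ₗ[k] A ⧸ J := (Ideal.Quotient.mkₐ k J).toLinearMap
  have hπ : LinearMap.ker q ≤ LinearMap.ker π := fun f hf =>
    Ideal.Quotient.eq_zero_iff_mem.2 (hq hf)
  rw [← (q.quotKerEquivRange).finrank_eq]
  have : Module.Finite k (A ⧸ LinearMap.ker q) := Module.Finite.equiv q.quotKerEquivRange.symm
  refine LinearMap.finrank_le_finrank_of_surjective (f := (LinearMap.ker q).liftQ π hπ) fun x => ?_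
  obtain ⟨f, rfl⟩ := Ideal.Quotient.mk_surjective x
  exact ⟨(LinearMap.ker q).mkQ f, rfl⟩

namespace NormalPair

variable {k V : Type*} [Field k] [AddCommGroup V] [Module k V] {P : NormalPair k V}
  {ρ : kˣ →* (V ≃ₗ[k] V)}

namespace Splitting

variable (σ : P.Splitting ρ)

theorem algMap_ι (c : Cot P.G 0) : σ.algMap (ι k _ c) = σ.toInv c := lift_ι_apply _ _

/-- The point of the tangent space given by a point of `V`. -/
def pt (x : V) : SymmetricAlgebra k (Cot P.G 0) →ₐ[k] k :=
  ((evalAt x).comp (invariants P.G).val).comp σ.algMap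

theorem pt_apply (x : V) (f : SymmetricAlgebra k (Cot P.G 0)) :
    σ.pt x f = evalAt x (σ.algMap f : Poly k V) := rfl

theorem pt_ι (x : V) (c : Cot P.G 0) : σ.pt x (ι k _ c) = σ.p x c := by
  rw [pt_apply, algMap_ι]; rfl

theorem pt_zero : σ.pt 0 = algebraMapInv := by
  apply algHom_ext
  ext c
  change σ.pt 0 (ι k _ c) = algebraMapInv (ι k _ c)
  rw [pt_ι, algebraMapInv_ι]
  exact (σ.toLin c).2

theorem algMap_mem_maxIdeal {x : V} {f : SymmetricAlgebra k (Cot P.G 0)} :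
    σ.algMap f ∈ maxIdeal P.G x ↔ σ.pt x f = 0 := Iff.rfl

theorem I_le_ker_pt (x : V) : σ.I ≤ RingHom.ker (σ.pt x) := fun f hf => by
  rw [RingHom.mem_ker, pt_apply, RingHom.mem_ker.1 hf]
  exact map_zero _

/-- The embedding in the tangent space is minimal. -/
theorem I_le_sq : σ.I ≤ P.augIdeal ^ 2 := by
  intro f hf
  have h0 : algebraMapInv f = (0 : k) := by
    rw [← pt_zero]; exact σ.I_le_ker_pt 0 hf
  refine mem_ker_sq_of_differential_eq_zero _ h0 ?_
  set c := differential algebraMapInv f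
  have h1 := sub_first_order_mem algebraMapInv f
  rw [h0, map_zero, sub_zero, algebraMapInv_ι, map_zero, sub_zero] at h1
  -- The linear part `c` of an equation `f` maps to minus its higher order part, which lies in the
  -- square of the maximal ideal; since the splitting is a section, `c = 0`.
  have h2 : (σ.toLin c : invariants P.G) ∈ maxIdeal P.G 0 ^ 2 := by
    have h3 : σ.algMap (f - ι k _ c) ∈ (P.augIdeal ^ 2).map σ.algMap := Ideal.mem_map_of_mem _ h1
    rw [map_sub, RingHom.mem_ker.1 hf, zero_sub, algMap_ι, neg_mem_iff, Ideal.map_pow] at h3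
    refine Ideal.pow_right_mono (Ideal.map_le_iff_le_comap.2 fun g hg => ?_) 2 h3
    change σ.algMap g ∈ maxIdeal P.G 0
    rw [algMap_mem_maxIdeal, pt_zero]
    exact hg
  rw [← σ.section_eq c]
  exact toCot_eq_zero.2 h2

theorem algMap_symAct_mk (w : P.W) (f : SymmetricAlgebra k (Cot P.G 0)) :
    σ.algMap (symAct P.cotRepZero (QuotientGroup.mk w) f)
      = invAct P.G (P.toNorm w) (σ.algMap f) := by
  have : σ.algMap.comp (symAct P.cotRepZero (QuotientGroup.mk w))
      = (invAct P.G (P.toNorm w)).comp σ.algMap := by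
    apply algHom_ext
    ext1 c
    change σ.algMap (symAct P.cotRepZero (QuotientGroup.mk w) (ι k _ c))
      = invAct P.G (P.toNorm w) (σ.algMap (ι k _ c))
    rw [symAct_ι, algMap_ι, algMap_ι]
    exact σ.equivariant (fixZero w) w.2 c
  exact DFunLike.congr_fun this f

theorem coe_algMap_symAct_mk (w : P.W) (f : SymmetricAlgebra k (Cot P.G 0)) :
    (σ.algMap (symAct P.cotRepZero (QuotientGroup.mk w) f) : Poly k V)
      = polyAct (w : V ≃ₗ[k] V) (σ.algMap f : Poly k V) :=
  congrArg _ (σ.algMap_symAct_mk w f)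

theorem pt_symAct_mk (w : P.W) (x : V) (f : SymmetricAlgebra k (Cot P.G 0)) :
    σ.pt x (symAct P.cotRepZero (QuotientGroup.mk w) f)
      = σ.pt ((w : V ≃ₗ[k] V)⁻¹ x) f := by
  rw [pt_apply, coe_algMap_symAct_mk, evalAt_polyAct]; rfl

variable (hc : ∀ w ∈ P.W, ∀ t : kˣ, Commute w (ρ t))

theorem toInv_cotGrad (t : kˣ) (c : Cot P.G 0) :
    σ.toInv (cotGrad hc t c) = invGrad hc t (σ.toInv c) :=
  σ.graded (gradFix hc t) ⟨t⁻¹, (coe_gradFix hc t).symm⟩ c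

theorem algMap_symAct_cotGrad (t : kˣ) (f : SymmetricAlgebra k (Cot P.G 0)) :
    σ.algMap (symAct (cotGrad hc) t f) = invGrad hc t (σ.algMap f) := by
  have : σ.algMap.comp (symAct (cotGrad hc) t) = (invGrad hc t).comp σ.algMap := by
    apply algHom_ext
    ext1 c
    have h1 : σ.algMap (symAct (cotGrad hc) t (ι k _ c)) = σ.algMap (ι k _ (cotGrad hc t c)) :=
      congrArg _ (symAct_ι _ _ _)
    have h2 : σ.algMap (ι k _ (cotGrad hc t c)) = invGrad hc t (σ.algMap (ι k _ c)) :=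
      (σ.algMap_ι _).trans ((σ.toInv_cotGrad hc t c).trans (congrArg _ (σ.algMap_ι c).symm))
    exact h1.trans h2
  exact DFunLike.congr_fun this f

theorem symAct_cotGrad_mem_I (t : kˣ) {f : SymmetricAlgebra k (Cot P.G 0)} (hf : f ∈ σ.I) :
    symAct (cotGrad hc) t f ∈ σ.I := by
  change σ.algMap _ = 0
  rw [algMap_symAct_cotGrad, RingHom.mem_ker.1 hf, map_zero]

theorem symAct_mem_I (γ : P.Quot) {f : SymmetricAlgebra k (Cot P.G 0)} (hf : f ∈ σ.I) :
    symAct P.cotRepZero γ f ∈ σ.I := by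
  obtain ⟨w, rfl⟩ := QuotientGroup.mk_surjective γ
  change σ.algMap _ = 0
  rw [algMap_symAct_mk, RingHom.mem_ker.1 hf, map_zero]

variable [CharZero k] [FiniteDimensional k V] (hρ : IsGrading ρ)

include hc hρ in
/-- A quotient embeds in its tangent space. -/
theorem algMap_surjective : Function.Surjective σ.algMap := by
  rw [← AlgHom.range_eq_top]
  have h1 := maxIdeal_le_wtGE hc hρ
  have h0 := wtGE_invariants_eq_top hc hρ
  refine subalgebra_eq_top_of_graded (R := invariants P.G) (a := invGrad hc)
    (ε := (evalAt 0).comp (invariants P.G).val) h1 h0 ?_ ?_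
  · rintro t _ ⟨f, rfl⟩
    exact ⟨symAct (cotGrad hc) t f, σ.algMap_symAct_cotGrad hc t f⟩
  · intro f hf
    refine ⟨σ.toLin (toCot P.G 0 ⟨f, hf⟩), ⟨ι k _ (toCot P.G 0 ⟨f, hf⟩), σ.algMap_ι _⟩, ?_⟩
    refine (toCot_eq_zero (f := ⟨f, hf⟩ - σ.toLin (toCot P.G 0 ⟨f, hf⟩))).1 ?_
    rw [map_sub]
    exact sub_eq_zero.2 (σ.section_eq _).symm

variable [Finite P.W]

instance finite_G : Finite P.G :=
  Finite.of_injective _ (Subgroup.inclusion_injective P.le)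

-- The quotient is the algebra of `G`-invariants, over which the polynomial functions are integral.
include hc hρ in
theorem ringKrullDim_quotient_I :
    ringKrullDim (SymmetricAlgebra k (Cot P.G 0) ⧸ σ.I) = Module.finrank k V := by
  have hint := isIntegral_of_isInv (isInv_invariants P.G)
  have h := ringKrullDim_eq_of_ringEquiv (RingHom.quotientKerEquivOfSurjective
      (f := (σ.algMap : SymmetricAlgebra k (Cot P.G 0) →+* invariants P.G))
      (σ.algMap_surjective hc hρ))
  refine h.trans ?_
  rw [ringKrullDim_eq_of_isIntegral (S := Poly k V) Subtype.val_injective,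
    ringKrullDim_symmetricAlgebra, Subspace.dual_finrank_eq]

-- An element that acts trivially on the cotangent space acts trivially on the algebra it generates,
-- that is, on all `G`-invariants, and so lies in `G`.
include σ hc hρ in
theorem cotRepZero_injective : Function.Injective P.cotRepZero := by
  rw [injective_iff_map_eq_one]
  intro γ hγ
  obtain ⟨w, rfl⟩ := QuotientGroup.mk_surjective γ
  rw [QuotientGroup.eq_one_iff, Subgroup.mem_subgroupOf]
  refine mem_of_forall_invariants P.G fun f hf => ?_
  obtain ⟨g, hg⟩ := σ.algMap_surjective hc hρ ⟨f, hf⟩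
  have h1 : symAct P.cotRepZero (QuotientGroup.mk w) g = g := by
    have : symAct P.cotRepZero (QuotientGroup.mk w) = AlgHom.id k _ := by
      apply algHom_ext
      ext1 c
      change symAct P.cotRepZero (QuotientGroup.mk w) (ι k _ c) = ι k _ c
      rw [symAct_ι, hγ]; rfl
    rw [this]; rfl
  have h2 := σ.coe_algMap_symAct_mk w g
  rw [h1, hg] at h2
  exact h2.symm

-- With `B` the invariants of `A`, this says that `A / B_+ A` embeds in the zero fibre of `P.W`.
-- Invariants of `P.W` lift to `B` by averaging, contraction from polynomial functions to
-- `G`-invariants loses nothing, and the ambiguity of the lifts lies in `I ⊆ B_+ A`.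
include hc hρ in
theorem mem_fibreIdeal_of_coe_algMap_mem
    (hI : σ.I ≤ fibreIdeal (inv (symAct P.cotRepZero)) algebraMapInv)
    {f : SymmetricAlgebra k (Cot P.G 0)}
    (hf : (σ.algMap f : Poly k V) ∈ fibreIdeal (invariants P.W) (evalAt 0)) :
    f ∈ fibreIdeal (inv (symAct P.cotRepZero)) algebraMapInv := by
  have hB := isInv_inv (symAct P.cotRepZero)
  set J := fibreIdeal (inv (symAct P.cotRepZero)) algebraMapInv with hJ
  have h1 : fibreIdeal (invariants P.W) (evalAt 0)
      ≤ (J.map σ.algMap).map (algebraMap (invariants P.G) (Poly k V)) := by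
    refine Ideal.map_le_iff_le_comap.2 fun c hcc => ?_
    have hcG : (c : Poly k V) ∈ invariants P.G := fun g hg => c.2 g (P.le hg)
    obtain ⟨f₀, hf₀⟩ := σ.algMap_surjective hc hρ ⟨c, hcG⟩
    have h2 : avg (actRep (symAct P.cotRepZero)) f₀ - f₀ ∈ σ.I :=
      avg_sub_mem _ (σ.I.restrictScalars k) fun γ => by
        obtain ⟨w, rfl⟩ := QuotientGroup.mk_surjective γ
        refine RingHom.mem_ker.2 ?_
        rw [map_sub, sub_eq_zero]
        apply Subtype.ext
        rw [actRep_apply, coe_algMap_symAct_mk, hf₀]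
        exact c.2 w w.2
    have h3 : σ.algMap (avg (actRep (symAct P.cotRepZero)) f₀) = ⟨c, hcG⟩ := by
      rw [← hf₀, ← sub_eq_zero, ← map_sub]
      exact h2
    have h4 : avg (actRep (symAct P.cotRepZero)) f₀ ∈ J := by
      refine mem_fibreIdeal_of_mem (avg_mem_of_isInv hB f₀) ?_
      rw [← pt_zero, pt_apply, h3]
      exact hcc
    have h5 := Ideal.mem_map_of_mem (algebraMap (invariants P.G) (Poly k V))
      (Ideal.mem_map_of_mem σ.algMap h4)
    rw [h3] at h5
    exact h5
  have h6 := mem_of_coe_mem_map (isInv_invariants P.G) (h1 hf)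
  obtain ⟨g, hg, hgf⟩ :=
    (Ideal.mem_map_iff_of_surjective σ.algMap (σ.algMap_surjective hc hρ)).1 h6
  rw [← sub_sub_cancel g f]
  refine sub_mem hg (hI (RingHom.mem_ker.2 ?_))
  rw [map_sub, hgf, sub_self]

include hc hρ in
/-- If `G` is good in a reflection group `W`, then `W / G` is a reflection group. -/
theorem isReflectionGroup_cotRepZero (hW : IsReflectionGroup ((natRep k V).comp P.W.subtype))
    (h : ∀ γ : P.Quot, ∀ f ∈ σ.I, symAct P.cotRepZero γ f - f ∈ P.augIdeal * σ.I) :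
    IsReflectionGroup P.cotRepZero := by
  have hB := isInv_inv (symAct P.cotRepZero)
  have hI : σ.I ≤ fibreIdeal (inv (symAct P.cotRepZero)) algebraMapInv := by
    refine le_fibreIdeal_of_trivial hB (algebraMapInv_symAct _) ?_ h
    rw [← pt_zero]
    exact σ.I_le_ker_pt 0
  have hfin := finite_invariants P.W
  have hF1 : Module.finrank k (Poly k V ⧸ fibreIdeal (invariants P.W) (evalAt 0))
      ≤ Nat.card P.W := by
    rw [evalAt_zero]
    refine finrank_fibre_le_of_isReflectionGroup (isReflectionGroup_dual_iff.2 hW) ?_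
    rw [← polyAct_comp_eq_symAct]
    exact isInv_invariants P.W
  -- The classes of `G`-invariants in the zero fibre of `P.W` span at most `[P.W : P.G]` dimensions.
  -- This is the order of the quotient group, exactly the bound the criterion asks for.
  have hL1 := finrank_map_le_index polyAct_comp_subtype_injective (isInv_invariants P.W)
    (evalAt 0) hF1 (isInv_subgroupOf P.le)
  have := finite_quotient_fibreIdeal (R := invariants P.W) (evalAt 0)
  refine isReflectionGroup_of_finrank_le (σ.cotRepZero_injective hc hρ) hB (le_trans ?_ hL1)
  let q : SymmetricAlgebra k (Cot P.G 0) →ₗ[k] Poly k V ⧸ fibreIdeal (invariants P.W) (evalAt 0) :=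
    (Ideal.Quotient.mkₐ k (fibreIdeal (invariants P.W) (evalAt 0))).toLinearMap ∘ₗ
      (invariants P.G).val.toLinearMap ∘ₗ σ.algMap.toLinearMap
  have hq : LinearMap.range q ≤ (invariants P.G).toSubmodule.map
      (Ideal.Quotient.mkₐ k (fibreIdeal (invariants P.W) (evalAt 0))).toLinearMap := by
    rintro _ ⟨f, rfl⟩
    exact ⟨_, (σ.algMap f).2, rfl⟩
  have hq' : LinearMap.ker q
      ≤ (fibreIdeal (inv (symAct P.cotRepZero)) algebraMapInv).restrictScalars k := fun f hf =>
    σ.mem_fibreIdeal_of_coe_algMap_mem hc hρ hI (Ideal.Quotient.eq_zero_iff_mem.1 hf)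
  exact (finrank_quotient_le_finrank_range _ q hq').trans (Submodule.finrank_mono hq)

end Splitting

end NormalPair

end GoodQuotient

/-! ### Invariant equations and the passage from the origin to other points. -/

namespace GoodQuotient

open SymmetricAlgebra

theorem symAct_commute {k M Γ Δ : Type*} [Field k] [AddCommGroup M] [Module k M] [Group Γ]
    [Group Δ] {r : Representation k Γ M} {s : Representation k Δ M}
    (h : ∀ γ δ m, r γ (s δ m) = s δ (r γ m)) (γ : Γ) (δ : Δ) (f : SymmetricAlgebra k M) :
    symAct r γ (symAct s δ f) = symAct s δ (symAct r γ f) := by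
  have : (symAct r γ).comp (symAct s δ) = (symAct s δ).comp (symAct r γ) := by
    apply algHom_ext
    ext m
    change symAct r γ (symAct s δ (ι k _ m)) = symAct s δ (symAct r γ (ι k _ m))
    rw [symAct_ι, symAct_ι, symAct_ι, symAct_ι, h]
  exact DFunLike.congr_fun this f

section InvariantEquations

variable {k A Γ : Type*} [Field k] [CommRing A] [Algebra k A] [Group Γ]
  {a : Γ →* (A →ₐ[k] A)} {I : Ideal A}

/-- For an invariant generator `f`, one has `γ (c f) - c f = (γ c - c) f`, and `γ c - c` vanishes at
any point fixed by `γ`. Invariant generators thus give triviality at every fixed point. -/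
theorem act_sub_mem_of_le_span (hI : I ≤ Ideal.span {f | f ∈ I ∧ ∀ γ, a γ f = f})
    {e : A →ₐ[k] k} {γ : Γ} (he : ∀ f, e (a γ f) = e f) {f : A} (hf : f ∈ I) :
    a γ f - f ∈ RingHom.ker e * I := by
  have h := hI hf
  clear hf
  have key : f ∈ I ∧ a γ f - f ∈ RingHom.ker e * I := by
    induction h using Submodule.span_induction with
    | mem f hf => exact ⟨hf.1, by rw [hf.2, sub_self]; exact zero_mem _⟩
    | zero => exact ⟨zero_mem _, by rw [map_zero, sub_self]; exact zero_mem _⟩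
    | add f g _ _ hf1 hg1 =>
      refine ⟨add_mem hf1.1 hg1.1, ?_⟩
      rw [map_add, add_sub_add_comm]
      exact add_mem hf1.2 hg1.2
    | smul c f _ hf1 =>
      obtain ⟨h1, h2⟩ := hf1
      refine ⟨Ideal.mul_mem_left _ _ h1, ?_⟩
      have h3 : a γ f ∈ I := by
        rw [← sub_add_cancel (a γ f) f]
        exact add_mem (Ideal.mul_le_right h2) h1
      have h4 : a γ (c • f) - c • f = (a γ c - c) * a γ f + c * (a γ f - f) := by
        rw [smul_eq_mul, map_mul]; ring
      rw [h4]
      refine add_mem (Ideal.mul_mem_mul ?_ h3) (Ideal.mul_mem_left _ _ h2)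
      rw [RingHom.mem_ker, map_sub, he, sub_self]
  exact key.2

/-- Each `f` in `I` is congruent modulo `n * I` to its average, an invariant element of `I`; graded
Nakayama concludes. -/
theorem le_span_invariant_of_graded [CharZero k] [Finite Γ] {g : kˣ →* (A →ₐ[k] A)} {n : Ideal A}
    (hn : n.restrictScalars k ≤ wtGE (actRep g) 1) (h0 : wtGE (actRep g) 0 = ⊤)
    (hI : ∀ t, ∀ f ∈ I, g t f ∈ I) (hI' : ∀ γ, ∀ f ∈ I, a γ f ∈ I)
    (hc : ∀ γ t f, a γ (g t f) = g t (a γ f)) (h : ∀ γ, ∀ f ∈ I, a γ f - f ∈ n * I) :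
    I ≤ Ideal.span {f | f ∈ I ∧ ∀ γ, a γ f = f} := by
  refine graded_nakayama hn h0 hI (fun t f hf => ?_) fun f hf => ?_
  · have h1 : Ideal.span {f | f ∈ I ∧ ∀ γ, a γ f = f}
        ≤ (Ideal.span {f | f ∈ I ∧ ∀ γ, a γ f = f}).comap (g t) :=
      Ideal.span_le.2 fun f hf => Ideal.subset_span ⟨hI t f hf.1, fun γ => by
        rw [hc, hf.2]⟩
    exact h1 hf
  · have h1 : avg (actRep a) f - f ∈ n * I :=
      avg_sub_mem (actRep a) ((n * I).restrictScalars k) fun γ => h γ f hf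
    rw [← sub_sub_cancel (avg (actRep a) f) f]
    refine sub_mem (Submodule.mem_sup_left (Ideal.subset_span ⟨?_, fun γ => ?_⟩))
      (Submodule.mem_sup_right h1)
    · exact avg_mem (actRep a) (I.restrictScalars k) fun γ => hI' γ f hf
    · exact avg_invariant (actRep a) γ f

end InvariantEquations

namespace NormalPair

variable {k V : Type*} [Field k] [AddCommGroup V] [Module k V] {P : NormalPair k V}
  {ρ : kˣ →* (V ≃ₗ[k] V)} (hc : ∀ w ∈ P.W, ∀ t : kˣ, Commute w (ρ t))

theorem cotRepZero_cotGrad (γ : P.Quot) (t : kˣ) (c : Cot P.G 0) :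
    P.cotRepZero γ (cotGrad hc t c) = cotGrad hc t (P.cotRepZero γ c) := by
  obtain ⟨w, rfl⟩ := QuotientGroup.mk_surjective γ
  exact (rep_gradFix_fixZero hc t w (cotRep P.G 0) c).symm

include hc in
theorem commute_of_mem_fix {S : Set V} : ∀ w ∈ (P.fix S).W, ∀ t : kˣ, Commute w (ρ t) :=
  fun w hw => hc w hw.1

instance finite_fix_W [Finite P.W] (S : Set V) : Finite (P.fix S).W :=
  Finite.of_injective _ (Subgroup.inclusion_injective (inf_le_left : (P.fix S).W ≤ P.W))

section Infinitesimal

variable [CharZero k] [FiniteDimensional k V] [Finite P.W]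

/-- The quotients by `G` and by the stabilizer of `x` have the same infinitesimal neighbourhoods
of the image of `x`: surjectivity. -/
theorem exists_invIncl_sub_mem (x : V) (g : invariants (P.fix {x}).G) (n : ℕ) :
    ∃ r : invariants P.G, P.invIncl {x} r - g ∈ maxIdeal (P.fix {x}).G x ^ n := by
  obtain ⟨r, hr, h, hrg⟩ := exists_sub_mem_ptIdeal_pow (isInv_invariants P.G)
    (isStab_evalAt P.G x) (isInv_subgroupOf inf_le_left) g n
  exact ⟨⟨r, hr⟩, hrg⟩

/-- The quotients by `G` and by the stabilizer of `x` have the same infinitesimal neighbourhoods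
of the image of `x`: injectivity. -/
theorem exists_mem_maxIdeal_pow (x : V) (n : ℕ) : ∃ m, ∀ r : invariants P.G,
    P.invIncl {x} r ∈ maxIdeal (P.fix {x}).G x ^ m → r ∈ maxIdeal P.G x ^ n := by
  obtain ⟨m, hm⟩ := mem_ptIdeal_pow_of_mem (isInv_invariants P.G) (evalAt x) n
  refine ⟨m, fun r hr => hm r ?_⟩
  have h1 := Ideal.mem_map_of_mem (algebraMap (invariants (P.fix {x}).G) (Poly k V)) hr
  rw [Ideal.map_pow] at h1
  exact Ideal.pow_right_mono (Ideal.map_le_iff_le_comap.2 fun f hf => hf) m h1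

end Infinitesimal

namespace Splitting

variable (σ : P.Splitting ρ) [CharZero k] [FiniteDimensional k V] [Finite P.W]
  (hρ : IsGrading ρ)

include hc hρ in
theorem I_le_span_invariant
    (h : ∀ γ : P.Quot, ∀ f ∈ σ.I, symAct P.cotRepZero γ f - f ∈ P.augIdeal * σ.I) :
    σ.I ≤ Ideal.span {f | f ∈ σ.I ∧ ∀ γ, symAct P.cotRepZero γ f = f} :=
  le_span_invariant_of_graded (g := symAct (cotGrad hc))
    (ker_le_wtGE_one (wtGE_cot_eq_top hc hρ)) (wtGE_zero_eq_top (wtGE_cot_eq_top hc hρ))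
    (fun t _ hf => σ.symAct_cotGrad_mem_I hc t hf) (fun γ _ hf => σ.symAct_mem_I γ hf)
    (fun γ t f => symAct_commute (cotRepZero_cotGrad hc) γ t f) h

-- Goodness only speaks of the origin. Having chosen invariant generators there, one obtains the
-- same triviality at `p(x)` for all elements that fix `x`.
include hc hρ in
theorem symAct_sub_mem_ker_pt_mul
    (h : ∀ γ : P.Quot, ∀ f ∈ σ.I, symAct P.cotRepZero γ f - f ∈ P.augIdeal * σ.I)
    {x : V} {w : P.W} (hw : (w : V ≃ₗ[k] V) x = x) {f : SymmetricAlgebra k (Cot P.G 0)}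
    (hf : f ∈ σ.I) :
    symAct P.cotRepZero (QuotientGroup.mk w) f - f ∈ RingHom.ker (σ.pt x) * σ.I := by
  refine act_sub_mem_of_le_span (σ.I_le_span_invariant hc hρ h) (fun g => ?_) hf
  rw [pt_symAct_mk]
  have h1 : (w : V ≃ₗ[k] V)⁻¹ x = x := (LinearEquiv.symm_apply_eq (w : V ≃ₗ[k] V)).2 hw.symm
  rw [h1]

omit [Finite P.W] in
include hc hρ in
theorem spanFinrank_I_le
    [Module.Finite k ((σ.I.restrictScalars k).map
      (Ideal.Quotient.mkₐ k (P.augIdeal * σ.I)).toLinearMap)] :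
    Submodule.spanFinrank σ.I ≤ Module.finrank k ((σ.I.restrictScalars k).map
      (Ideal.Quotient.mkₐ k (P.augIdeal * σ.I)).toLinearMap) :=
  spanFinrank_le_of_graded (n := P.augIdeal) (a := symAct (cotGrad hc))
    (ker_le_wtGE_one (wtGE_cot_eq_top hc hρ)) (wtGE_zero_eq_top (wtGE_cot_eq_top hc hρ))
    (fun t _ hf => σ.symAct_cotGrad_mem_I hc t hf)

include hc hρ in
theorem finrank_cot_le : Module.finrank k (Cot P.G 0)
    ≤ Submodule.spanFinrank σ.I + Module.finrank k V := by
  have h := finrank_le_dim_add_spanFinrank (I := σ.I) (by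
    rw [← pt_zero]; exact σ.I_le_ker_pt 0)
  rw [σ.ringKrullDim_quotient_I hc hρ] at h
  have h' : ((Module.finrank k (Cot P.G 0) : ℕ) : WithBot ℕ∞)
      ≤ ((Module.finrank k V + Submodule.spanFinrank σ.I : ℕ) : WithBot ℕ∞) := by
    rw [Nat.cast_add]; exact h
  rw [Nat.cast_le] at h'
  omega

-- The Krull dimension in the definition is `dim V`, so the complete intersection condition becomes
-- an equality of natural numbers.
include hc hρ in
theorem isGood_iff : σ.IsGood ↔
    Submodule.spanFinrank σ.I + Module.finrank k V = Module.finrank k (Cot P.G 0) ∧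
    ∀ γ : P.Quot, ∀ f ∈ σ.I, symAct P.cotRepZero γ f - f ∈ P.augIdeal * σ.I := by
  refine and_congr_left fun _ => ?_
  rw [σ.ringKrullDim_quotient_I hc hρ, Subspace.dual_finrank_eq, ← Nat.cast_add, Nat.cast_inj]

end Splitting

end NormalPair

end GoodQuotient

/-! ### Goodness of the stabilizer of a point. -/

namespace GoodQuotient

open SymmetricAlgebra

namespace NormalPair

variable {k V : Type*} [Field k] [AddCommGroup V] [Module k V] {P : NormalPair k V}
  {ρ : kˣ →* (V ≃ₗ[k] V)}

theorem fix_G_apply (x : V) : ∀ g ∈ (P.fix {x}).G, g x = x := fun g hg =>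
  P.fix_apply (Set.mem_singleton x) g ((P.fix {x}).le hg)

variable (P) in
/-- The map from the stabilizer of a point to the quotient group. -/
def fixQuot (S : Set V) : (P.fix S).W →* P.Quot :=
  (QuotientGroup.mk' _).comp (Subgroup.inclusion (inf_le_left : (P.fix S).W ≤ P.W))

namespace Splitting

variable (σ : P.Splitting ρ) {x : V} (τ : (P.fix {x}).Splitting ρ)

/-- The morphism from the quotient by the stabilizer of a point to the tangent space. -/
def localMap (x : V) : SymmetricAlgebra k (Cot P.G 0) →ₐ[k] invariants (P.fix {x}).G :=
  (P.invIncl {x}).comp σ.algMap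

theorem coe_localMap (x : V) (f : SymmetricAlgebra k (Cot P.G 0)) :
    (σ.localMap x f : Poly k V) = σ.algMap f := rfl

theorem ker_localMap (x : V) : RingHom.ker (σ.localMap x) = σ.I := by
  ext f
  rw [RingHom.mem_ker, I, RingHom.mem_ker]
  constructor
  · intro h
    apply Subtype.ext
    have := congrArg (Subtype.val) h
    exact this
  · intro h
    apply Subtype.ext
    rw [coe_localMap, h]; rfl

theorem localMap_mem_maxIdeal (x : V) (f : SymmetricAlgebra k (Cot P.G 0)) :
    σ.localMap x f ∈ maxIdeal (P.fix {x}).G x ↔ σ.pt x f = 0 := Iff.rfl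

/-- The embedding of the quotient by the stabilizer of a point `x`, translated in such a way that
the image of `x` is sent to the origin. -/
def centredMap : SymmetricAlgebra k (Cot (P.fix {x}).G 0) →ₐ[k] invariants (P.fix {x}).G :=
  (translInv (neg_fixed (fix_G_apply x))).comp τ.algMap

theorem coe_centredMap (f : SymmetricAlgebra k (Cot (P.fix {x}).G 0)) :
    (centredMap τ f : Poly k V) = transl (-x) (τ.algMap f : Poly k V) := rfl

theorem ker_centredMap : RingHom.ker (centredMap τ) = τ.I := by
  ext f
  rw [RingHom.mem_ker, I, RingHom.mem_ker]
  constructor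
  · intro h
    have h1 := translInv_translInv_neg (fix_G_apply x) (τ.algMap f)
    rw [← h1]
    exact (congrArg (translInv (fix_G_apply x)) h).trans (map_zero _)
  · intro h
    exact (congrArg (translInv (neg_fixed (fix_G_apply x))) h).trans (map_zero _)

theorem centredMap_mem_maxIdeal (f : SymmetricAlgebra k (Cot (P.fix {x}).G 0)) :
    centredMap τ f ∈ maxIdeal (P.fix {x}).G x ↔ algebraMapInv f = (0 : k) := by
  rw [← pt_zero τ]
  exact translInv_neg_mem (fix_G_apply x)

variable [CharZero k] [FiniteDimensional k V] [Finite P.W] (hρ : IsGrading ρ)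
  (hc : ∀ w ∈ P.W, ∀ t : kˣ, Commute w (ρ t))

omit [Finite P.W] in
include hc hρ in
theorem centredMap_surjective : Function.Surjective (centredMap τ) := by
  intro f
  obtain ⟨g, hg⟩ := τ.algMap_surjective (commute_of_mem_fix hc) hρ (translInv (fix_G_apply x) f)
  refine ⟨g, ?_⟩
  exact (congrArg (translInv (neg_fixed (fix_G_apply x))) hg).trans
    (translInv_neg_translInv (fix_G_apply x) f)

include hc hρ in
theorem exists_sub_localMap_mem (f : invariants (P.fix {x}).G)
    (hf : f ∈ maxIdeal (P.fix {x}).G x) :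
    ∃ g, σ.pt x g = 0 ∧ f - σ.localMap x g ∈ maxIdeal (P.fix {x}).G x ^ 2 := by
  obtain ⟨r, hr⟩ := exists_invIncl_sub_mem x f 2
  obtain ⟨g, rfl⟩ := σ.algMap_surjective hc hρ r
  have h1 : f - σ.localMap x g ∈ maxIdeal (P.fix {x}).G x ^ 2 := by
    rw [← neg_mem_iff, neg_sub]
    exact hr
  refine ⟨g, ?_, h1⟩
  rw [← localMap_mem_maxIdeal, ← sub_sub_cancel f (σ.localMap x g)]
  exact sub_mem hf (Ideal.pow_le_self two_ne_zero h1)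

include hc hρ in
theorem exists_mem_sup_of_localMap_mem (x : V) (n : ℕ) : ∃ m, ∀ f,
    σ.localMap x f ∈ maxIdeal (P.fix {x}).G x ^ m →
      f ∈ RingHom.ker (σ.localMap x) ⊔ RingHom.ker (σ.pt x) ^ n := by
  obtain ⟨m, hm⟩ := exists_mem_maxIdeal_pow (P := P) x n
  refine ⟨m, fun f hf => ?_⟩
  have h1 := hm (σ.algMap f) hf
  have h2 : maxIdeal P.G x ≤ (RingHom.ker (σ.pt x)).map σ.algMap := by
    intro r hr
    obtain ⟨g, rfl⟩ := σ.algMap_surjective hc hρ r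
    exact Ideal.mem_map_of_mem _ hr
  have h3 := Ideal.pow_right_mono h2 n h1
  rw [← Ideal.map_pow] at h3
  obtain ⟨g, hg, hgf⟩ := (Ideal.mem_map_iff_of_surjective _ (σ.algMap_surjective hc hρ)).1 h3
  rw [← sub_add_cancel f g, ker_localMap]
  refine Submodule.add_mem_sup (RingHom.mem_ker.2 ?_) hg
  rw [map_sub, hgf, sub_self]

omit [CharZero k] [FiniteDimensional k V] [Finite P.W] in
theorem localMap_symAct (w : (P.fix {x}).W) (f : SymmetricAlgebra k (Cot P.G 0)) :
    σ.localMap x (symAct (P.cotRepZero.comp (P.fixQuot {x})) w f)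
      = invAct (P.fix {x}).G ((P.fix {x}).toNorm w) (σ.localMap x f) :=
  Subtype.ext (σ.coe_algMap_symAct_mk ⟨w, w.2.1⟩ f)

omit [CharZero k] [FiniteDimensional k V] [Finite P.W] in
theorem centredMap_symAct (w : (P.fix {x}).W)
    (f : SymmetricAlgebra k (Cot (P.fix {x}).G 0)) :
    centredMap τ (symAct ((P.fix {x}).cotRepZero.comp (QuotientGroup.mk' _)) w f)
      = invAct (P.fix {x}).G ((P.fix {x}).toNorm w) (centredMap τ f) := by
  apply Subtype.ext
  rw [coe_centredMap]
  have h3 : (w : V ≃ₗ[k] V) (-x) = -x := by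
    rw [map_neg, P.fix_apply (Set.mem_singleton x) w w.2]
  exact (congrArg (transl (-x)) (τ.coe_algMap_symAct_mk w f)).trans (transl_polyAct h3 _)

include hc hρ in
/-- The equations of the quotient by the stabilizer of a point, compared with the equations of
the quotient by `G`. -/
theorem equations_fix
    (h : ∀ γ : P.Quot, ∀ f ∈ σ.I, symAct P.cotRepZero γ f - f ∈ P.augIdeal * σ.I) :
    (∀ (w : (P.fix {x}).W), ∀ f ∈ τ.I, symAct ((P.fix {x}).cotRepZero.comp
      (QuotientGroup.mk' _)) w f - f ∈ (P.fix {x}).augIdeal * τ.I) ∧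
    Module.Finite k ((τ.I.restrictScalars k).map
      (Ideal.Quotient.mkₐ k ((P.fix {x}).augIdeal * τ.I)).toLinearMap) ∧
    Module.finrank k ((τ.I.restrictScalars k).map
      (Ideal.Quotient.mkₐ k ((P.fix {x}).augIdeal * τ.I)).toLinearMap)
        + Module.finrank k (Cot P.G 0)
      ≤ Submodule.spanFinrank σ.I + Module.finrank k (Cot (P.fix {x}).G 0) := by
  have h1 : ∀ w, ∀ f ∈ RingHom.ker (σ.localMap x),
      symAct (P.cotRepZero.comp (P.fixQuot {x})) w f - f
        ∈ RingHom.ker (σ.pt x) * RingHom.ker (σ.localMap x) := fun w f hf => by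
    rw [ker_localMap] at hf ⊢
    exact σ.symAct_sub_mem_ker_pt_mul hc hρ h (w := ⟨w, w.2.1⟩)
      (P.fix_apply (Set.mem_singleton x) w w.2) hf
  have h2 : RingHom.ker (centredMap τ) ≤ RingHom.ker (algebraMapInv :
      SymmetricAlgebra k (Cot (P.fix {x}).G 0) →ₐ[k] k) ^ 2 := by
    rw [ker_centredMap]; exact τ.I_le_sq
  -- The first presentation, `localMap`, need not be surjective; it is only so to every finite order
  -- at `x`, which is what `transfer` asks. The second is surjective and minimal.
  have ht := transfer (c := (invAct (P.fix {x}).G).comp (P.fix {x}).toNorm)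
    (centredMap_surjective τ hρ hc) σ.localMap_symAct (centredMap_symAct τ)
    (σ.localMap_mem_maxIdeal x) (centredMap_mem_maxIdeal τ) h2
    (σ.exists_sub_localMap_mem hρ hc) (σ.exists_mem_sup_of_localMap_mem hρ hc x) h1
  rw [ker_centredMap, ker_localMap] at ht
  exact ht

include hc hρ in
/-- Goodness passes to the stabilizers of points. -/
theorem isGood_fix (hgood : σ.IsGood) : τ.IsGood := by
  have hc' := commute_of_mem_fix (P := P) (S := {x}) hc
  obtain ⟨h1, h2⟩ := (σ.isGood_iff hc hρ).1 hgood
  obtain ⟨h3, h4, h5⟩ := σ.equations_fix τ hρ hc h2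
  have h6 := τ.spanFinrank_I_le hc' hρ
  have h7 := τ.finrank_cot_le hc' hρ
  rw [τ.isGood_iff hc' hρ]
  -- Combining `h1`, `h5` and `h6` bounds the number of equations from above by the codimension;
  -- `h7` is the bound from below.
  refine ⟨by omega, fun γ f hf => ?_⟩
  obtain ⟨w, rfl⟩ := QuotientGroup.mk_surjective γ
  exact h3 w f hf

end Splitting

end NormalPair

end GoodQuotient

namespace GoodQuotient

open SymmetricAlgebra

/-! ### Comparison of reflections -/

section CompareReflections

variable {k Γ Γ' M M' : Type*} [Field k] [CharZero k] [Group Γ] [Group Γ'] [Finite Γ]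
  [AddCommGroup M] [Module k M] [AddCommGroup M'] [Module k M']
  {r : Representation k Γ M} {r' : Representation k Γ' M'}

/-- If `γ u = u + v` with `v` fixed, then `γ ^ n u = u + n v`; taking for `n` the order of `γ` gives
`v = 0` in characteristic zero. -/
theorem eq_zero_of_fixed_of_mem_range {γ : Γ} {v : M} (hv : r γ v = v)
    (h : v ∈ LinearMap.range (r γ - 1)) : v = 0 := by
  obtain ⟨u, rfl⟩ := h
  set v := (r γ - 1) u with hvdef
  have h1 : r γ u = u + v := by
    rw [hvdef, LinearMap.sub_apply, Module.End.one_apply, add_sub_cancel]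
  have h2 : ∀ n : ℕ, r (γ ^ n) u = u + n • v := by
    intro n
    induction n with
    | zero => simp
    | succ n ih =>
      rw [pow_succ', map_mul, Module.End.mul_apply, ih, map_add, map_nsmul, h1, hv, add_assoc,
        ← succ_nsmul']
  have h3 := h2 (orderOf γ)
  rw [pow_orderOf_eq_one, map_one, Module.End.one_apply, left_eq_add,
    ← Nat.cast_smul_eq_nsmul k] at h3
  exact (smul_eq_zero.1 h3).resolve_left (Nat.cast_ne_zero.2 (orderOf_pos γ).ne')

variable [FiniteDimensional k M] [FiniteDimensional k M']

/-- A surjective map whose kernel is fixed preserves and detects reflections. -/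
theorem isReflection_iff_of_surjective [Finite Γ'] {γ : Γ} {γ' : Γ'} {F : M →ₗ[k] M'}
    (hF : Function.Surjective F) (hγ : ∀ m, F (r γ m) = r' γ' (F m))
    (hker : ∀ m, F m = 0 → r γ m = m) : IsReflection (r γ) ↔ IsReflection (r' γ') := by
  have h1 : Module.finrank k (LinearMap.range (r γ - 1))
      = Module.finrank k (LinearMap.range (r' γ' - 1)) := by
    have h2 : (LinearMap.range (r γ - 1)).map F = LinearMap.range (r' γ' - 1) := by
      have h3 : F ∘ₗ (r γ - 1) = (r' γ' - 1) ∘ₗ F := by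
        ext m
        simp [hγ]
      rw [← LinearMap.range_comp, h3, LinearMap.range_comp, LinearMap.range_eq_top.2 hF,
        Submodule.map_top]
    -- `F` is injective on the image of `r γ - 1`: a vector of this image killed by `F` is fixed by
    -- `γ`, hence zero.
    rw [← h2]
    rw [← LinearMap.range_domRestrict]
    refine (LinearMap.finrank_range_of_inj ?_).symm
    rw [injective_iff_map_eq_zero]
    rintro ⟨v, hv⟩ h3
    exact Subtype.ext (eq_zero_of_fixed_of_mem_range (hker v h3) hv)
  have h4 := LinearMap.finrank_range_add_finrank_ker (r γ - 1)
  have h5 := LinearMap.finrank_range_add_finrank_ker (r' γ' - 1)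
  rw [isReflection_iff, isReflection_iff]
  omega

omit [CharZero k] [Finite Γ] [FiniteDimensional k M] [FiniteDimensional k M'] in
theorem isReflectionIso_of_iff (e : Γ ≃* Γ') (hr : IsReflectionGroup r)
    (hr' : Function.Injective r') (h : ∀ γ, IsReflection (r γ) ↔ IsReflection (r' (e γ))) :
    IsReflectionIso r r' e := by
  refine ⟨hr, ⟨hr', ?_⟩, fun γ hγ => Or.inr ((h γ).1 hγ), fun γ hγ => Or.inr ((h _).2 ?_)⟩
  · have h1 : {γ' : Γ' | IsReflection (r' γ')} = e '' {γ : Γ | IsReflection (r γ)} := by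
      ext γ'
      constructor
      · intro hγ'
        refine ⟨e.symm γ', (h _).2 ?_, e.apply_symm_apply γ'⟩
        rw [e.apply_symm_apply]
        exact hγ'
      · rintro ⟨γ, hγ, rfl⟩
        exact (h γ).1 hγ
    rw [h1]
    have h2 := (MonoidHom.map_closure e.toMonoidHom {γ : Γ | IsReflection (r γ)}).symm
    refine h2.trans ?_
    rw [hr.2, ← MonoidHom.range_eq_map, MonoidHom.range_eq_top]
    exact e.surjective
  · change IsReflection (r' (e (e.symm γ)))
    rw [e.apply_symm_apply]
    exact hγ

end CompareReflections

theorem differential_symAct {k Γ M : Type*} [Field k] [Group Γ] [AddCommGroup M] [Module k M]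
    {r : Representation k Γ M} {e : SymmetricAlgebra k M →ₐ[k] k} {γ : Γ}
    (he : ∀ f, e (symAct r γ f) = e f) (f : SymmetricAlgebra k M) :
    differential e (symAct r γ f) = r γ (differential e f) := by
  induction f using SymmetricAlgebra.induction with
  | algebraMap c => rw [AlgHom.commutes, differential_algebraMap, map_zero]
  | ι m => rw [symAct_ι, differential_ι, differential_ι]
  | add f g hf hg => rw [map_add, map_add, map_add, map_add, hf, hg]
  | mul f g hf hg =>
    rw [map_mul, differential_mul, differential_mul, he, he, hf, hg, map_add, map_smul, map_smul]

namespace NormalPair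

variable {k V : Type*} [Field k] [AddCommGroup V] [Module k V] {P : NormalPair k V}
  {ρ : kˣ →* (V ≃ₗ[k] V)}

theorem fixMap_mk {S : Set V} (w : (P.fix S).W) :
    P.fixMap S (QuotientGroup.mk w) = QuotientGroup.mk (⟨w, w.2.1⟩ : P.W) := rfl

theorem fixMap_injective (S : Set V) : Function.Injective (P.fixMap S) := by
  rw [injective_iff_map_eq_one]
  intro γ hγ
  obtain ⟨w, rfl⟩ := QuotientGroup.mk_surjective γ
  rw [fixMap_mk, QuotientGroup.eq_one_iff] at hγ
  rw [QuotientGroup.eq_one_iff]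
  exact ⟨hγ, w.2.2⟩

theorem eq_of_W_eq_of_G_eq {Q : NormalPair k V} (h : P.W = Q.W) (h' : P.G = Q.G) : P = Q := by
  cases P
  cases Q
  obtain rfl : _ = _ := h
  obtain rfl : _ = _ := h'
  rfl

/-- The stabilizer of a subspace is the stabilizer of some point of the subspace. -/
theorem exists_fix_singleton_eq [CharZero k] [Finite P.W] (L : Submodule k V) :
    ∃ x ∈ L, P.fix {x} = P.fix (L : Set V) := by
  obtain ⟨x, hx⟩ : ∃ x : L, ∀ w : P.W, (w : V ≃ₗ[k] V) x = x →
      ∀ y ∈ L, (w : V ≃ₗ[k] V) y = y := by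
    -- Otherwise `L` would be the union of the fixed subspaces of the finitely many elements of
    -- `P.W` that do not fix `L` pointwise.
    by_contra! hcon
    let T := {w : P.W // ∃ y ∈ L, (w : V ≃ₗ[k] V) y ≠ y}
    have h1 : ⋃ w : T, (LinearMap.ker (((w.1 : V ≃ₗ[k] V).toLinearMap - LinearMap.id) ∘ₗ L.subtype)
        : Set L) = Set.univ := by
      refine Set.eq_univ_of_forall fun x => ?_
      obtain ⟨w, hw, y, hy, hwy⟩ := hcon x
      exact Set.mem_iUnion.2 ⟨⟨w, y, hy, hwy⟩, sub_eq_zero.2 hw⟩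
    obtain ⟨⟨w, y, hy, hwy⟩, hw⟩ := Subspace.exists_eq_top_of_iUnion_eq_univ h1
    have h2 := LinearMap.mem_ker.1 (hw ▸ Submodule.mem_top : (⟨y, hy⟩ : L) ∈ LinearMap.ker _)
    exact hwy (sub_eq_zero.1 h2)
  have key : ∀ w ∈ P.W, w ∈ fixingSubgroup (V ≃ₗ[k] V) ({(x : V)} : Set V) ↔
      w ∈ fixingSubgroup (V ≃ₗ[k] V) (L : Set V) := by
    intro w hw
    rw [mem_fixingSubgroup_iff, mem_fixingSubgroup_iff]
    constructor
    · intro h y hy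
      exact hx ⟨w, hw⟩ (h x rfl) y hy
    · intro h y hy
      rw [Set.mem_singleton_iff.1 hy]
      exact h x x.2
  refine ⟨x, x.2, eq_of_W_eq_of_G_eq ?_ ?_⟩
  · ext w
    exact and_congr_right fun hw => key w hw
  · ext w
    exact and_congr_right fun hw => key w (P.le hw)

namespace Splitting

variable (σ : P.Splitting ρ)

theorem p_apply (x : V) (c : Cot P.G 0) : σ.p x c = evalAt x (σ.toInv c : Poly k V) := rfl

theorem toInv_cotRepZero (w : P.W) (c : Cot P.G 0) :
    (σ.toInv (P.cotRepZero (QuotientGroup.mk w) c) : Poly k V)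
      = polyAct (w : V ≃ₗ[k] V) (σ.toInv c : Poly k V) :=
  congrArg _ (σ.equivariant (fixZero w) w.2 c)

theorem tangentRepZero_p (w : P.W) (x : V) :
    P.tangentRepZero (QuotientGroup.mk w) (σ.p x) = σ.p ((w : V ≃ₗ[k] V) x) := by
  ext1 c
  change σ.p x (P.cotRepZero (QuotientGroup.mk w)⁻¹ c) = _
  rw [← QuotientGroup.mk_inv, p_apply, toInv_cotRepZero, evalAt_polyAct, p_apply]
  rw [InvMemClass.coe_inv, inv_inv]

theorem fixMap_mem_quotStab (S : Set V) (γ : (P.fix S).Quot) :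
    P.fixMap S γ ∈ P.quotStab (σ.p '' S) := by
  obtain ⟨w, rfl⟩ := QuotientGroup.mk_surjective γ
  rintro _ ⟨x, hx, rfl⟩
  rw [fixMap_mk, tangentRepZero_p, P.fix_apply hx w w.2]

/-- The map from `W_S / G_S` to the stabilizer of the image of `S`. -/
def toQuotStab (S : Set V) : (P.fix S).Quot →* P.quotStab (σ.p '' S) :=
  (P.fixMap S).codRestrict _ (σ.fixMap_mem_quotStab S)

theorem pt_eq_of_p_eq {x y : V} (h : σ.p x = σ.p y) : σ.pt x = σ.pt y := by
  apply algHom_ext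
  ext c
  change σ.pt x (ι k _ c) = σ.pt y (ι k _ c)
  rw [pt_ι, pt_ι, h]

variable [CharZero k] [FiniteDimensional k V] [Finite P.W] (hρ : IsGrading ρ)
  (hc : ∀ w ∈ P.W, ∀ t : kˣ, Commute w (ρ t))

-- If `w` fixes `p(x)`, then all `G`-invariants agree at `w x` and `x`, so `w x = g x` for some `g`
-- in `G`, and `g⁻¹ w` is a representative of the same class that fixes `x`.
include hc hρ in
theorem exists_mk_eq_of_mem_quotStab {x : V} {γ : P.Quot}
    (hγ : P.tangentRepZero γ (σ.p x) = σ.p x) :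
    ∃ w : P.W, (w : V ≃ₗ[k] V) x = x ∧ QuotientGroup.mk w = γ := by
  obtain ⟨w, rfl⟩ := QuotientGroup.mk_surjective γ
  rw [tangentRepZero_p] at hγ
  obtain ⟨g, hg, hgx⟩ := exists_apply_eq_of_evalAt_eq P.G (x := x) (y := (w : V ≃ₗ[k] V) x)
    fun f hf => by
      obtain ⟨f', hf'⟩ := σ.algMap_surjective hc hρ ⟨f, hf⟩
      have h1 := DFunLike.congr_fun (σ.pt_eq_of_p_eq hγ) f'
      rw [pt_apply, pt_apply, hf'] at h1
      exact h1
  have hgn : (⟨g, P.le hg⟩ : P.W) ∈ P.G.subgroupOf P.W := hg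
  refine ⟨⟨g, P.le hg⟩⁻¹ * w, ?_, ?_⟩
  · change g.symm ((w : V ≃ₗ[k] V) x) = x
    rw [← hgx, g.symm_apply_apply]
  · rw [QuotientGroup.mk_mul, QuotientGroup.mk_inv, (QuotientGroup.eq_one_iff _).2 hgn, inv_one,
      one_mul]

end Splitting

end NormalPair

end GoodQuotient

/-! ### The differential of `p` and the correspondence of reflections. -/

namespace GoodQuotient

open SymmetricAlgebra

namespace NormalPair

variable {k V : Type*} [Field k] [AddCommGroup V] [Module k V] {P : NormalPair k V}
  {ρ : kˣ →* (V ≃ₗ[k] V)}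

section Square

variable [CharZero k] [FiniteDimensional k V] [Finite P.W]

/-- Factors in the maximal ideal of `G_x`-invariants are approximated to high order by
`G`-invariants vanishing at `x`, so `r` differs from an element of the wanted square by a
`G`-invariant of high order at `x`, which lies in the square as well. -/
theorem mem_maxIdeal_sq_of_invIncl {x : V} {r : invariants P.G}
    (hr : P.invIncl {x} r ∈ maxIdeal (P.fix {x}).G x ^ 2) : r ∈ maxIdeal P.G x ^ 2 := by
  obtain ⟨m, hm⟩ := exists_mem_maxIdeal_pow (P := P) x 2
  have key : ∀ g ∈ maxIdeal (P.fix {x}).G x ^ 2, ∃ r ∈ maxIdeal P.G x ^ 2,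
      P.invIncl {x} r - g ∈ maxIdeal (P.fix {x}).G x ^ (m + 1) := by
    intro g hg
    rw [pow_two] at hg
    have happrox : ∀ g ∈ maxIdeal (P.fix {x}).G x, ∃ r ∈ maxIdeal P.G x,
        P.invIncl {x} r - g ∈ maxIdeal (P.fix {x}).G x ^ (m + 1) := by
      intro g hg
      obtain ⟨r, hr⟩ := exists_invIncl_sub_mem x g (m + 1)
      refine ⟨r, ?_, hr⟩
      have h1 : P.invIncl {x} r ∈ maxIdeal (P.fix {x}).G x := by
        rw [← sub_add_cancel (P.invIncl {x} r) g]
        exact add_mem (Ideal.pow_le_self (Nat.succ_ne_zero m) hr) hg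
      exact h1
    refine Submodule.mul_induction_on hg (fun a ha b hb => ?_) fun a b ha hb => ?_
    · obtain ⟨r, hr, hra⟩ := happrox a ha
      obtain ⟨s, hs, hsb⟩ := happrox b hb
      refine ⟨r * s, by rw [pow_two]; exact Ideal.mul_mem_mul hr hs, ?_⟩
      have h1 : P.invIncl {x} (r * s) - a * b
          = (P.invIncl {x} r - a) * P.invIncl {x} s + a * (P.invIncl {x} s - b) := by
        rw [map_mul]; ring
      rw [h1]
      exact add_mem (Ideal.mul_mem_right _ _ hra) (Ideal.mul_mem_left _ _ hsb)
    · obtain ⟨r, hr, hra⟩ := ha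
      obtain ⟨s, hs, hsb⟩ := hb
      refine ⟨r + s, add_mem hr hs, ?_⟩
      rw [map_add, add_sub_add_comm]
      exact add_mem hra hsb
  obtain ⟨s, hs, hrs⟩ := key _ hr
  rw [← sub_sub_cancel s r]
  refine sub_mem hs (hm _ ?_)
  rw [map_sub]
  exact Ideal.pow_le_pow_right (Nat.le_succ m) hrs

end Square

namespace Splitting

variable (σ : P.Splitting ρ) {x : V}

theorem localMap_ι_sub_mem (x : V) (c : Cot P.G 0) :
    σ.localMap x (ι k _ c - algebraMap k _ (σ.p x c)) ∈ maxIdeal (P.fix {x}).G x := by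
  rw [localMap_mem_maxIdeal, map_sub, pt_ι, AlgHom.commutes]
  exact sub_self _

theorem cotangentMap_apply (x : V) (c : Cot P.G 0) :
    σ.cotangentMap x c = toCot (P.fix {x}).G x
      ⟨σ.localMap x (ι k _ c - algebraMap k _ (σ.p x c)), σ.localMap_ι_sub_mem x c⟩ := by
  refine congrArg (toCot (P.fix {x}).G x) (Subtype.ext ?_)
  change P.invIncl {x} (σ.toInv c) - algebraMap k _ (σ.p x c)
    = P.invIncl {x} (σ.algMap (ι k _ c - algebraMap k _ (σ.p x c)))
  rw [map_sub, algMap_ι, map_sub, AlgHom.commutes, AlgHom.commutes]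

/-- The map on cotangent spaces is equivariant. -/
theorem cotangentMap_cotRepZero (x : V) (γ : (P.fix {x}).Quot) (c : Cot P.G 0) :
    σ.cotangentMap x (P.cotRepZero (P.fixMap {x} γ) c)
      = (P.fix {x}).quotCotRep x (P.fix_apply (Set.mem_singleton x)) γ (σ.cotangentMap x c) := by
  obtain ⟨w, rfl⟩ := QuotientGroup.mk_surjective γ
  rw [fixMap_mk, (P.fix {x}).quotCotRep_mk x _ w, cotangentMap_apply, cotangentMap_apply,
    ← toCot_maxRep]
  refine congrArg (toCot (P.fix {x}).G x) (Subtype.ext (Subtype.ext ?_))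
  have hp : σ.p x (P.cotRepZero (QuotientGroup.mk (⟨w, w.2.1⟩ : P.W)) c) = σ.p x c := by
    rw [p_apply, toInv_cotRepZero, evalAt_polyAct, p_apply]
    have h1 : (w : V ≃ₗ[k] V)⁻¹ x = x :=
      P.fix_apply (Set.mem_singleton x) _ ((P.fix {x}).W.inv_mem w.2)
    exact congrArg (fun y => evalAt y (σ.toInv c : Poly k V)) h1
  have h2 := σ.coe_algMap_symAct_mk ⟨w, w.2.1⟩ (ι k _ c - algebraMap k _ (σ.p x c))
  rw [map_sub (symAct P.cotRepZero _), symAct_ι, AlgHom.commutes] at h2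
  refine Eq.trans ?_ h2
  exact congrArg (fun s => (σ.algMap (ι k _ (P.cotRepZero (QuotientGroup.mk (⟨w, w.2.1⟩ : P.W)) c)
    - algebraMap k _ s) : Poly k V)) hp

variable [CharZero k] [FiniteDimensional k V] [Finite P.W] (hρ : IsGrading ρ)
  (hc : ∀ w ∈ P.W, ∀ t : kˣ, Commute w (ρ t))

-- A function on `V/G_x` is, to second order at `x`, the restriction of a polynomial on the ambient
-- tangent space, and only the differential of that polynomial matters.
include hc hρ in
theorem cotangentMap_surjective (x : V) : Function.Surjective (σ.cotangentMap x) := by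
  intro f
  obtain ⟨f, rfl⟩ := toCot_surjective f
  obtain ⟨g, hg, hgf⟩ := σ.exists_sub_localMap_mem (x := x) hρ hc f f.2
  have h1 := sub_first_order_mem (σ.pt x) g
  set c := differential (σ.pt x) g
  refine ⟨c, ?_⟩
  rw [hg, map_zero, sub_zero, pt_ι] at h1
  rw [cotangentMap_apply, ← sub_eq_zero, ← map_sub, toCot_eq_zero]
  have h2 : σ.localMap x (g - (ι k _ c - algebraMap k _ (σ.p x c)))
      ∈ maxIdeal (P.fix {x}).G x ^ 2 := by
    have h3 := Ideal.mem_map_of_mem (σ.localMap x) h1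
    rw [Ideal.map_pow] at h3
    have h4 : (RingHom.ker (σ.pt x)).map (σ.localMap x) ≤ maxIdeal (P.fix {x}).G x :=
      Ideal.map_le_iff_le_comap.2 fun q hq => hq
    exact Ideal.pow_right_mono h4 2 h3
  rw [map_sub] at h2
  rw [← neg_mem_iff]
  convert add_mem hgf h2 using 1
  change -(σ.localMap x (ι k _ c - algebraMap k _ (σ.p x c)) - (f : invariants (P.fix {x}).G)) = _
  ring

include hc hρ in
/-- The directions normal to the stratum of a point are fixed by the stabilizer of the point. -/
theorem cotRepZero_apply_of_cotangentMap_eq_zero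
    (h : ∀ γ : P.Quot, ∀ f ∈ σ.I, symAct P.cotRepZero γ f - f ∈ P.augIdeal * σ.I)
    {c : Cot P.G 0} (hc0 : σ.cotangentMap x c = 0) (γ : (P.fix {x}).Quot) :
    P.cotRepZero (P.fixMap {x} γ) c = c := by
  obtain ⟨w, rfl⟩ := QuotientGroup.mk_surjective γ
  have hwx := P.fix_apply (Set.mem_singleton x) w w.2
  rw [fixMap_mk]
  rw [cotangentMap_apply, toCot_eq_zero] at hc0
  have h1 := mem_maxIdeal_sq_of_invIncl hc0
  have h2 : maxIdeal P.G x ≤ (RingHom.ker (σ.pt x)).map σ.algMap := by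
    intro r hr
    obtain ⟨g, rfl⟩ := σ.algMap_surjective hc hρ r
    exact Ideal.mem_map_of_mem _ hr
  have h3 := Ideal.pow_right_mono h2 2 h1
  rw [← Ideal.map_pow] at h3
  obtain ⟨q, hq, hqc⟩ := (Ideal.mem_map_iff_of_surjective _ (σ.algMap_surjective hc hρ)).1 h3
  -- A cotangent vector that dies on `V/G_x` is the differential at `p(x)` of an equation: the
  -- centred linear form of `c` agrees on `V/G` with some `q` of order two.
  set f := ι k _ c - algebraMap k _ (σ.p x c) - q with hf
  have hfI : f ∈ σ.I := by
    refine RingHom.mem_ker.2 ?_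
    rw [hf, map_sub, hqc]
    exact sub_self _
  have hdf : differential (σ.pt x) f = c := by
    rw [hf, map_sub, map_sub, differential_ι, differential_algebraMap, differential_eq_zero _ hq,
      sub_zero, sub_zero]
  -- Both factors vanish at `p(x)`, so the difference has order two there and its differential `w c
  -- - c` is zero.
  have h4 := σ.symAct_sub_mem_ker_pt_mul hc hρ h (w := ⟨w, w.2.1⟩) hwx hfI
  have h5 := differential_eq_zero (σ.pt x) (by
    rw [pow_two]
    exact Ideal.mul_mono_right (σ.I_le_ker_pt x) h4)
  rw [map_sub, differential_symAct, hdf, sub_eq_zero] at h5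
  · exact h5
  · intro g
    rw [pt_symAct_mk]
    have h6 : (w : V ≃ₗ[k] V)⁻¹ x = x :=
      P.fix_apply (Set.mem_singleton x) _ ((P.fix {x}).W.inv_mem w.2)
    exact congrArg (fun y => σ.pt y g) h6

include hc hρ in
theorem isReflection_cotRepZero_fixMap_iff
    (h : ∀ γ : P.Quot, ∀ f ∈ σ.I, symAct P.cotRepZero γ f - f ∈ P.augIdeal * σ.I)
    (γ : (P.fix {x}).Quot) :
    IsReflection (P.cotRepZero (P.fixMap {x} γ)) ↔
      IsReflection ((P.fix {x}).quotCotRep x (P.fix_apply (Set.mem_singleton x)) γ) :=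
  isReflection_iff_of_surjective (r := P.cotRepZero)
    (r' := (P.fix {x}).quotCotRep x (P.fix_apply (Set.mem_singleton x)))
    (σ.cotangentMap_surjective hρ hc x) (σ.cotangentMap_cotRepZero x γ)
    fun _ hm => σ.cotRepZero_apply_of_cotangentMap_eq_zero hρ hc h hm γ

theorem isReflection_quotCotRep_iff (x : V) (γ : (P.fix {x}).Quot) :
    IsReflection ((P.fix {x}).quotCotRep x (P.fix_apply (Set.mem_singleton x)) γ) ↔
      IsReflection ((P.fix {x}).cotRepZero γ) :=
  isReflection_iff_of_surjective
    (r := (P.fix {x}).quotCotRep x (P.fix_apply (Set.mem_singleton x)))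
    (r' := (P.fix {x}).cotRepZero) (translCot_bijective (fix_G_apply x)).2
    ((P.fix {x}).translCot_quotCotRep x (P.fix_apply (Set.mem_singleton x)) γ)
    fun m hm => by
      rw [(map_eq_zero_iff _ (translCot_bijective (fix_G_apply x)).1).1 hm, map_zero]

end Splitting

end NormalPair

end GoodQuotient

/-! ### Stabilizers of images and isomorphisms of reflection groups. -/

namespace GoodQuotient

namespace NormalPair

variable {k V : Type*} [Field k] [CharZero k] [AddCommGroup V] [Module k V]
  [FiniteDimensional k V] {P : NormalPair k V} [Finite P.W] {ρ : kˣ →* (V ≃ₗ[k] V)}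
  (hρ : IsGrading ρ) (hc : ∀ w ∈ P.W, ∀ t : kˣ, Commute w (ρ t))

include hρ hc in
theorem IsGoodPair.isReflectionGroup_cotRepZero (h : P.IsGoodPair ρ) :
    IsReflectionGroup P.cotRepZero := by
  obtain ⟨hW, ⟨τ⟩, hτ⟩ := h
  exact τ.isReflectionGroup_cotRepZero hc hρ hW (hτ τ).2

omit [CharZero k] [FiniteDimensional k V] [Finite P.W] in
theorem quotCotRep_injective (h0 : Function.Injective P.cotRepZero) (x : V)
    (hx : ∀ w ∈ P.W, w x = x) : Function.Injective (P.quotCotRep x hx) := by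
  intro γ δ h
  refine h0 (LinearMap.ext fun c => ?_)
  obtain ⟨c, rfl⟩ := (translCot_bijective fun g hg => hx g (P.le hg)).2 c
  rw [← translCot_quotCotRep, ← translCot_quotCotRep, h]

namespace Splitting

variable (σ : P.Splitting ρ)

include hρ hc in
theorem isGoodPair_fix (hW : IsReflectionGroup ((natRep k V).comp P.W.subtype))
    (hgood : σ.IsGood) (x : V) : (P.fix {x}).IsGoodPair ρ :=
  ⟨isReflectionGroup_stabilizer hW x, nonempty_splitting (commute_of_mem_fix hc) hρ,
    fun τ => σ.isGood_fix τ hρ hc hgood⟩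

-- A class that fixes `p(S)` fixes `p(x)`, hence is represented by an element of the stabilizer of
-- `x`, which by `hS` is that of `S`. Both points and subspaces are covered.
include hρ hc in
theorem exists_mulEquiv {S : Set V} {x : V} (hx : x ∈ S) (hS : P.fix {x} = P.fix S) :
    ∃ e : (P.fix S).Quot ≃* P.quotStab (σ.p '' S), ∀ γ, (e γ : P.Quot) = P.fixMap S γ := by
  refine ⟨MulEquiv.ofBijective (σ.toQuotStab S) ⟨fun γ δ h => ?_, fun γ => ?_⟩, fun γ => rfl⟩
  · exact fixMap_injective S (congrArg Subtype.val h)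
  · obtain ⟨w, hwx, hw⟩ := σ.exists_mk_eq_of_mem_quotStab hρ hc (x := x) (γ := γ)
      (γ.2 _ ⟨x, hx, rfl⟩)
    have hwS : (w : V ≃ₗ[k] V) ∈ (P.fix S).W := by
      rw [← hS]
      refine ⟨w.2, (mem_fixingSubgroup_iff _).2 fun y hy => ?_⟩
      rw [Set.mem_singleton_iff.1 hy]
      exact hwx
    exact ⟨QuotientGroup.mk ⟨w, hwS⟩, Subtype.ext hw⟩

include σ hρ hc in
theorem quotStabRep_injective (S : Set (Tangent P.G 0)) :
    Function.Injective (P.quotStabRep S) := by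
  have h := dual_injective_iff.2 (σ.cotRepZero_injective hc hρ)
  exact h.comp Subtype.val_injective

include hρ hc in
theorem isReflectionIso_tangentRep (hgood : σ.IsGood) {x : V} (hx : (P.fix {x}).IsGoodPair ρ)
    {S : Set (Tangent P.G 0)} (e : (P.fix {x}).Quot ≃* P.quotStab S)
    (he : ∀ γ, (e γ : P.Quot) = P.fixMap {x} γ) :
    IsReflectionIso ((P.fix {x}).tangentRep x (P.fix_apply (Set.mem_singleton x)))
      (P.quotStabRep S) e := by
  have h0 := hx.isReflectionGroup_cotRepZero hρ (commute_of_mem_fix hc)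
  -- The reflection group property is known at the origin; translation carries it to the cotangent
  -- space at `x`.
  have h1 := isReflectionIso_of_iff (MulEquiv.refl _) h0
    (quotCotRep_injective h0.1 x (P.fix_apply (Set.mem_singleton x)))
    fun γ => (isReflection_quotCotRep_iff x γ).symm
  refine isReflectionIso_of_iff e (isReflectionGroup_dual_iff.2 h1.2.1)
    (σ.quotStabRep_injective hρ hc S) fun γ => ?_
  have h2 : P.quotStabRep S (e γ) = P.cotRepZero.dual (P.fixMap {x} γ) := by
    rw [← he]; rfl
  rw [h2, isReflection_dual_iff, σ.isReflection_cotRepZero_fixMap_iff hρ hc hgood.2]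
  exact isReflection_dual_iff γ

-- The quotient group and the cotangent space depend on the pair, so the equality of pairs is
-- eliminated by substitution, with a general `Q` and representatives in place of classes.
include hρ hc in
theorem isReflection_cotRepZero_iff (hgood : σ.IsGood) {x : V} {Q : NormalPair k V}
    (hQ : P.fix {x} = Q) (w : Q.W) (hw : (w : V ≃ₗ[k] V) ∈ P.W) :
    IsReflection (Q.cotRepZero (QuotientGroup.mk w)) ↔
      IsReflection (P.cotRepZero (QuotientGroup.mk ⟨w, hw⟩)) := by
  subst hQ
  rw [← isReflection_quotCotRep_iff x, ← σ.isReflection_cotRepZero_fixMap_iff hρ hc hgood.2]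
  rfl

include hρ hc in
theorem isReflectionIso_tangentRepZero (hgood : σ.IsGood) {x : V} {S : Set V}
    (hS : P.fix {x} = P.fix S) (hx : (P.fix S).IsGoodPair ρ)
    {T : Set (Tangent P.G 0)} (e : (P.fix S).Quot ≃* P.quotStab T)
    (he : ∀ γ, (e γ : P.Quot) = P.fixMap S γ) :
    IsReflectionIso (P.fix S).tangentRepZero (P.quotStabRep T) e := by
  have h0 := hx.isReflectionGroup_cotRepZero hρ (commute_of_mem_fix hc)
  refine isReflectionIso_of_iff e (isReflectionGroup_dual_iff.2 h0)
    (σ.quotStabRep_injective hρ hc T) fun γ => ?_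
  have h2 : P.quotStabRep T (e γ) = P.cotRepZero.dual (P.fixMap S γ) := by
    rw [← he]; rfl
  rw [h2, isReflection_dual_iff]
  refine (isReflection_dual_iff γ).trans ?_
  obtain ⟨w, rfl⟩ := QuotientGroup.mk_surjective γ
  exact σ.isReflection_cotRepZero_iff hρ hc hgood hS w w.2.1

end Splitting

end NormalPair

end GoodQuotient

end

open GoodQuotient in
theorem mainTheorem9 {k V : Type*} [Field k] [CharZero k] [AddCommGroup V] [Module k V]
    [FiniteDimensional k V]
    -- a grading of `V`, a finite reflection group `P.W` of graded automorphisms,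
    -- a normal subgroup `P.G`
    (ρ : kˣ →* (V ≃ₗ[k] V)) (hρ : IsGrading ρ)
    (P : NormalPair k V) (hfin : Finite P.W)
    (hgr : ∀ w ∈ P.W, ∀ t : kˣ, Commute w (ρ t))
    (hW : IsReflectionGroup ((natRep k V).comp P.W.subtype))
    -- the embedding of `V/G` in its tangent space at the image of `0`
    (σ : P.Splitting ρ) (hgood : σ.IsGood) :
    -- points
    (∀ x : V,
      (P.fix {x}).IsGoodPair ρ ∧
      Function.Injective (σ.tangentMap x) ∧
      ∃ e : (P.fix {x}).Quot ≃* P.quotStab {σ.p x},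
        (∀ γ, (e γ : P.Quot) = P.fixMap {x} γ) ∧
        (∀ γ τ, σ.tangentMap x
            ((P.fix {x}).tangentRep x (P.fix_apply (Set.mem_singleton x)) γ τ)
          = P.quotStabRep {σ.p x} (e γ) (σ.tangentMap x τ)) ∧
        IsReflectionIso ((P.fix {x}).tangentRep x (P.fix_apply (Set.mem_singleton x)))
          (P.quotStabRep {σ.p x}) e) ∧
    -- subspaces
    (∀ L : Submodule k V,
      (P.fix (L : Set V)).IsGoodPair ρ ∧
      ∃ e : (P.fix (L : Set V)).Quot ≃* P.quotStab (σ.p '' (L : Set V)),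
        (∀ γ, (e γ : P.Quot) = P.fixMap (L : Set V) γ) ∧
        IsReflectionIso (P.fix (L : Set V)).tangentRepZero
          (P.quotStabRep (σ.p '' (L : Set V))) e) := by
  have hpt := σ.isGoodPair_fix hρ hgr hW hgood
  refine ⟨fun x => ⟨hpt x, ?_, ?_⟩, fun L => ?_⟩
  · exact LinearMap.dualMap_injective_of_surjective (σ.cotangentMap_surjective hρ hgr x)
  · have h := σ.exists_mulEquiv hρ hgr (Set.mem_singleton x) rfl
    rw [Set.image_singleton] at h
    obtain ⟨e, he⟩ := h
    refine ⟨e, he, fun γ τ => ?_, σ.isReflectionIso_tangentRep hρ hgr hgood (hpt x) e he⟩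
    have h1 : P.quotStabRep {σ.p x} (e γ) = P.cotRepZero.dual (P.fixMap {x} γ) := by
      rw [← he]; rfl
    rw [h1]
    ext1 c
    change τ ((P.fix {x}).quotCotRep x _ γ⁻¹ (σ.cotangentMap x c))
      = τ (σ.cotangentMap x (P.cotRepZero (P.fixMap {x} γ)⁻¹ c))
    rw [← map_inv, σ.cotangentMap_cotRepZero]
  -- A point of `L` with the same stabilizers as `L` reduces this case to the previous one, except
  -- that the tangent space is now taken at the image of `0`.
  · obtain ⟨x, hxL, hx⟩ := P.exists_fix_singleton_eq L
    have hL : (P.fix (L : Set V)).IsGoodPair ρ := hx ▸ hpt x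
    obtain ⟨e, he⟩ := σ.exists_mulEquiv hρ hgr hxL hx
    exact ⟨hL, e, he, σ.isReflectionIso_tangentRepZero hρ hgr hgood hx hL e he⟩
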